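/- **Setting.** Let $(\mathcal M,g_{ab})$ be a smooth oriented Ricci-flat Riemannian $4$-manifold with volume form $\epsilon_{abcd}$, Levi-Civita derivative $\nabla$ and curvature conventions $R_{abc}{}^d\nu_d=(\nabla_a\nabla_b-\nabla_b\nabla_a)\nu_c$, $R_{ab}=R^c{}_{acb}$, and let $\xi^a$ be a Killing field. Put $\lambda=\xi_a\xi^a$, $F_{ab}=\nabla_a\xi_b$, and, for each sign $\pm$, $$\mathcal F^\pm_{ab}=F_{ab}\pm\tfrac12\epsilon_{ab}{}^{cd}F_{cd},\quad (\mathcal F^\pm)^2=\mathcal F^\pm_{ab}\mathcal F^{\pm ab},\quad \sigma^\pm_a=2\mathcal F^\pm_{ab}\xi^b,\quad \omega_a=\epsilon_{abcd}\xi^bF^{cd}.$$ Suppose there is a smooth function $\omega$ with $\nabla_a\omega=\omega_a$ (a twist potential), and let $\mathcal E^\pm=\lambda\pm\omega$ (Ernst potentials, so that $\nabla_a\mathcal E^\pm=\sigma_a^\pm$). Let $W_{abcd}$ be the Weyl tensor, $\mathcal W^\pm_{abcd}=W_{abcd}\pm\frac12\epsilon_{cd}{}^{ef}W_{abef}$,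 $\mathcal I^\pm_{abcd}=\frac14(g_{ac}g_{bd}-g_{ad}g_{bc}\pm\epsilon_{abcd})$, and, where $\mathcal E^\pm\ne1$, $$\mathcal S^\pm_{abcd}=\mathcal W^\pm_{abcd}-\frac{6\bigl(\mathcal F^\pm_{ab}\mathcal F^\pm_{cd}-\frac13(\mathcal F^\pm)^2\mathcal I^\pm_{abcd}\bigr)}{1-\mathcal E^\pm},\qquad |\mathbf s^\pm|=\Bigl(\frac{(\mathcal F^\pm)^2}{(1-\mathcal E^\pm)^4}\Bigr)^{1/2}.$$ Put $(\mathcal S^\pm)^2=\mathcal S^\pm_{abcd}\mathcal S^{\pm abcd}$ and $(\mathcal F^\pm\mathcal S^\pm)^2=\mathcal F^{\pm ab}\mathcal S^{\pm ef}{}_{ab}\mathcal F^{\pm cd}\mathcal S^\pm_{efcd}$. With $$J_T^a=\frac{\sigma^{-a}-\sigma^{+a}}{2\lambda^2},\quad J_D^a=\frac{\mathcal E^+\sigma^{-a}+\mathcal E^-\sigma^{+a}}{2\lambda^2},\quad J_E^a=\frac{(\mathcal E^+)^2\sigma^{-a}-(\mathcal E^-)^2\sigma^{+a}}{2\lambda^2},\quad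 J^{\pm a}=\pm J_T^a-2J_D^a\pm J_E^a,$$ define for $\beta\in\mathbb R$ $$V^\pm(\beta)=\frac{\beta\lambda\bigl((\mathcal F^\pm)^2(\mathcal S^\pm)^2+(\beta-2)(\mathcal F^\pm\mathcal S^\pm)^2\bigr)}{4((\mathcal F^\pm)^2)^2},\qquad \Psi^{\pm(\beta)a}=\tfrac12J^{\pm a}|\mathbf s^\pm|^\beta+\frac{(1+\mathcal E^\mp)(1-\mathcal E^\pm)}{2\lambda}\nabla^a|\mathbf s^\pm|^\beta .$$ **Definitions.** A complete Riemannian $4$-manifold $(\mathcal M,g)$ is *ALF* if the complement of a compact set is diffeomorphic to an end $(A,\infty)\times L$, $A>0$, whose coordinate $r\in(A,\infty)$ tends to infinity exactly at infinity in $\mathcal M$, where $L$ is $S^1\times S^2$, $S^3$ or a finite quotient thereof; $L$ carries a $1$-form $\eta$, a vector field $T$ with $\eta(T)=1$, $i_Td\eta=0$, and a $T$-invariant metric $\gamma$ on $\ker\eta$ (extended by $\gamma(T,\cdot)=0$) of constant transverse curvature $+1$; and on the end $g=\mathring g+h$, $\mathring g=dr^2+r^2\gamma+\eta^2$, where for each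 $k\ge0$ there is $C_k$ with $|\mathring\nabla^kh|_{\mathring g}\le C_kr^{-1-k}$. An *ALF $S^1$-instanton* is a connected Ricci-flat ALF manifold with an effective smooth $S^1$-action by isometries generated by a Killing field $\xi$ of uniformly bounded norm. We say that $\mathcal W^\pm$ is *algebraically special* at a point if the endomorphism $\varphi_{ab}\mapsto\mathcal W^\pm_{ab}{}^{cd}\varphi_{cd}$ of the space of two-forms $\varphi$ with $\varphi_{ab}=\pm\frac12\epsilon_{ab}{}^{cd}\varphi_{cd}$ has an eigenvalue of multiplicity at least $2$. **Statement.** For each sign $\pm$ the following hold. 1. For every $\beta\in\mathbb R$, at every point where $\lambda\neq0$, $\mathcal F^\pm\ne0$ and $\mathcal E^\pm\ne1$, the vector field $\Psi^{\pm(\beta)}$ is differentiable and $$\nabla_a\Psi^{\pm(\beta)a}=\frac{(1+\mathcal E^\mp)(1-\mathcal E^\pm)}{2\lambda}V^\pm(\beta)\,|\mathbf s^\pm|^\beta .$$ 2. For every $\beta\ge\frac12$, $V^\pm(\beta)\ge0$ at every point where $\mathcal F^\pm\ne0$ and $\mathcal E^\pm\neq1$. 3. Suppose in addition that $(\mathcal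 M,g_{ab})$ is an ALF $S^1$-instanton with generating Killing field $\xi^a$, normalized so that $\sup_{\mathcal M}\lambda=1$ and $\omega\to0$ at infinity. Then at every point where $\lambda\ne0$ and $\mathcal F^\pm\neq0$ one has $\mathcal E^\pm\neq1$, the field $\Psi^{\pm a}=\Psi^{\pm(1)a}$ is differentiable, $$\nabla_a\Psi^{\pm a}=\frac{(1+\mathcal E^\mp)(1-\mathcal E^\pm)}{2\lambda}\cdot\frac{\lambda\bigl((\mathcal F^\pm)^2(\mathcal S^\pm)^2-(\mathcal F^\pm\mathcal S^\pm)^2\bigr)}{4((\mathcal F^\pm)^2)^2}\,|\mathbf s^\pm|\ \ge\ 0,$$ and equality $\nabla_a\Psi^{\pm a}=0$ holds at such a point only if $\mathcal W^\pm_{abcd}$ is algebraically special there. -/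

import Mathlib

open Set Filter Topology Bundle
open scoped Manifold ContDiff

noncomputable section

namespace ALFInst

/-- The coordinate space `ℝⁿ`. -/
abbrev Eucl (n : ℕ) : Type := EuclideanSpace ℝ (Fin n)

/-! ### Tensor calculus in a coordinate domain of `ℝⁿ`

A metric is given by its component functions `g x a b`.  Index conventions:
`R_abc^d ν_d = (∇_a ∇_b - ∇_b ∇_a) ν_c`, `R_ab = R^c_acb`, so round spheres have positive Ricci
curvature. -/

section Coordinates

variable {n : ℕ}

/-- Partial derivative `∂_i f`. -/
def pd (i : Fin n) (f : Eucl n → ℝ) (x : Eucl n) : ℝ :=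
  fderiv ℝ f x (EuclideanSpace.single i 1)

/-- Inverse metric `g^{ab}`. -/
def ginv (g : Eucl n → Fin n → Fin n → ℝ) (x : Eucl n) (a b : Fin n) : ℝ :=
  (Matrix.of (g x))⁻¹ a b

/-- Christoffel symbols `Γ^c_ab` of the Levi-Civita connection. -/
def chr (g : Eucl n → Fin n → Fin n → ℝ) (x : Eucl n) (c a b : Fin n) : ℝ :=
  (1 / 2) * ∑ d, ginv g x c d *
    (pd a (fun y => g y b d) x + pd b (fun y => g y a d) x - pd d (fun y => g y a b) x)

/-- `R_abc^d`, defined by `R_abc^d ν_d = (∇_a ∇_b - ∇_b ∇_a) ν_c`. -/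
def riemUp (g : Eucl n → Fin n → Fin n → ℝ) (x : Eucl n) (a b c d : Fin n) : ℝ :=
  pd b (fun y => chr g y d a c) x - pd a (fun y => chr g y d b c) x
    + ∑ e, (chr g x e a c * chr g x d b e - chr g x e b c * chr g x d a e)

/-- `R_abcd`. -/
def riem (g : Eucl n → Fin n → Fin n → ℝ) (x : Eucl n) (a b c d : Fin n) : ℝ :=
  ∑ e, riemUp g x a b c e * g x e d

/-- Ricci tensor `R_ab = R^c_acb`. -/
def ric (g : Eucl n → Fin n → Fin n → ℝ) (x : Eucl n) (a b : Fin n) : ℝ :=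
  ∑ c, ∑ d, ginv g x c d * riem g x d a c b

/-- Scalar curvature. -/
def scal (g : Eucl n → Fin n → Fin n → ℝ) (x : Eucl n) : ℝ :=
  ∑ a, ∑ b, ginv g x a b * ric g x a b

/-- Covariant derivative `∇_a ν_b` of a covector field. -/
def covDer1 (g : Eucl n → Fin n → Fin n → ℝ) (ν : Eucl n → Fin n → ℝ) (x : Eucl n)
    (a b : Fin n) : ℝ :=
  pd a (fun y => ν y b) x - ∑ c, chr g x c a b * ν x c

/-- Divergence `∇_a X^a` of a vector field. -/
def divergence (g : Eucl n → Fin n → Fin n → ℝ) (X : Eucl n → Fin n → ℝ) (x : Eucl n) : ℝ :=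
  ∑ a, (pd a (fun y => X y a) x + ∑ b, chr g x a a b * X x b)

/-- `v_a = g_ab v^b`. -/
def lower1 (g : Eucl n → Fin n → Fin n → ℝ) (x : Eucl n) (v : Fin n → ℝ) (a : Fin n) : ℝ :=
  ∑ b, g x a b * v b

/-- `v^a = g^{ab} v_b`. -/
def raise1 (g : Eucl n → Fin n → Fin n → ℝ) (x : Eucl n) (v : Fin n → ℝ) (a : Fin n) : ℝ :=
  ∑ b, ginv g x a b * v b

/-- `t^{ab} = g^{ac} g^{bd} t_cd`. -/
def raise2 (g : Eucl n → Fin n → Fin n → ℝ) (x : Eucl n) (t : Fin n → Fin n → ℝ)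
    (a b : Fin n) : ℝ :=
  ∑ c, ∑ d, ginv g x a c * ginv g x b d * t c d

/-- `t_ab t^{ab}`. -/
def normSq2 (g : Eucl n → Fin n → Fin n → ℝ) (x : Eucl n) (t : Fin n → Fin n → ℝ) : ℝ :=
  ∑ a, ∑ b, t a b * raise2 g x t a b

/-- `t_abcd t^{abcd}`. -/
def normSq4 (g : Eucl n → Fin n → Fin n → ℝ) (x : Eucl n)
    (t : Fin n → Fin n → Fin n → Fin n → ℝ) : ℝ :=
  ∑ a, ∑ b, ∑ c, ∑ d, t a b c d *
    raise2 g x (fun a' b' => raise2 g x (fun c' d' => t a' b' c' d') c d) a b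

/-- Covariant derivative of a covariant tensor field of arbitrary rank `k`; the new index
(the direction of differentiation) comes first. -/
def covD (g : Eucl n → Fin n → Fin n → ℝ) {k : ℕ} (t : Eucl n → (Fin k → Fin n) → ℝ)
    (x : Eucl n) (I : Fin (k + 1) → Fin n) : ℝ :=
  pd (I 0) (fun y => t y (Fin.tail I)) x
    - ∑ m : Fin k, ∑ l, chr g x l (I 0) (I m.succ) * t x (Function.update (Fin.tail I) m l)

/-- Iterated covariant derivative `∇^k h` of a covariant 2-tensor field. -/
def covDIter (g h : Eucl n → Fin n → Fin n → ℝ) :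
    (k : ℕ) → Eucl n → (Fin (2 + k) → Fin n) → ℝ
  | 0 => fun x I => h x (I 0) (I 1)
  | k + 1 => covD g (covDIter g h k)

/-- Pointwise norm of a covariant tensor. -/
def tensorNorm (g : Eucl n → Fin n → Fin n → ℝ) (x : Eucl n) {k : ℕ}
    (t : (Fin k → Fin n) → ℝ) : ℝ :=
  Real.sqrt (∑ I, ∑ J, (∏ m, ginv g x (I m) (J m)) * t I * t J)

end Coordinates

/-! ### Four-dimensional geometry with a vector field, in an oriented coordinate domain -/

/-- The permutation symbol `[abcd]`, with `[0123] = 1`. -/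
def permSymbol (a b c d : Fin 4) : ℝ :=
  Matrix.det (Matrix.of fun i j : Fin 4 => if ![a, b, c, d] i = j then (1 : ℝ) else 0)

/-- Volume form `ε_abcd` of the metric in positively oriented coordinates. -/
def vol (g : Eucl 4 → Fin 4 → Fin 4 → ℝ) (x : Eucl 4) (a b c d : Fin 4) : ℝ :=
  Real.sqrt (Matrix.of (g x)).det * permSymbol a b c d

/-- Weyl tensor `W_abcd` of a four-dimensional metric. -/
def weyl (g : Eucl 4 → Fin 4 → Fin 4 → ℝ) (x : Eucl 4) (a b c d : Fin 4) : ℝ :=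
  riem g x a b c d
    - (1 / 2) * (g x a c * ric g x b d - g x a d * ric g x b c
        - g x b c * ric g x a d + g x b d * ric g x a c)
    + (scal g x / 6) * (g x a c * g x b d - g x a d * g x b c)

/-- Component functions, in positively oriented coordinates, of a metric `g_ab`, a vector
field `ξ^a` and a function `om` (the twist potential `ω`). -/
structure Coords where
  g : Eucl 4 → Fin 4 → Fin 4 → ℝ
  ξ : Eucl 4 → Fin 4 → ℝ
  om : Eucl 4 → ℝ

/-- The real number `±1` of a sign. -/
def sgn (s : ℤˣ) : ℝ := ((s : ℤ) : ℝ)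

namespace Coords

variable (C : Coords)

/-- `λ = ξ_a ξ^a`. -/
def lam (x : Eucl 4) : ℝ := ∑ a, lower1 C.g x (C.ξ x) a * C.ξ x a

/-- `F_ab = ∇_a ξ_b`. -/
def F (x : Eucl 4) (a b : Fin 4) : ℝ := covDer1 C.g (fun y => lower1 C.g y (C.ξ y)) x a b

/-- `𝓕^±_ab = F_ab ± ½ ε_ab^{cd} F_cd`. -/
def SF (s : ℤˣ) (x : Eucl 4) (a b : Fin 4) : ℝ :=
  C.F x a b + sgn s * (1 / 2) * ∑ c, ∑ d, vol C.g x a b c d * raise2 C.g x (C.F x) c d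

/-- `(𝓕^±)² = 𝓕^±_ab 𝓕^{±ab}`. -/
def SFsq (s : ℤˣ) (x : Eucl 4) : ℝ := normSq2 C.g x (C.SF s x)

/-- `σ^±_a = 2 𝓕^±_ab ξ^b`. -/
def sigma (s : ℤˣ) (x : Eucl 4) (a : Fin 4) : ℝ := 2 * ∑ b, C.SF s x a b * C.ξ x b

/-- Twist one-form `ω_a = ε_abcd F^{cd} ξ^b`. -/
def twist (x : Eucl 4) (a : Fin 4) : ℝ :=
  ∑ b, ∑ c, ∑ d, vol C.g x a b c d * raise2 C.g x (C.F x) c d * C.ξ x b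

/-- Ernst potentials `𝓔^± = λ ± ω`. -/
def E (s : ℤˣ) (x : Eucl 4) : ℝ := C.lam x + sgn s * C.om x

/-- `𝓦^±_abcd = W_abcd ± ½ ε_cd^{ef} W_abef`. -/
def SW (s : ℤˣ) (x : Eucl 4) (a b c d : Fin 4) : ℝ :=
  weyl C.g x a b c d
    + sgn s * (1 / 2) * ∑ e, ∑ f, vol C.g x c d e f * raise2 C.g x (weyl C.g x a b) e f

/-- `𝓘^±_abcd = ¼ (g_ac g_bd - g_ad g_bc ± ε_abcd)`. -/
def II (s : ℤˣ) (x : Eucl 4) (a b c d : Fin 4) : ℝ :=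
  (1 / 4) * (C.g x a c * C.g x b d - C.g x a d * C.g x b c + sgn s * vol C.g x a b c d)

/-- `𝓢^±_abcd = 𝓦^±_abcd - 6 (𝓕^±_ab 𝓕^±_cd - ⅓ (𝓕^±)² 𝓘^±_abcd) / (1 - 𝓔^±)`. -/
def S (s : ℤˣ) (x : Eucl 4) (a b c d : Fin 4) : ℝ :=
  C.SW s x a b c d
    - 6 * (C.SF s x a b * C.SF s x c d - (1 / 3) * C.SFsq s x * C.II s x a b c d)
      / (1 - C.E s x)

/-- `(𝓢^±)² = 𝓢^±_abcd 𝓢^{±abcd}`. -/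
def Ssq (s : ℤˣ) (x : Eucl 4) : ℝ := normSq4 C.g x (C.S s x)

/-- `(𝓕^± 𝓢^±)² = 𝓕^{ab} 𝓢^{ef}_ab 𝓕^{cd} 𝓢_efcd`. -/
def FSsq (s : ℤˣ) (x : Eucl 4) : ℝ :=
  normSq2 C.g x (fun e f => ∑ a, ∑ b, C.S s x e f a b * raise2 C.g x (C.SF s x) a b)

/-- `|s^±|`, where `(s^±)² = (𝓕^±)² / (1 - 𝓔^±)⁴`. -/
def sAbs (s : ℤˣ) (x : Eucl 4) : ℝ := Real.sqrt (C.SFsq s x / (1 - C.E s x) ^ 4)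

/-- `V^±(β) = β λ ((𝓕^±)² (𝓢^±)² + (β - 2) (𝓕^± 𝓢^±)²) / (4 ((𝓕^±)²)²)`. -/
def V (s : ℤˣ) (β : ℝ) (x : Eucl 4) : ℝ :=
  β * C.lam x * (C.SFsq s x * C.Ssq s x + (β - 2) * C.FSsq s x) / (4 * (C.SFsq s x) ^ 2)

/-- `σ^{±a}`. -/
def sigmaUp (s : ℤˣ) (x : Eucl 4) (a : Fin 4) : ℝ := raise1 C.g x (C.sigma s x) a

/-- Translation current `J_T^a`. -/
def JT (x : Eucl 4) (a : Fin 4) : ℝ :=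
  (C.sigmaUp (-1) x a - C.sigmaUp 1 x a) / (2 * C.lam x ^ 2)

/-- Dilation current `J_D^a`. -/
def JD (x : Eucl 4) (a : Fin 4) : ℝ :=
  (C.E 1 x * C.sigmaUp (-1) x a + C.E (-1) x * C.sigmaUp 1 x a) / (2 * C.lam x ^ 2)

/-- Ehlers current `J_E^a`. -/
def JE (x : Eucl 4) (a : Fin 4) : ℝ :=
  (C.E 1 x ^ 2 * C.sigmaUp (-1) x a - C.E (-1) x ^ 2 * C.sigmaUp 1 x a) / (2 * C.lam x ^ 2)

/-- `J^{±a} = ± J_T^a - 2 J_D^a ± J_E^a`. -/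
def J (s : ℤˣ) (x : Eucl 4) (a : Fin 4) : ℝ :=
  sgn s * C.JT x a - 2 * C.JD x a + sgn s * C.JE x a

/-- The current
`Ψ^{±(β)a} = ½ J^{±a} |s^±|^β + ((1 + 𝓔^∓) (1 - 𝓔^±) / (2 λ)) ∇^a |s^±|^β`. -/
def Psi (s : ℤˣ) (β : ℝ) (x : Eucl 4) (a : Fin 4) : ℝ :=
  (1 / 2) * C.J s x a * C.sAbs s x ^ β
    + (1 + C.E (-s) x) * (1 - C.E s x) / (2 * C.lam x)
      * raise1 C.g x (fun b => pd b (fun y => C.sAbs s y ^ β) x) a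

/-- `φ_ab` is a two-form with `φ_ab = ± ½ ε_ab^{cd} φ_cd`. -/
def IsSelfDual (s : ℤˣ) (x : Eucl 4) (φ : Fin 4 → Fin 4 → ℝ) : Prop :=
  (∀ a b, φ a b = - φ b a) ∧
  ∀ a b, φ a b = sgn s * (1 / 2) * ∑ c, ∑ d, vol C.g x a b c d * raise2 C.g x φ c d

/-- `𝓦^±` is algebraically special at `x` (Petrov type `D` or `O`): the endomorphism
`φ_ab ↦ 𝓦^±_ab^{cd} φ_cd` of the three-dimensional space of (anti-)self-dual two-forms has an
eigenvalue of multiplicity at least two. -/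
def IsAlgSpecial (s : ℤˣ) (x : Eucl 4) : Prop :=
  ∃ (μ : ℝ) (φ ψ : Fin 4 → Fin 4 → ℝ), LinearIndependent ℝ ![φ, ψ] ∧
    C.IsSelfDual s x φ ∧ C.IsSelfDual s x ψ ∧
    (∀ a b, ∑ c, ∑ d, C.SW s x a b c d * raise2 C.g x φ c d = μ * φ a b) ∧
    (∀ a b, ∑ c, ∑ d, C.SW s x a b c d * raise2 C.g x ψ c d = μ * ψ a b)

end Coords

/-! ### Coordinate components of objects on a manifold -/

section Components

variable {n : ℕ} {M : Type*} [TopologicalSpace M] [ChartedSpace (Eucl n) M]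

/-- A smooth Riemannian metric on an `n`-manifold. -/
abbrev Metric (n : ℕ) (M : Type*) [TopologicalSpace M] [ChartedSpace (Eucl n) M]
    [IsManifold (𝓡 n) ∞ M] : Type _ :=
  ContMDiffRiemannianMetric (𝓡 n) ∞ (Eucl n) (fun p : M => TangentSpace (𝓡 n) p)

/-- The coordinate vector field `∂_a` of a local parametrization `f` of `M`. -/
def coordVec {m : ℕ} (f : Eucl m → M) (x : Eucl m) (a : Fin m) : TangentSpace (𝓡 n) (f x) :=
  mfderiv (𝓡 m) (𝓡 n) f x (EuclideanSpace.single a (1 : ℝ) : Eucl m)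

/-- Components `η_a = η(∂_a)` of a one-form in a chart. -/
def comp1 (η : ∀ p : M, TangentSpace (𝓡 n) p →L[ℝ] ℝ) (e : OpenPartialHomeomorph M (Eucl n))
    (x : Eucl n) (a : Fin n) : ℝ :=
  η (e.symm x) (coordVec e.symm x a)

/-- Components `h_ab = h(∂_a, ∂_b)` of a bilinear form field in a parametrization. -/
def comp2 {m : ℕ} (h : ∀ p : M, TangentSpace (𝓡 n) p →L[ℝ] TangentSpace (𝓡 n) p →L[ℝ] ℝ)
    (f : Eucl m → M) (x : Eucl m) (a b : Fin m) : ℝ :=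
  h (f x) (coordVec f x a) (coordVec f x b)

/-- Components `X^a = dx^a(X)` of a vector field in a chart. -/
def compV (X : ∀ p : M, TangentSpace (𝓡 n) p) (e : OpenPartialHomeomorph M (Eucl n))
    (x : Eucl n) (a : Fin n) : ℝ :=
  let v : Eucl n := mfderiv (𝓡 n) (𝓡 n) e (e.symm x) (X (e.symm x))
  v a

end Components

section Manifold

variable {M : Type*} [TopologicalSpace M] [ChartedSpace (Eucl 4) M] [IsManifold (𝓡 4) ∞ M]

/-- An orientation of a four-manifold, given by an oriented atlas. -/
structure OrientedAtlas (M : Type*) [TopologicalSpace M] [ChartedSpace (Eucl 4) M] where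
  charts : Set (OpenPartialHomeomorph M (Eucl 4))
  subset_maximalAtlas : charts ⊆ IsManifold.maximalAtlas (𝓡 4) ∞ M
  covers : ∀ p : M, ∃ e ∈ charts, p ∈ e.source
  det_pos : ∀ e ∈ charts, ∀ e' ∈ charts, ∀ p ∈ e.source ∩ e'.source,
    0 < (fderiv ℝ (fun x => e' (e.symm x)) (e p)).det

/-- The component functions of `(g, ξ, om)` in a chart. -/
def coords (g : Metric 4 M) (ξ : ∀ p : M, TangentSpace (𝓡 4) p) (om : M → ℝ)
    (e : OpenPartialHomeomorph M (Eucl 4)) : Coords where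
  g := comp2 g.inner e.symm
  ξ := compV ξ e
  om := fun x => om (e.symm x)

/-- `g` is Ricci-flat. -/
def IsRicciFlat (g : Metric 4 M) : Prop :=
  ∀ e ∈ IsManifold.maximalAtlas (𝓡 4) ∞ M, ∀ x ∈ e.target, ∀ a b,
    ric (comp2 g.inner e.symm) x a b = 0

/-- `ξ` is a smooth vector field with `∇_a ξ_b + ∇_b ξ_a = 0`. -/
def IsKilling (g : Metric 4 M) (ξ : ∀ p : M, TangentSpace (𝓡 4) p) : Prop :=
  ContMDiff (𝓡 4) ((𝓡 4).prod 𝓘(ℝ, Eucl 4)) ∞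
      (fun p => (TotalSpace.mk' (Eucl 4) p (ξ p) : TangentBundle (𝓡 4) M)) ∧
  ∀ e ∈ IsManifold.maximalAtlas (𝓡 4) ∞ M, ∀ x ∈ e.target, ∀ a b,
    (coords g ξ 0 e).F x a b + (coords g ξ 0 e).F x b a = 0

/-- `om` is a twist potential of `ξ`: a smooth function with `∇_a om = ω_a`. -/
def IsTwistPotential (g : Metric 4 M) (𝒪 : OrientedAtlas M)
    (ξ : ∀ p : M, TangentSpace (𝓡 4) p) (om : M → ℝ) : Prop :=
  ContMDiff (𝓡 4) 𝓘(ℝ, ℝ) ∞ om ∧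
  ∀ e ∈ 𝒪.charts, ∀ x ∈ e.target, ∀ a,
    pd a (fun y => om (e.symm y)) x = (coords g ξ om e).twist x a

/-- `(M, g)` is a complete Riemannian manifold: Cauchy sequences of the Riemannian distance
converge. -/
def IsCompleteMetric (g : Metric 4 M) : Prop :=
  letI : RiemannianBundle (fun p : M => TangentSpace (𝓡 4) p) := ⟨g.toRiemannianMetric⟩
  ∀ u : ℕ → M,
    (∀ ε > 0, ∃ N, ∀ i ≥ N, ∀ j ≥ N, Manifold.riemannianEDist (𝓡 4) (u i) (u j) < ε) →
    ∃ p, Tendsto u atTop (𝓝 p)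

/-! ### ALF manifolds -/

/-- `L` is the quotient of the manifold `P` by a finite group of diffeomorphisms acting freely. -/
def IsFiniteQuotient {B H : Type*} [NormedAddCommGroup B] [NormedSpace ℝ B] [TopologicalSpace H]
    (I : ModelWithCorners ℝ B H) (P : Type*) [TopologicalSpace P] [ChartedSpace H P]
    (L : Type*) [TopologicalSpace L] [ChartedSpace (Eucl 3) L] : Prop :=
  ∃ (Γ : Subgroup (Equiv.Perm P)) (proj : P → L), Finite Γ ∧
    (∀ φ ∈ Γ, ContMDiff I I ∞ φ) ∧ (∀ φ ∈ Γ, ∀ x, φ x = x → φ = 1) ∧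
    IsLocalDiffeomorph I (𝓡 3) ∞ proj ∧ Function.Surjective proj ∧
    ∀ x y, proj x = proj y ↔ ∃ φ ∈ Γ, φ x = y

/-- `L` is `S¹ × S²`, `S³`, or a finite quotient of one of them. -/
def IsBoundaryType (L : Type*) [TopologicalSpace L] [ChartedSpace (Eucl 3) L] : Prop :=
  IsFiniteQuotient ((𝓡 1).prod (𝓡 2))
    (Circle × Metric.sphere (0 : EuclideanSpace ℝ (Fin 3)) 1) L ∨
  IsFiniteQuotient (𝓡 3) (Metric.sphere (0 : EuclideanSpace ℝ (Fin 4)) 1) L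

/-- Last three coordinates of a point of `ℝ⁴ = ℝ × ℝ³`. -/
def tail3 (x : Eucl 4) : Eucl 3 := WithLp.toLp 2 fun i => x i.succ

/-- Components of `dr² + r² γ + η²` in the coordinates `(r, y)`, where `y` are coordinates
on `L`. -/
def ringMetric (η : Eucl 3 → Fin 3 → ℝ) (γ : Eucl 3 → Fin 3 → Fin 3 → ℝ)
    (x : Eucl 4) (a b : Fin 4) : ℝ :=
  Fin.cases (Fin.cases 1 (fun _ => 0) b)
    (fun i => Fin.cases 0
      (fun j => x 0 ^ 2 * γ (tail3 x) i j + η (tail3 x) i * η (tail3 x) j) b) a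

/-- ALF structure on `(M, g)` with boundary at infinity `L`. -/
structure ALFStructure (g : Metric 4 M) (L : Type*) [TopologicalSpace L]
    [ChartedSpace (Eucl 3) L] [IsManifold (𝓡 3) ∞ L] where
  boundaryType : IsBoundaryType L
  A : ℝ
  A_pos : 0 < A
  /-- The diffeomorphism from `(A, ∞) × L` onto the end (only its values there matter). -/
  Φ : ℝ × L → M
  Φ_localDiffeo : IsLocalDiffeomorphOn (𝓘(ℝ, ℝ).prod (𝓡 3)) (𝓡 4) ∞ Φ (Ioi A ×ˢ univ)
  Φ_inj : InjOn Φ (Ioi A ×ˢ univ)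
  /-- The sets `{r > r₀}` of the end are the neighbourhoods of infinity in `M`. -/
  Φ_end : (cocompact M).HasBasis (fun r₀ : ℝ => A < r₀) (fun r₀ => Φ '' (Ioi r₀ ×ˢ univ))
  η : ∀ y : L, TangentSpace (𝓡 3) y →L[ℝ] ℝ
  T : ∀ y : L, TangentSpace (𝓡 3) y
  /-- The metric on `ker η`, extended to `L` with kernel spanned by `T`. -/
  γ : ∀ y : L, TangentSpace (𝓡 3) y →L[ℝ] TangentSpace (𝓡 3) y →L[ℝ] ℝ
  smooth_η : ∀ e ∈ IsManifold.maximalAtlas (𝓡 3) ∞ L, ∀ i,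
    ContDiffOn ℝ ∞ (fun y => comp1 η e y i) e.target
  smooth_T : ∀ e ∈ IsManifold.maximalAtlas (𝓡 3) ∞ L, ∀ i,
    ContDiffOn ℝ ∞ (fun y => compV T e y i) e.target
  smooth_γ : ∀ e ∈ IsManifold.maximalAtlas (𝓡 3) ∞ L, ∀ i j,
    ContDiffOn ℝ ∞ (fun y => comp2 γ e.symm y i j) e.target
  η_T : ∀ y, η y (T y) = 1
  /-- `i_T dη = 0`. -/
  dη_T : ∀ e ∈ IsManifold.maximalAtlas (𝓡 3) ∞ L, ∀ y ∈ e.target, ∀ j,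
    ∑ i, compV T e y i *
      (pd i (fun z => comp1 η e z j) y - pd j (fun z => comp1 η e z i) y) = 0
  γ_symm : ∀ y u v, γ y u v = γ y v u
  γ_T : ∀ y u, γ y (T y) u = 0
  γ_pos : ∀ y u, η y u = 0 → u ≠ 0 → 0 < γ y u u
  /-- `𝓛_T γ = 0`. -/
  γ_invariant : ∀ e ∈ IsManifold.maximalAtlas (𝓡 3) ∞ L, ∀ y ∈ e.target, ∀ i j,
    ∑ k, (compV T e y k * pd k (fun z => comp2 γ e.symm z i j) y
      + comp2 γ e.symm y k j * pd i (fun z => compV T e z k) y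
      + comp2 γ e.symm y i k * pd j (fun z => compV T e z k) y) = 0
  /-- The transverse metric has Gauss curvature `+1`: in a chart in which `T = ∂/∂y²`, the
  two-dimensional metric `γ_ij dyⁱ dyʲ`, `i, j ∈ {0, 1}`, has curvature one. -/
  γ_curvature : ∀ e ∈ IsManifold.maximalAtlas (𝓡 3) ∞ L,
    (∀ y ∈ e.target, ∀ i, compV T e y i = if i = 2 then 1 else 0) →
    ∀ y ∈ e.target,
      let q : Eucl 2 → Fin 2 → Fin 2 → ℝ := fun u i j =>
        comp2 γ e.symm (WithLp.toLp 2 ![u 0, u 1, y 2]) i.castSucc j.castSucc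
      let u : Eucl 2 := WithLp.toLp 2 ![y 0, y 1]
      riem q u 0 1 0 1 = q u 0 0 * q u 1 1 - q u 0 1 ^ 2
  /-- `g = g̊ + h` on the end, with `|∇̊^k h| ≤ C_k r^{-1-k}` for all `k`. -/
  decay : ∀ k : ℕ, ∃ c : ℝ, ∀ e ∈ IsManifold.maximalAtlas (𝓡 3) ∞ L, ∀ x : Eucl 4,
    A < x 0 → tail3 x ∈ e.target →
      let g₀ : Eucl 4 → Fin 4 → Fin 4 → ℝ := ringMetric (comp1 η e) (comp2 γ e.symm)
      let h : Eucl 4 → Fin 4 → Fin 4 → ℝ := fun z a b =>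
        comp2 g.inner (fun w : Eucl 4 => Φ (w 0, e.symm (tail3 w))) z a b - g₀ z a b
      tensorNorm g₀ x (covDIter g₀ h k x) ≤ c / x 0 ^ (k + 1)

/-- `ξ` is a Killing field of uniformly bounded norm which generates the given effective smooth
action of the circle on `M` by isometries (for some parametrization of the circle with constant
speed). -/
structure GeneratesCircleAction (g : Metric 4 M) (ξ : ∀ p : M, TangentSpace (𝓡 4) p)
    [MulAction Circle M] : Prop where
  smooth : ContMDiffSMul (𝓡 1) (𝓡 4) ∞ Circle M
  effective : FaithfulSMul Circle M
  isometric : ∀ (z : Circle) (p : M) (u v : TangentSpace (𝓡 4) p),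
    g.inner (z • p) (mfderiv (𝓡 4) (𝓡 4) (fun q : M => z • q) p u)
      (mfderiv (𝓡 4) (𝓡 4) (fun q : M => z • q) p v) = g.inner p u v
  killing : IsKilling g ξ
  generates : ∃ c : ℝ, c ≠ 0 ∧ ∀ p : M, IsMIntegralCurve (fun t : ℝ => Circle.exp (c * t) • p) ξ
  bounded : ∃ B : ℝ, ∀ p, g.inner p (ξ p) (ξ p) ≤ B

end Manifold

end ALFInst

end

/-!
The proof takes place in coordinates, on the target of an oriented chart. At a point, the
(anti-)self-dual bivectors have a basis `Θ_1, Θ_2, Θ_3` obeying the quaternion relations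
(`IsSDFrame`, `IsMetricOn.exists_sdFrame`). In it `𝓕^±` is a vector `f` of `ℝ³`, and `𝓦^±` is a
symmetric trace-free `3 × 3` matrix `w`; since the metric is Ricci-flat, the curvature has no block
that mixes the two chiralities. The vectors `Θ_p^{ab} ξ_b` are orthogonal with square `λ`, so every
scalar in the statement becomes an expression in `λ`, `𝓔^±`, `f` and `w`.

*Divergence identity.* Kostant's identity `∇_a F_bc = - R_bca^d ξ_d` (`kostant_up`) and the Bianchi
identities give `∇𝓔^± = σ^±` (`pd_E`), `div σ^± = (𝓕^±)²` (`divergence_sigmaUp_eq`),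
`∇(𝓕^±)² = 4 Y` with `Y^e = R_abd^e 𝓕^{± ab} ξ^d` (`grad_SFsq`), and
`div Y = 2 λ |w|² - 4 f·wf` (`divergence_Y_eq_of_frame`). Near the point `Ψ^±` is an explicit
combination of `σ^∓`, `σ^±` and `Y` (`Psi_eq`). Its divergence is therefore a rational function of
`λ`, `𝓔^±`, `|f|²`, `f·wf`, `|wf|²`, `|w|²` and of scalars of the opposite chirality; the latter
cancel, and the rest is the claimed multiple of `V^±` (`divergence_Psi`).

*Nonnegativity.* `𝓢^±` is again symmetric and trace-free, and for such a `3 × 3` matrix `S` one has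
`|S f|² ≤ ⅔ |S|² |f|²` (`traceFree_mulVec_le`), that is,
`(𝓕^± 𝓢^±)² ≤ ⅔ (𝓕^±)² (𝓢^±)²`. For `β ≥ ½` the coefficient `β - 2` is at least `-3/2`, exactly what
the factor `⅔` compensates.

*Instantons.* The Laplacian of `𝓔^±` is `(𝓕^±)² ≥ 0`. At infinity `𝓔^± = λ ± ω` has upper limit at
most `1`, so the strong maximum principle (`not_touching`, `isOpen_setOf_eq_max`) gives `𝓔^± ≤ 1`
everywhere (`ernst_le_one`). Where `𝓔^± = 1` there is a local maximum, so the Laplacian is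
nonpositive and `𝓕^± = 0`; elsewhere, and where `λ ≠ 0`, `𝓔^∓ = 2 λ - 𝓔^± > -1`, and the coefficient
of `V^±` in the divergence is positive. If the divergence vanishes then
`(𝓕^±)² (𝓢^±)² = (𝓕^± 𝓢^±)²`, which the bound allows only for `𝓢^± = 0`, and then `𝓦^±` acts by a
scalar on the orthogonal complement of `𝓕^±` (`isAlgSpecial_of_frame`).
-/

noncomputable section

namespace ALFInst

/-! ### Partial derivatives of functions and of matrices of functions -/

section PartialDerivatives

variable {n : ℕ} {f h : Eucl n → ℝ} {x : Eucl n}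

theorem pd_congr (i : Fin n) (hfh : f =ᶠ[𝓝 x] h) : pd i f x = pd i h x := by
  unfold pd; rw [hfh.fderiv_eq]

@[fun_prop]
theorem contDiffAt_pd (i : Fin n) (hf : ContDiffAt ℝ ∞ f x) : ContDiffAt ℝ ∞ (pd i f) x := by
  unfold pd
  exact (hf.fderiv_right (m := ∞) (by simp)).clm_apply contDiffAt_const

theorem diffAt_of_smooth (hf : ContDiffAt ℝ ∞ f x) : DifferentiableAt ℝ f x :=
  hf.differentiableAt (by simp)

theorem pd_const (i : Fin n) (c : ℝ) : pd i (fun _ => c) x = 0 := by simp [pd]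

theorem pd_add (i : Fin n) (hf : DifferentiableAt ℝ f x) (hh : DifferentiableAt ℝ h x) :
    pd i (fun y => f y + h y) x = pd i f x + pd i h x := by
  unfold pd; rw [fderiv_fun_add hf hh]; rfl

theorem pd_sub (i : Fin n) (hf : DifferentiableAt ℝ f x) (hh : DifferentiableAt ℝ h x) :
    pd i (fun y => f y - h y) x = pd i f x - pd i h x := by
  unfold pd; rw [fderiv_fun_sub hf hh]; rfl

theorem pd_neg (i : Fin n) : pd i (fun y => - f y) x = - pd i f x := by
  unfold pd; rw [fderiv_fun_neg]; rfl

theorem pd_mul (i : Fin n) (hf : DifferentiableAt ℝ f x) (hh : DifferentiableAt ℝ h x) :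
    pd i (fun y => f y * h y) x = pd i f x * h x + f x * pd i h x := by
  unfold pd; rw [fderiv_fun_mul hf hh]; simp; ring

theorem pd_const_mul (i : Fin n) (c : ℝ) (hf : DifferentiableAt ℝ f x) :
    pd i (fun y => c * f y) x = c * pd i f x := by
  unfold pd; rw [fderiv_const_mul hf]; rfl

theorem pd_sum {ι : Type*} (u : Finset ι) {A : ι → Eucl n → ℝ} (i : Fin n)
    (hA : ∀ j ∈ u, DifferentiableAt ℝ (A j) x) :
    pd i (fun y => ∑ j ∈ u, A j y) x = ∑ j ∈ u, pd i (A j) x := by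
  unfold pd; rw [fderiv_fun_sum hA]; simp

/-- Chain rule for a function of one real variable. -/
theorem pd_comp (i : Fin n) {φ : ℝ → ℝ} {φ' : ℝ} (hφ : HasDerivAt φ φ' (f x))
    (hf : DifferentiableAt ℝ f x) : pd i (fun y => φ (f y)) x = φ' * pd i f x := by
  unfold pd
  have := hφ.comp_hasFDerivAt x hf.hasFDerivAt
  rw [show (fun y => φ (f y)) = φ ∘ f from rfl, this.fderiv]; rfl

theorem pd_comm (i j : Fin n) (hf : ContDiffAt ℝ ∞ f x) :
    pd i (pd j f) x = pd j (pd i f) x := by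
  have hs : IsSymmSndFDerivAt ℝ f x := hf.isSymmSndFDerivAt
    (by simpa using WithTop.coe_le_coe.2 (le_top : (2 : ℕ∞) ≤ ⊤))
  have hd : DifferentiableAt ℝ (fderiv ℝ f) x :=
    (hf.fderiv_right (m := ∞) (by simp)).differentiableAt (by simp)
  have key : ∀ a b : Fin n, pd a (pd b f) x
      = fderiv ℝ (fderiv ℝ f) x (EuclideanSpace.single a 1) (EuclideanSpace.single b 1) := by
    intro a b
    unfold pd
    rw [fderiv_clm_apply hd (differentiableAt_const _)]
    simp
  rw [key, key, hs.eq]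

end PartialDerivatives

section MatrixDerivatives

variable {n : ℕ} {ι κ μ : Type*} [Fintype κ] {x : Eucl n}

/-- Entrywise partial derivative of a matrix of functions. -/
def pdM (i : Fin n) (A : Eucl n → Matrix ι μ ℝ) (x : Eucl n) : Matrix ι μ ℝ :=
  Matrix.of fun a b => pd i (fun y => A y a b) x

/-- Entrywise smoothness at a point of a matrix of functions. -/
def SmoothM (A : Eucl n → Matrix ι μ ℝ) (x : Eucl n) : Prop :=
  ∀ a b, ContDiffAt ℝ ∞ (fun y => A y a b) x

theorem SmoothM.mul {A : Eucl n → Matrix ι κ ℝ} {B : Eucl n → Matrix κ μ ℝ}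
    (hA : SmoothM A x) (hB : SmoothM B x) : SmoothM (fun y => A y * B y) x := by
  intro a b
  simp only [Matrix.mul_apply]
  exact ContDiffAt.sum fun k _ => (hA a k).mul (hB k b)

theorem SmoothM.add {A B : Eucl n → Matrix ι μ ℝ}
    (hA : SmoothM A x) (hB : SmoothM B x) : SmoothM (fun y => A y + B y) x :=
  fun a b => (hA a b).add (hB a b)

theorem SmoothM.sub {A B : Eucl n → Matrix ι μ ℝ}
    (hA : SmoothM A x) (hB : SmoothM B x) : SmoothM (fun y => A y - B y) x :=
  fun a b => (hA a b).sub (hB a b)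

theorem SmoothM.transpose {A : Eucl n → Matrix ι μ ℝ}
    (hA : SmoothM A x) : SmoothM (fun y => (A y).transpose) x :=
  fun a b => hA b a

theorem SmoothM.pdM {A : Eucl n → Matrix ι μ ℝ} (i : Fin n)
    (hA : SmoothM A x) : SmoothM (pdM i A) x :=
  fun a b => contDiffAt_pd i (hA a b)

theorem pdM_congr {A B : Eucl n → Matrix ι μ ℝ} (i : Fin n) (h : A =ᶠ[𝓝 x] B) :
    pdM i A x = pdM i B x := by
  ext a b
  exact pd_congr i (h.mono fun y hy => congrFun₂ hy a b)

theorem pdM_const (i : Fin n) (A : Matrix ι μ ℝ) : pdM i (fun _ => A) x = 0 := by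
  ext a b
  exact pd_const i _

theorem pdM_mul {A : Eucl n → Matrix ι κ ℝ} {B : Eucl n → Matrix κ μ ℝ} (i : Fin n)
    (hA : SmoothM A x) (hB : SmoothM B x) :
    pdM i (fun y => A y * B y) x = pdM i A x * B x + A x * pdM i B x := by
  ext a b
  simp only [pdM, Matrix.of_apply, Matrix.mul_apply, Matrix.add_apply]
  rw [pd_sum _ _ fun k _ => diffAt_of_smooth ((hA a k).mul (hB k b)), ← Finset.sum_add_distrib]
  exact Finset.sum_congr rfl fun k _ =>
    pd_mul i (diffAt_of_smooth (hA a k)) (diffAt_of_smooth (hB k b))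

theorem pdM_add {A B : Eucl n → Matrix ι μ ℝ} (i : Fin n)
    (hA : SmoothM A x) (hB : SmoothM B x) :
    pdM i (fun y => A y + B y) x = pdM i A x + pdM i B x := by
  ext a b
  exact pd_add i (diffAt_of_smooth (hA a b)) (diffAt_of_smooth (hB a b))

theorem pdM_sub {A B : Eucl n → Matrix ι μ ℝ} (i : Fin n)
    (hA : SmoothM A x) (hB : SmoothM B x) :
    pdM i (fun y => A y - B y) x = pdM i A x - pdM i B x := by
  ext a b
  exact pd_sub i (diffAt_of_smooth (hA a b)) (diffAt_of_smooth (hB a b))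

theorem pdM_neg {A : Eucl n → Matrix ι μ ℝ} (i : Fin n) :
    pdM i (fun y => -(A y)) x = - pdM i A x := by
  ext a b
  exact pd_neg i

theorem pdM_transpose {A : Eucl n → Matrix ι μ ℝ} (i : Fin n) :
    pdM i (fun y => (A y).transpose) x = (pdM i A x).transpose := rfl

theorem pdM_comm {A : Eucl n → Matrix ι μ ℝ} (i j : Fin n) (hA : SmoothM A x) :
    pdM i (pdM j A) x = pdM j (pdM i A) x := by
  ext a b
  exact pd_comm i j (hA a b)

end MatrixDerivatives

/-! ### Levi-Civita connection and curvature of a metric in coordinates -/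

section Curvature

variable {n : ℕ} {g : Eucl n → Fin n → Fin n → ℝ} {x : Eucl n}

/-- The metric as a matrix. -/
def gM (g : Eucl n → Fin n → Fin n → ℝ) (x : Eucl n) : Matrix (Fin n) (Fin n) ℝ :=
  Matrix.of (g x)

/-- The connection matrix `(Γ_a)^c_b = Γ^c_ab`. -/
def chrM (g : Eucl n → Fin n → Fin n → ℝ) (a : Fin n) (x : Eucl n) : Matrix (Fin n) (Fin n) ℝ :=
  Matrix.of fun c b => chr g x c a b

/-- The curvature matrix `(R_ab)^d_c = R_abc^d`. -/
def riemM (g : Eucl n → Fin n → Fin n → ℝ) (a b : Fin n) (x : Eucl n) :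
    Matrix (Fin n) (Fin n) ℝ :=
  Matrix.of fun d c => riemUp g x a b c d

theorem riemM_eq (a b : Fin n) : riemM g a b x
    = pdM b (chrM g a) x - pdM a (chrM g b) x
      + (chrM g b x * chrM g a x - chrM g a x * chrM g b x) := by
  ext d c
  simp only [riemM, riemUp, Matrix.of_apply, Matrix.add_apply, Matrix.sub_apply, pdM, chrM,
    Matrix.mul_apply, ← Finset.sum_sub_distrib]
  congr 1
  exact Finset.sum_congr rfl fun e _ => by ring

theorem riemM_swap (a b : Fin n) : riemM g b a x = - riemM g a b x := by
  rw [riemM_eq, riemM_eq]; abel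

theorem riemUp_swap (a b c d : Fin n) : riemUp g x b a c d = - riemUp g x a b c d :=
  congrFun₂ (riemM_swap a b) d c

theorem riem_swap (a b c d : Fin n) : riem g x b a c d = - riem g x a b c d := by
  unfold riem
  rw [← Finset.sum_neg_distrib]
  exact Finset.sum_congr rfl fun e _ => by rw [riemUp_swap a b]; ring

/-- A Riemannian metric on a coordinate domain: smooth, symmetric and positive definite. -/
structure IsMetricOn (g : Eucl n → Fin n → Fin n → ℝ) (U : Set (Eucl n)) : Prop where
  isOpen : IsOpen U
  smooth : ∀ x ∈ U, ∀ a b, ContDiffAt ℝ ∞ (fun y => g y a b) x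
  symm : ∀ x ∈ U, ∀ a b, g x a b = g x b a
  posDef : ∀ x ∈ U, (Matrix.of (g x)).PosDef

namespace IsMetricOn

variable {U : Set (Eucl n)} (hg : IsMetricOn g U)
include hg

theorem mem_nhds (hx : x ∈ U) : U ∈ 𝓝 x := hg.isOpen.mem_nhds hx

theorem smooth_gM (hx : x ∈ U) : SmoothM (gM g) x := fun a b => hg.smooth x hx a b

theorem transpose_gM (hx : x ∈ U) : (gM g x).transpose = gM g x := by
  ext a b
  exact hg.symm x hx b a

theorem det_pos (hx : x ∈ U) : 0 < (gM g x).det := (hg.posDef x hx).det_pos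

theorem isUnit_det (hx : x ∈ U) : IsUnit (gM g x).det := (hg.det_pos hx).ne'.isUnit

theorem mul_inv (hx : x ∈ U) : gM g x * (gM g x)⁻¹ = 1 :=
  Matrix.mul_nonsing_inv _ (hg.isUnit_det hx)

theorem inv_mul (hx : x ∈ U) : (gM g x)⁻¹ * gM g x = 1 :=
  Matrix.nonsing_inv_mul _ (hg.isUnit_det hx)

theorem transpose_inv (hx : x ∈ U) : ((gM g x)⁻¹).transpose = (gM g x)⁻¹ := by
  rw [Matrix.transpose_nonsing_inv, hg.transpose_gM hx]

theorem ginv_symm (hx : x ∈ U) (a b : Fin n) : ginv g x a b = ginv g x b a :=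
  congrFun (congrFun (hg.transpose_inv hx) b) a

theorem smooth_det (hx : x ∈ U) : ContDiffAt ℝ ∞ (fun y => (gM g y).det) x := by
  simp only [Matrix.det_apply]
  exact ContDiffAt.sum fun σ _ =>
    (contDiffAt_prod fun i _ => hg.smooth_gM hx (σ i) i).const_smul _

theorem smooth_adjugate (hx : x ∈ U) (a b : Fin n) :
    ContDiffAt ℝ ∞ (fun y => (gM g y).adjugate a b) x := by
  simp only [Matrix.adjugate_apply, Matrix.det_apply]
  refine ContDiffAt.sum fun σ _ => (contDiffAt_prod fun i _ => ?_).const_smul _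
  by_cases h : σ i = b
  · simp only [h, Matrix.updateRow_self]; exact contDiffAt_const
  · simp only [Matrix.updateRow_ne h]; exact hg.smooth_gM hx (σ i) i

theorem smooth_inv (hx : x ∈ U) : SmoothM (fun y => (gM g y)⁻¹) x := by
  intro a b
  simp only [Matrix.inv_def, Matrix.smul_apply, smul_eq_mul, Ring.inverse_eq_inv']
  exact ((hg.smooth_det hx).inv (hg.det_pos hx).ne').mul (hg.smooth_adjugate hx a b)

theorem smooth_ginv (hx : x ∈ U) (a b : Fin n) : ContDiffAt ℝ ∞ (fun y => ginv g y a b) x :=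
  hg.smooth_inv hx a b

theorem smooth_chr (hx : x ∈ U) (c a b : Fin n) : ContDiffAt ℝ ∞ (fun y => chr g y c a b) x := by
  unfold chr
  refine contDiffAt_const.mul (ContDiffAt.sum fun d _ => (hg.smooth_ginv hx c d).mul ?_)
  exact ((contDiffAt_pd a (hg.smooth x hx b d)).add (contDiffAt_pd b (hg.smooth x hx a d))).sub
    (contDiffAt_pd d (hg.smooth x hx a b))

theorem smooth_chrM (hx : x ∈ U) (a : Fin n) : SmoothM (chrM g a) x :=
  fun c b => hg.smooth_chr hx c a b

theorem smooth_riemUp (hx : x ∈ U) (a b c d : Fin n) :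
    ContDiffAt ℝ ∞ (fun y => riemUp g y a b c d) x := by
  unfold riemUp
  exact ((contDiffAt_pd b (hg.smooth_chr hx d a c)).sub
    (contDiffAt_pd a (hg.smooth_chr hx d b c))).add (ContDiffAt.sum fun e _ =>
      ((hg.smooth_chr hx e a c).mul (hg.smooth_chr hx d b e)).sub
        ((hg.smooth_chr hx e b c).mul (hg.smooth_chr hx d a e)))

/-- The connection is torsion-free. -/
theorem chr_symm (hx : x ∈ U) (c a b : Fin n) : chr g x c a b = chr g x c b a := by
  unfold chr
  have h : (fun y => g y a b) =ᶠ[𝓝 x] fun y => g y b a :=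
    (hg.mem_nhds hx |> eventually_of_mem) fun y hy => hg.symm y hy a b
  congr 1
  refine Finset.sum_congr rfl fun d _ => ?_
  rw [pd_congr d h]; ring

/-- The Christoffel symbols with all indices lowered. -/
theorem lower_chr (hx : x ∈ U) (d a b : Fin n) :
    ∑ c, g x d c * chr g x c a b = (1 / 2) * (pd a (fun y => g y b d) x
      + pd b (fun y => g y a d) x - pd d (fun y => g y a b) x) := by
  have h := congrFun₂ (hg.mul_inv hx) d
  simp only [Matrix.mul_apply] at h
  calc ∑ c, g x d c * chr g x c a b
      = (1 / 2) * ∑ m, (∑ c, g x d c * ginv g x c m) * (pd a (fun y => g y b m) x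
        + pd b (fun y => g y a m) x - pd m (fun y => g y a b) x) := by
        simp only [chr, Finset.mul_sum, Finset.sum_mul]
        rw [Finset.sum_comm]
        refine Finset.sum_congr rfl fun m _ => Finset.sum_congr rfl fun c _ => by ring
    _ = _ := by
        have h' : ∀ m, ∑ c, g x d c * ginv g x c m = (1 : Matrix (Fin n) (Fin n) ℝ) d m := h
        simp only [h', Matrix.one_apply]
        simp

/-- The connection is metric. -/
theorem pdM_gM (hx : x ∈ U) (a : Fin n) :
    pdM a (gM g) x = gM g x * chrM g a x + (chrM g a x).transpose * gM g x := by
  ext b d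
  have h1 : (gM g x * chrM g a x) b d = ∑ c, g x b c * chr g x c a d := rfl
  have h2 : ((chrM g a x).transpose * gM g x) b d = ∑ c, g x d c * chr g x c a b := by
    simp only [Matrix.mul_apply, Matrix.transpose_apply]
    exact Finset.sum_congr rfl fun c _ => by rw [hg.symm x hx d c, mul_comm]; rfl
  have s : ∀ i j k, pd k (fun y => g y i j) x = pd k (fun y => g y j i) x := fun i j k =>
    pd_congr k ((hg.mem_nhds hx |> eventually_of_mem) fun y hy => hg.symm y hy i j)
  rw [Matrix.add_apply, h1, h2, hg.lower_chr hx, hg.lower_chr hx]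
  change pd a (fun y => g y b d) x = _
  rw [s d b a, s a b d, s a d b]
  ring

theorem pdM_inv (hx : x ∈ U) (a : Fin n) :
    pdM a (fun y => (gM g y)⁻¹) x
      = - (chrM g a x * (gM g x)⁻¹ + (gM g x)⁻¹ * (chrM g a x).transpose) := by
  have h : pdM a (fun y => gM g y * (gM g y)⁻¹) x = 0 := by
    rw [pdM_congr a ((hg.mem_nhds hx |> eventually_of_mem) fun y hy => hg.mul_inv hy), pdM_const]
  rw [pdM_mul a (hg.smooth_gM hx) (hg.smooth_inv hx), hg.pdM_gM hx] at h
  have h2 := congrArg (fun A => (gM g x)⁻¹ * A) h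
  simp only [mul_add, add_mul, mul_zero] at h2
  have e1 : ∀ A : Matrix (Fin n) (Fin n) ℝ, (gM g x)⁻¹ * (gM g x * A) = A := fun A => by
    rw [← mul_assoc, hg.inv_mul hx, one_mul]
  have e2 : (gM g x)⁻¹ * ((chrM g a x).transpose * gM g x * (gM g x)⁻¹)
      = (gM g x)⁻¹ * (chrM g a x).transpose := by
    rw [mul_assoc, hg.mul_inv hx, mul_one]
  rw [e1, e2, mul_assoc, e1] at h2
  rw [eq_neg_iff_add_eq_zero, ← h2]; abel

/-- First Bianchi identity. -/
theorem riemUp_cyclic (hx : x ∈ U) (a b c d : Fin n) :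
    riemUp g x a b c d + riemUp g x b c a d + riemUp g x c a b d = 0 := by
  unfold riemUp
  have s : ∀ i j k l, pd k (fun y => chr g y l i j) x = pd k (fun y => chr g y l j i) x :=
    fun i j k l => pd_congr k ((hg.mem_nhds hx |> eventually_of_mem) fun y hy =>
      hg.chr_symm hy l i j)
  rw [s c a b d, s c b a d, s b a c d]
  simp only [Finset.sum_sub_distrib]
  simp only [hg.chr_symm hx _ c a, hg.chr_symm hx _ c b, hg.chr_symm hx _ b a]
  ring

/-- The curvature is antisymmetric in its last pair of indices: this is the commutator of the
second derivatives of the metric. -/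
theorem riem_antisymm_right (hx : x ∈ U) (a b c d : Fin n) :
    riem g x a b c d = - riem g x a b d c := by
  have key : gM g x * riemM g a b x + (riemM g a b x).transpose * gM g x = 0 := by
    have h := pdM_comm a b (hg.smooth_gM hx)
    have dd : ∀ i j, pdM i (pdM j (gM g)) x
        = (gM g x * chrM g i x + (chrM g i x).transpose * gM g x) * chrM g j x
          + gM g x * pdM i (chrM g j) x
          + ((pdM i (chrM g j) x).transpose * gM g x + (chrM g j x).transpose *
            (gM g x * chrM g i x + (chrM g i x).transpose * gM g x)) := by
      intro i j
      rw [pdM_congr i (A := pdM j (gM g))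
        ((hg.mem_nhds hx |> eventually_of_mem) fun y hy => hg.pdM_gM hy j)]
      rw [pdM_add i ((hg.smooth_gM hx).mul (hg.smooth_chrM hx j))
        ((hg.smooth_chrM hx j).transpose.mul (hg.smooth_gM hx)),
        pdM_mul i (hg.smooth_gM hx) (hg.smooth_chrM hx j),
        pdM_mul i (hg.smooth_chrM hx j).transpose (hg.smooth_gM hx), hg.pdM_gM hx]
      rfl
    rw [dd, dd, ← sub_eq_zero] at h
    rw [riemM_eq]
    simp only [Matrix.transpose_add, Matrix.transpose_sub, Matrix.transpose_mul]
    rw [← neg_eq_zero, ← h]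
    noncomm_ring
  have h1 := congrFun₂ key d c
  simp only [Matrix.add_apply, Matrix.mul_apply, Matrix.transpose_apply, Matrix.zero_apply,
    gM, riemM, Matrix.of_apply] at h1
  unfold riem
  rw [eq_neg_iff_add_eq_zero, ← h1]
  congr 1
  exact Finset.sum_congr rfl fun e _ => by rw [hg.symm x hx e d, mul_comm]

theorem riem_cyclic (hx : x ∈ U) (a b c d : Fin n) :
    riem g x a b c d + riem g x b c a d + riem g x c a b d = 0 := by
  unfold riem
  rw [← Finset.sum_add_distrib, ← Finset.sum_add_distrib]
  exact Finset.sum_eq_zero fun e _ => by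
    rw [← add_mul, ← add_mul, hg.riemUp_cyclic hx, zero_mul]

theorem riem_pair (hx : x ∈ U) (a b c d : Fin n) : riem g x a b c d = riem g x c d a b := by
  have h1 := hg.riem_cyclic hx a b c d
  have h2 := hg.riem_cyclic hx b c d a
  have h3 := hg.riem_cyclic hx c d a b
  have h4 := hg.riem_cyclic hx d a b c
  have r := hg.riem_antisymm_right hx
  have l := @riem_swap n g x
  linarith [r a b c d, r b c a d, r c a b d, r b c d a, r c d b a, r d b c a, r c d a b, r d a c b,
    r a c d b, r d a b c, r a b d c, r b d a c, l a b c d, l b c a d, l c a b d, l b c d a,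
    l c d b a, l d b c a, l c d a b, l d a c b, l a c d b, l d a b c, l a b d c, l b d a c]

theorem riem_raise (hx : x ∈ U) (a b c d : Fin n) :
    riemUp g x a b c d = ∑ e, riem g x a b c e * ginv g x e d := by
  have h : ∀ m, ∑ e, g x m e * ginv g x e d = (1 : Matrix (Fin n) (Fin n) ℝ) m d := fun m =>
    congrFun₂ (hg.mul_inv hx) m d
  simp only [riem, Finset.sum_mul]
  rw [Finset.sum_comm]
  simp only [mul_assoc, ← Finset.mul_sum, h, Matrix.one_apply]
  simp

/-- The Ricci tensor as a trace which does not involve the metric. -/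
theorem ric_eq_trace (hx : x ∈ U) (a b : Fin n) : ric g x a b = ∑ d, riemUp g x a d b d := by
  unfold ric
  rw [Finset.sum_comm]
  refine Finset.sum_congr rfl fun d _ => ?_
  rw [hg.riem_raise hx]
  refine Finset.sum_congr rfl fun c _ => ?_
  rw [riem_swap a d, hg.riem_antisymm_right hx a d c b]
  ring

/-- Second Bianchi identity, for the endomorphism-valued curvature form. -/
theorem second_bianchi (hx : x ∈ U) (e a b : Fin n) :
    (pdM e (riemM g a b) x + chrM g e x * riemM g a b x - riemM g a b x * chrM g e x)
    + (pdM a (riemM g b e) x + chrM g a x * riemM g b e x - riemM g b e x * chrM g a x)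
    + (pdM b (riemM g e a) x + chrM g b x * riemM g e a x - riemM g e a x * chrM g b x) = 0 := by
  have s := hg.smooth_chrM hx
  have dR : ∀ i j k, pdM i (riemM g j k) x
      = pdM i (pdM k (chrM g j)) x - pdM i (pdM j (chrM g k)) x
      + ((pdM i (chrM g k) x * chrM g j x + chrM g k x * pdM i (chrM g j) x)
        - (pdM i (chrM g j) x * chrM g k x + chrM g j x * pdM i (chrM g k) x)) := by
    intro i j k
    rw [show riemM g j k = fun y => pdM k (chrM g j) y - pdM j (chrM g k) y
      + (chrM g k y * chrM g j y - chrM g j y * chrM g k y) from funext fun y => riemM_eq j k]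
    rw [pdM_add i (((s j).pdM k).sub ((s k).pdM j)) (((s k).mul (s j)).sub ((s j).mul (s k))),
      pdM_sub i ((s j).pdM k) ((s k).pdM j), pdM_sub i ((s k).mul (s j)) ((s j).mul (s k)),
      pdM_mul i (s k) (s j), pdM_mul i (s j) (s k)]
  simp only [dR, riemM_eq]
  rw [pdM_comm e b (s a), pdM_comm e a (s b), pdM_comm a b (s e)]
  noncomm_ring

end IsMetricOn

end Curvature

/-! ### Duality of antisymmetric `4 × 4` matrices -/

/-- The dual `½ [abcd] K_cd` of an antisymmetric `4 × 4` matrix with respect to the flat metric. -/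
def dualM (K : Matrix (Fin 4) (Fin 4) ℝ) : Matrix (Fin 4) (Fin 4) ℝ :=
  !![0, K 2 3, -K 1 3, K 1 2; -K 2 3, 0, K 0 3, -K 0 2; K 1 3, -K 0 3, 0, K 0 1;
    -K 1 2, K 0 2, -K 0 1, 0]

theorem det_four (A : Matrix (Fin 4) (Fin 4) ℝ) : A.det =
    A 0 0 * (A 1 1 * (A 2 2 * A 3 3 - A 2 3 * A 3 2) - A 1 2 * (A 2 1 * A 3 3 - A 2 3 * A 3 1)
      + A 1 3 * (A 2 1 * A 3 2 - A 2 2 * A 3 1))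
    - A 0 1 * (A 1 0 * (A 2 2 * A 3 3 - A 2 3 * A 3 2) - A 1 2 * (A 2 0 * A 3 3 - A 2 3 * A 3 0)
      + A 1 3 * (A 2 0 * A 3 2 - A 2 2 * A 3 0))
    + A 0 2 * (A 1 0 * (A 2 1 * A 3 3 - A 2 3 * A 3 1) - A 1 1 * (A 2 0 * A 3 3 - A 2 3 * A 3 0)
      + A 1 3 * (A 2 0 * A 3 1 - A 2 1 * A 3 0))
    - A 0 3 * (A 1 0 * (A 2 1 * A 3 2 - A 2 2 * A 3 1) - A 1 1 * (A 2 0 * A 3 2 - A 2 2 * A 3 0)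
      + A 1 2 * (A 2 0 * A 3 1 - A 2 1 * A 3 0)) := by
  rw [Matrix.det_succ_row_zero]
  simp [Fin.sum_univ_four, Matrix.det_fin_three, Fin.succAbove]
  ring

/-- For antisymmetric `K`, contraction with the permutation symbol is `2 dualM K`; this is how sums
over `ε` become matrix algebra. -/
theorem permSymbol_contract (K : Matrix (Fin 4) (Fin 4) ℝ) (hK : K.transpose = -K) (a b : Fin 4) :
    ∑ c, ∑ d, permSymbol a b c d * K c d = 2 * dualM K a b := by
  have h : ∀ i j, K j i = - K i j := fun i j => congrFun₂ hK i j
  simp only [permSymbol, det_four, Matrix.of_apply, Matrix.cons_val]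
  have h10 := h 0 1
  have h20 := h 0 2
  have h30 := h 0 3
  have h21 := h 1 2
  have h31 := h 1 3
  have h32 := h 2 3
  fin_cases a <;> fin_cases b <;>
    simp [Fin.sum_univ_four, dualM, h10, h20, h30, h21, h31, h32] <;> ring

/-- The flat dual is equivariant up to the determinant: the permutation symbol is a tensor
density. -/
theorem dualM_conj (M K : Matrix (Fin 4) (Fin 4) ℝ) (hK : K.transpose = -K) :
    M * dualM (M.transpose * K * M) * M.transpose = M.det • dualM K := by
  have h : ∀ i j, K j i = - K i j := fun i j => congrFun₂ hK i j
  have h0 : ∀ i, K i i = 0 := fun i => by linarith [h i i]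
  have h10 := h 0 1
  have h20 := h 0 2
  have h30 := h 0 3
  have h21 := h 1 2
  have h31 := h 1 3
  have h32 := h 2 3
  ext i j
  fin_cases i <;> fin_cases j <;>
    simp [Matrix.mul_apply, Fin.sum_univ_four, dualM, det_four, h0, h10, h20, h30, h21, h31, h32]
      <;> ring

/-- The derivative of `dualM_conj` at the identity, in the direction `Γ`. Applied to connection
matrices it says that the volume form is parallel. -/
theorem dualM_infinitesimal (Γ K : Matrix (Fin 4) (Fin 4) ℝ) (hK : K.transpose = -K) :
    Γ.trace • dualM K = Γ * dualM K + dualM K * Γ.transpose + dualM (Γ.transpose * K + K * Γ) := by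
  have h : ∀ i j, K j i = - K i j := fun i j => congrFun₂ hK i j
  have h0 : ∀ i, K i i = 0 := fun i => by linarith [h i i]
  have h10 := h 0 1
  have h20 := h 0 2
  have h21 := h 1 2
  have h31 := h 1 3
  have h32 := h 2 3
  ext i j
  fin_cases i <;> fin_cases j <;>
    simp [Matrix.mul_apply, Fin.sum_univ_four, dualM, Matrix.trace,
      Matrix.vecMul, dotProduct, h0, h10, h20, h21, h31, h32]
      <;> ring

theorem permSymbol_swap (a b c d : Fin 4) : permSymbol a b d c = - permSymbol a b c d := by
  unfold permSymbol
  have h := Matrix.det_permute (Equiv.swap (2 : Fin 4) 3)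
    (Matrix.of fun i j : Fin 4 => if ![a, b, c, d] i = j then (1 : ℝ) else 0)
  rw [Equiv.Perm.sign_swap (by decide)] at h
  have e : (Matrix.of fun i j : Fin 4 => if ![a, b, d, c] i = j then (1 : ℝ) else 0)
      = (Matrix.of fun i j : Fin 4 => if ![a, b, c, d] i = j then (1 : ℝ) else 0).submatrix
        (Equiv.swap (2 : Fin 4) 3) id := by
    ext i j
    fin_cases i <;> rfl
  rw [e, h]
  simp

/-- The antisymmetric elementary matrix `e_c e_dᵀ - e_d e_cᵀ`. -/
def elemAnti (c d : Fin 4) : Matrix (Fin 4) (Fin 4) ℝ :=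
  Matrix.of fun i j => (if i = c then 1 else 0) * (if j = d then 1 else 0)
    - (if i = d then 1 else 0) * (if j = c then 1 else 0)

theorem elemAnti_transpose (c d : Fin 4) : (elemAnti c d).transpose = - elemAnti c d := by
  ext i j
  simp only [elemAnti, Matrix.transpose_apply, Matrix.of_apply, Matrix.neg_apply]
  ring

theorem permSymbol_eq_dualM (a b c d : Fin 4) :
    permSymbol a b c d = dualM (elemAnti c d) a b := by
  have h := permSymbol_contract (elemAnti c d) (elemAnti_transpose c d) a b
  have e : ∑ c', ∑ d', permSymbol a b c' d' * elemAnti c d c' d'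
      = permSymbol a b c d - permSymbol a b d c := by
    simp [elemAnti, mul_sub, Finset.sum_sub_distrib]
  rw [e, permSymbol_swap a b c d] at h
  linarith

theorem dualM_smul (r : ℝ) (K : Matrix (Fin 4) (Fin 4) ℝ) : dualM (r • K) = r • dualM K := by
  ext a b
  fin_cases a <;> fin_cases b <;> simp [dualM]

theorem dualM_transpose (K : Matrix (Fin 4) (Fin 4) ℝ) : (dualM K).transpose = - dualM K := by
  ext a b
  fin_cases a <;> fin_cases b <;> simp [dualM]

theorem dualM_add (K L : Matrix (Fin 4) (Fin 4) ℝ) : dualM (K + L) = dualM K + dualM L := by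
  ext a b
  fin_cases a <;> fin_cases b <;> simp [dualM] <;> ring

theorem dualM_neg (K : Matrix (Fin 4) (Fin 4) ℝ) : dualM (-K) = - dualM K := by
  ext a b
  fin_cases a <;> fin_cases b <;> simp [dualM]

/-! ### The volume density -/

/-- Jacobi's formula. -/
theorem pd_det {n : ℕ} {ι : Type*} [Fintype ι] [DecidableEq ι] {x : Eucl n}
    {A : Eucl n → Matrix ι ι ℝ} (hA : SmoothM A x) (i : Fin n) :
    pd i (fun y => (A y).det) x = ((A x).adjugate * pdM i A x).trace := by
  have hprod : ∀ σ : Equiv.Perm ι, pd i (fun y => ∏ k, A y (σ k) k) x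
      = ∑ k, (∏ m ∈ Finset.univ.erase k, A x (σ m) m) * pdM i A x (σ k) k := by
    intro σ
    unfold pd
    have := HasFDerivAt.finsetProd (u := Finset.univ) (x := x)
      (g := fun k (y : Eucl n) => A y (σ k) k)
      (g' := fun k => fderiv ℝ (fun y => A y (σ k) k) x)
      fun k _ => (diffAt_of_smooth (hA (σ k) k)).hasFDerivAt
    rw [this.fderiv]
    simp [pdM, pd]
  have hd : ∀ σ : Equiv.Perm ι, ContDiffAt ℝ ∞ (fun y => ∏ k, A y (σ k) k) x :=
    fun σ => contDiffAt_prod fun k _ => hA (σ k) k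
  simp only [Matrix.det_apply', Matrix.trace, Matrix.diag, Matrix.mul_apply]
  rw [pd_sum _ _ fun σ _ => (diffAt_of_smooth (hd σ)).const_mul _]
  simp only [pd_const_mul _ _ (diffAt_of_smooth (hd _)), hprod]
  have hc : ∀ k, ∑ j, (A x).adjugate k j * pdM i A x j k
      = ((A x).updateCol k fun j => pdM i A x j k).det := by
    intro k
    rw [← Matrix.cramer_apply, Matrix.cramer_eq_adjugate_mulVec]; rfl
  simp only [hc, Matrix.det_apply', Finset.mul_sum]
  rw [Finset.sum_comm]
  refine Finset.sum_congr rfl fun k _ => Finset.sum_congr rfl fun σ _ => ?_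
  rw [← Finset.mul_prod_erase Finset.univ _ (Finset.mem_univ k), Matrix.updateCol_self,
    mul_comm (pdM i A x (σ k) k)]
  congr 2
  exact Finset.prod_congr rfl fun m hm => by rw [Matrix.updateCol_ne (Finset.ne_of_mem_erase hm)]

namespace IsMetricOn

variable {n : ℕ} {g : Eucl n → Fin n → Fin n → ℝ} {x : Eucl n} {U : Set (Eucl n)}
  (hg : IsMetricOn g U)
include hg

theorem pd_det (hx : x ∈ U) (i : Fin n) :
    pd i (fun y => (gM g y).det) x = 2 * (chrM g i x).trace * (gM g x).det := by
  rw [ALFInst.pd_det (hg.smooth_gM hx), hg.pdM_gM hx, mul_add, ← mul_assoc, Matrix.adjugate_mul,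
    Matrix.trace_add, ← mul_assoc, Matrix.trace_mul_comm _ (gM g x), ← mul_assoc,
    Matrix.mul_adjugate]
  simp only [Matrix.smul_mul, one_mul, Matrix.trace_smul, Matrix.trace_transpose, smul_eq_mul]
  ring

theorem pd_sqrt_det (hx : x ∈ U) (i : Fin n) :
    pd i (fun y => Real.sqrt (gM g y).det) x
      = (chrM g i x).trace * Real.sqrt (gM g x).det := by
  have hp := hg.det_pos hx
  rw [pd_comp i (Real.hasDerivAt_sqrt hp.ne') (diffAt_of_smooth (hg.smooth_det hx)),
    hg.pd_det hx]
  have h := Real.sqrt_pos.2 hp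
  nth_rewrite 2 [← Real.sq_sqrt hp.le]
  field_simp

theorem smooth_sqrt_det (hx : x ∈ U) : ContDiffAt ℝ ∞ (fun y => Real.sqrt (gM g y).det) x :=
  (hg.smooth_det hx).sqrt (hg.det_pos hx).ne'

end IsMetricOn

theorem pd_sum_mul {n : ℕ} {ι : Type*} [Fintype ι] {A B : ι → Eucl n → ℝ} {x : Eucl n} (i : Fin n)
    (hA : ∀ j, ContDiffAt ℝ ∞ (A j) x) (hB : ∀ j, ContDiffAt ℝ ∞ (B j) x) :
    pd i (fun y => ∑ j, A j y * B j y) x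
      = ∑ j, (pd i (A j) x * B j x + A j x * pd i (B j) x) := by
  rw [pd_sum _ _ fun j _ => diffAt_of_smooth ((hA j).mul (hB j))]
  exact Finset.sum_congr rfl fun j _ =>
    pd_mul i (diffAt_of_smooth (hA j)) (diffAt_of_smooth (hB j))

/-! ### Self-dual parts of two-forms -/

section SelfDual

variable {g : Eucl 4 → Fin 4 → Fin 4 → ℝ} {x : Eucl 4} {U : Set (Eucl 4)}

/-- The contravariant tensor `t^{ab} ± ½ ε^{abcd} t_cd` associated with a two-form `t`. -/
def upSD (g : Eucl 4 → Fin 4 → Fin 4 → ℝ) (s : ℤˣ) (x : Eucl 4)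
    (t : Matrix (Fin 4) (Fin 4) ℝ) : Matrix (Fin 4) (Fin 4) ℝ :=
  (gM g x)⁻¹ * t * (gM g x)⁻¹ + (sgn s / Real.sqrt (gM g x).det) • dualM t

theorem raise2_eq (hg : IsMetricOn g U) (hx : x ∈ U) (t : Matrix (Fin 4) (Fin 4) ℝ) (a b : Fin 4) :
    raise2 g x t a b = ((gM g x)⁻¹ * t * (gM g x)⁻¹) a b := by
  have h : ∀ a b, (gM g x)⁻¹ a b = ginv g x a b := fun _ _ => rfl
  simp only [raise2, Matrix.mul_apply, Finset.sum_mul, h]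
  rw [Finset.sum_comm]
  refine Finset.sum_congr rfl fun d _ => Finset.sum_congr rfl fun c _ => ?_
  rw [hg.ginv_symm hx b d]; ring

theorem vol_contract (K : Matrix (Fin 4) (Fin 4) ℝ) (hK : K.transpose = -K) (a b : Fin 4) :
    ∑ c, ∑ d, vol g x a b c d * K c d = 2 * Real.sqrt (gM g x).det * dualM K a b := by
  have h := permSymbol_contract K hK a b
  simp only [vol, mul_assoc, ← Finset.mul_sum]
  rw [h]
  simp only [gM]; ring

theorem conj_antisymm {A t : Matrix (Fin 4) (Fin 4) ℝ} (hA : A.transpose = A)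
    (ht : t.transpose = -t) : (A * t * A).transpose = -(A * t * A) := by
  simp [Matrix.transpose_mul, hA, ht, mul_assoc]

/-- `t_ab ± ½ ε_ab^{cd} t_cd` in matrix form. -/
theorem sd_eq (hg : IsMetricOn g U) (hx : x ∈ U) (s : ℤˣ) (t : Matrix (Fin 4) (Fin 4) ℝ)
    (ht : t.transpose = -t) (a b : Fin 4) :
    t a b + sgn s * (1 / 2) * ∑ c, ∑ d, vol g x a b c d * raise2 g x t c d
      = (t + (sgn s * Real.sqrt (gM g x).det) • dualM ((gM g x)⁻¹ * t * (gM g x)⁻¹)) a b := by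
  simp only [raise2_eq hg hx]
  rw [vol_contract _ (conj_antisymm (hg.transpose_inv hx) ht)]
  simp only [Matrix.add_apply, Matrix.smul_apply, smul_eq_mul]
  ring

theorem raise2_sd (hg : IsMetricOn g U) (hx : x ∈ U) (s : ℤˣ) (t : Matrix (Fin 4) (Fin 4) ℝ)
    (ht : t.transpose = -t) (a b : Fin 4) :
    raise2 g x (fun a b => t a b
      + sgn s * (1 / 2) * ∑ c, ∑ d, vol g x a b c d * raise2 g x t c d) a b = upSD g s x t a b := by
  have e : (fun a b => t a b
      + sgn s * (1 / 2) * ∑ c, ∑ d, vol g x a b c d * raise2 g x t c d)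
      = (t + (sgn s * Real.sqrt (gM g x).det) • dualM ((gM g x)⁻¹ * t * (gM g x)⁻¹) :
        Matrix (Fin 4) (Fin 4) ℝ) :=
    funext₂ fun a b => sd_eq hg hx s t ht a b
  rw [e, raise2_eq hg hx]
  have h := dualM_conj (gM g x)⁻¹ t ht
  simp only [hg.transpose_inv hx] at h
  have hp := hg.det_pos hx
  have hq := Real.sqrt_pos.2 hp
  have e2 : (sgn s * Real.sqrt (gM g x).det) * (gM g x)⁻¹.det = sgn s / Real.sqrt (gM g x).det := by
    rw [Matrix.det_nonsing_inv, Ring.inverse_eq_inv']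
    nth_rewrite 2 [← Real.sq_sqrt hp.le]
    field_simp
  rw [upSD, ← e2, mul_smul _ _ (dualM t), ← h]
  simp only [mul_add, add_mul, Matrix.mul_smul, Matrix.smul_mul, mul_smul]

/-- The bilinear form `t_ab (u^{ab} ± ½ ε^{abcd} u_cd)` is symmetric. -/
theorem upSD_pairing_symm (s : ℤˣ)
    {t u : Matrix (Fin 4) (Fin 4) ℝ} (ht : t.transpose = -t) (hu : u.transpose = -u) :
    ∑ a, ∑ b, t a b * upSD g s x u a b = ∑ a, ∑ b, u a b * upSD g s x t a b := by
  have h1 : ∀ t u : Matrix (Fin 4) (Fin 4) ℝ,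
      ∑ a, ∑ b, t a b * u a b = (t.transpose * u).trace := by
    intro t u
    simp only [Matrix.trace, Matrix.diag, Matrix.mul_apply, Matrix.transpose_apply]
    exact Finset.sum_comm
  have h2 : (t.transpose * dualM u).trace = (u.transpose * dualM t).trace := by
    have h : ∀ i j, t j i = - t i j := fun i j => congrFun₂ ht i j
    have h' : ∀ i j, u j i = - u i j := fun i j => congrFun₂ hu i j
    rw [ht, hu]
    simp [Matrix.trace, Matrix.mul_apply, Fin.sum_univ_four, dualM,
      h 0 1, h 0 2, h 0 3, h 1 2, h 1 3, h 2 3, h' 0 1, h' 0 2, h' 0 3, h' 1 2, h' 1 3, h' 2 3]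
    ring
  have h3 : (t.transpose * ((gM g x)⁻¹ * u * (gM g x)⁻¹)).trace
      = (u.transpose * ((gM g x)⁻¹ * t * (gM g x)⁻¹)).trace := by
    rw [ht, hu]
    simp only [neg_mul, Matrix.trace_neg]
    rw [← mul_assoc, Matrix.trace_mul_comm, ← mul_assoc, ← mul_assoc, Matrix.trace_mul_comm]
  rw [h1, h1, upSD, upSD, mul_add, mul_add, Matrix.trace_add, Matrix.trace_add, h3,
    Matrix.mul_smul, Matrix.mul_smul, Matrix.trace_smul, Matrix.trace_smul, h2]

theorem SmoothM.upSD (hg : IsMetricOn g U) (hx : x ∈ U) (s : ℤˣ)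
    {t : Eucl 4 → Matrix (Fin 4) (Fin 4) ℝ} (ht : SmoothM t x) :
    SmoothM (fun y => upSD g s y (t y)) x := by
  refine (((hg.smooth_inv hx).mul ht).mul (hg.smooth_inv hx)).add fun a b => ?_
  simp only [Matrix.smul_apply, smul_eq_mul]
  refine (contDiffAt_const.div (hg.smooth_sqrt_det hx)
    (Real.sqrt_pos.2 (hg.det_pos hx)).ne').mul ?_
  fin_cases a <;> fin_cases b <;>
    simp only [dualM] <;> first | exact ht _ _ | exact (ht _ _).neg | exact contDiffAt_const

/-- Forming `t^{ab} ± ½ ε^{abcd} t_cd` commutes with covariant differentiation: the metric and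
the volume form are parallel. -/
theorem covD_upSD (hg : IsMetricOn g U) (hx : x ∈ U) (s : ℤˣ)
    {t : Eucl 4 → Matrix (Fin 4) (Fin 4) ℝ} (ht : SmoothM t x)
    (hant : ∀ y ∈ U, (t y).transpose = - t y) (e : Fin 4) :
    pdM e (fun y => upSD g s y (t y)) x + chrM g e x * upSD g s x (t x)
        + upSD g s x (t x) * (chrM g e x).transpose
      = upSD g s x (pdM e t x - (chrM g e x).transpose * t x - t x * chrM g e x) := by
  have hq := Real.sqrt_pos.2 (hg.det_pos hx)
  have hdual : SmoothM (fun y => dualM (t y)) x := by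
    intro a b
    fin_cases a <;> fin_cases b <;>
      simp only [dualM] <;> first | exact ht _ _ | exact (ht _ _).neg | exact contDiffAt_const
  have hdd : pdM e (fun y => dualM (t y)) x = dualM (pdM e t x) := by
    ext a b
    fin_cases a <;> fin_cases b <;> simp [pdM, dualM, pd_const, pd_neg]
  have hs : SmoothM (fun y => (sgn s / Real.sqrt (gM g y).det) • dualM (t y)) x := fun a b =>
    (contDiffAt_const.div (hg.smooth_sqrt_det hx) hq.ne').mul (hdual a b)
  have h2 : pdM e (fun y => (sgn s / Real.sqrt (gM g y).det) • dualM (t y)) x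
      = (sgn s / Real.sqrt (gM g x).det) •
        (dualM (pdM e t x) - (chrM g e x).trace • dualM (t x)) := by
    have hscal : pd e (fun y => sgn s / Real.sqrt (gM g y).det) x
        = - (sgn s / Real.sqrt (gM g x).det) * (chrM g e x).trace := by
      have := pd_comp e (f := fun y => Real.sqrt (gM g y).det) (x := x)
        ((hasDerivAt_inv hq.ne').const_mul (sgn s)) (diffAt_of_smooth (hg.smooth_sqrt_det hx))
      simp only [div_eq_mul_inv]
      rw [this, hg.pd_sqrt_det hx]
      field_simp
    ext a b
    simp only [← hdd]
    simp only [pdM, Matrix.of_apply, Matrix.smul_apply, smul_eq_mul, Matrix.sub_apply]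
    rw [pd_mul (f := fun y => sgn s / Real.sqrt (gM g y).det) e
      (diffAt_of_smooth (contDiffAt_const.div (hg.smooth_sqrt_det hx) hq.ne'))
      (diffAt_of_smooth (hdual a b)), hscal]
    ring
  have hinf := dualM_infinitesimal (chrM g e x) (t x) (hant x hx)
  simp only [upSD]
  rw [pdM_add e (((hg.smooth_inv hx).mul ht).mul (hg.smooth_inv hx)) hs, h2,
    pdM_mul e ((hg.smooth_inv hx).mul ht) (hg.smooth_inv hx),
    pdM_mul e (hg.smooth_inv hx) ht, hg.pdM_inv hx, hinf]
  have hneg : dualM (pdM e t x - (chrM g e x).transpose * t x - t x * chrM g e x)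
      = dualM (pdM e t x) - dualM ((chrM g e x).transpose * t x + t x * chrM g e x) := by
    rw [sub_sub, sub_eq_add_neg, dualM_add, dualM_neg, ← sub_eq_add_neg]
  rw [hneg]
  simp only [smul_sub, smul_add, mul_add, add_mul, Matrix.mul_smul, Matrix.smul_mul]
  noncomm_ring

end SelfDual

/-! ### Killing fields of Ricci-flat metrics in coordinates -/

/-- The coordinate form of the standing hypotheses: on the open set `U`, `C.g` is a Ricci-flat
Riemannian metric, `C.ξ` a Killing field and `C.om` a twist potential of it. -/
structure IsLocalSolution (C : Coords) (U : Set (Eucl 4)) : Prop where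
  metric : IsMetricOn C.g U
  smooth_ξ : ∀ x ∈ U, ∀ a, ContDiffAt ℝ ∞ (fun y => C.ξ y a) x
  smooth_om : ∀ x ∈ U, ContDiffAt ℝ ∞ C.om x
  killing : ∀ x ∈ U, ∀ a b, C.F x a b + C.F x b a = 0
  ricciFlat : ∀ x ∈ U, ∀ a b, ric C.g x a b = 0
  twist : ∀ x ∈ U, ∀ a, pd a C.om x = C.twist x a

namespace Coords

variable (C : Coords)

/-- The one-form `ξ_a`. -/
def eta (x : Eucl 4) (a : Fin 4) : ℝ := lower1 C.g x (C.ξ x) a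

/-- The two-form `F_ab` as a matrix. -/
def FM (x : Eucl 4) : Matrix (Fin 4) (Fin 4) ℝ := Matrix.of (C.F x)

/-- `𝓕^{± ab}` as a matrix. -/
def KM (s : ℤˣ) (x : Eucl 4) : Matrix (Fin 4) (Fin 4) ℝ := upSD C.g s x (C.FM x)

/-- The covariant derivative `(∇_c F)_ab` as a matrix in `a`, `b`. -/
def DFM (c : Fin 4) (x : Eucl 4) : Matrix (Fin 4) (Fin 4) ℝ :=
  pdM c C.FM x - (chrM C.g c x).transpose * C.FM x - C.FM x * chrM C.g c x

/-- The vector field `R_abd^e 𝓕^{± ab} ξ^d`, a quarter of the gradient of `(𝓕^±)²`. -/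
def Y (s : ℤˣ) (x : Eucl 4) (e : Fin 4) : ℝ :=
  ∑ a, ∑ b, ∑ d, riemUp C.g x a b d e * C.KM s x a b * C.ξ x d

variable {C} {x : Eucl 4}

theorem pd_eta (a b : Fin 4) :
    pd a (fun y => C.eta y b) x = C.F x a b + ∑ c, chr C.g x c a b * C.eta x c := by
  simp only [Coords.F, covDer1, Coords.eta]; ring

theorem riemUp_eta (a b c : Fin 4) :
    ∑ d, riemUp C.g x a b c d * C.eta x d = ∑ d, riem C.g x a b c d * C.ξ x d := by
  simp only [Coords.eta, lower1, riem, Finset.mul_sum, Finset.sum_mul]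
  rw [Finset.sum_comm]
  exact Finset.sum_congr rfl fun d _ => Finset.sum_congr rfl fun e _ => by ring

end Coords

namespace IsLocalSolution

variable {C : Coords} {U : Set (Eucl 4)} {x : Eucl 4} (hC : IsLocalSolution C U)
include hC

theorem smooth_eta (hx : x ∈ U) (a : Fin 4) : ContDiffAt ℝ ∞ (fun y => C.eta y a) x := by
  unfold Coords.eta lower1
  exact ContDiffAt.sum fun b _ => (hC.metric.smooth x hx a b).mul (hC.smooth_ξ x hx b)

theorem smooth_FM (hx : x ∈ U) : SmoothM C.FM x := by
  intro a b
  simp only [Coords.FM, Matrix.of_apply, Coords.F, covDer1]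
  exact (contDiffAt_pd a (hC.smooth_eta hx b)).sub (ContDiffAt.sum fun c _ =>
    (hC.metric.smooth_chr hx c a b).mul (hC.smooth_eta hx c))

theorem FM_transpose (hx : x ∈ U) : (C.FM x).transpose = - C.FM x := by
  ext a b
  exact eq_neg_of_add_eq_zero_left (hC.killing x hx b a)

theorem smooth_KM (s : ℤˣ) (hx : x ∈ U) : SmoothM (C.KM s) x :=
  SmoothM.upSD hC.metric hx s (hC.smooth_FM hx)

/-- The Ricci identity for the one-form `ξ_a`. -/
theorem ricci_identity (hx : x ∈ U) (a b c : Fin 4) :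
    C.DFM a x b c - C.DFM b x a c = ∑ d, riemUp C.g x a b c d * C.eta x d := by
  have hg := hC.metric
  have hpd : ∀ i j k, pd i (fun y => C.FM y j k) x = pd i (pd j fun y => C.eta y k) x
      - ∑ d, (pd i (fun y => chr C.g y d j k) x * C.eta x d
        + chr C.g x d j k * pd i (fun y => C.eta y d) x) := by
    intro i j k
    rw [← pd_sum_mul i (fun d => hg.smooth_chr hx d j k) (hC.smooth_eta hx)]
    exact pd_sub i (diffAt_of_smooth (contDiffAt_pd j (hC.smooth_eta hx k)))
      (diffAt_of_smooth (ContDiffAt.sum fun d _ =>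
        (hg.smooth_chr hx d j k).mul (hC.smooth_eta hx d)))
  have e1 : ∀ i j k, C.DFM i x j k = pd i (fun y => C.FM y j k) x
      - ∑ m, chr C.g x m i j * C.F x m k - ∑ m, C.F x j m * chr C.g x m i k := fun i j k => rfl
  have e2 : ∀ i j k l, ∑ d, (∑ e, (chr C.g x e i k * chr C.g x d j e)) * C.eta x d
      = ∑ m, (∑ d, chr C.g x d j m * C.eta x d) * chr C.g x m i l
        - ∑ m, (∑ d, chr C.g x d j m * C.eta x d) * (chr C.g x m i l - chr C.g x m i k) := by
    intro i j k l
    rw [← Finset.sum_sub_distrib]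
    simp only [Finset.sum_mul]
    rw [Finset.sum_comm]
    refine Finset.sum_congr rfl fun m _ => ?_
    rw [← Finset.sum_sub_distrib]
    exact Finset.sum_congr rfl fun d _ => by ring
  have e3 : ∀ i j k, ∑ m, chr C.g x m j k * pd i (fun y => C.eta y m) x
      = ∑ m, C.F x i m * chr C.g x m j k
        + ∑ d, (∑ e, (chr C.g x e j k * chr C.g x d i e)) * C.eta x d := by
    intro i j k
    rw [e2 j i k k]
    simp only [Coords.pd_eta, sub_self, mul_zero, Finset.sum_const_zero, sub_zero,
      ← Finset.sum_add_distrib]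
    exact Finset.sum_congr rfl fun m _ => by ring
  rw [e1, e1, hpd, hpd, pd_comm a b (hC.smooth_eta hx c)]
  simp only [Finset.sum_add_distrib, e3]
  simp only [riemUp, Finset.sum_sub_distrib, sub_mul, add_mul, Finset.sum_add_distrib,
    hg.chr_symm hx _ b a]
  ring

/-- Covariant derivatives of the Killing equation. -/
theorem DFM_transpose (hx : x ∈ U) (c : Fin 4) : (C.DFM c x).transpose = - C.DFM c x := by
  have h := pdM_congr c (A := fun y => (C.FM y).transpose) (B := fun y => - C.FM y)
    ((hC.metric.mem_nhds hx |> eventually_of_mem) fun y hy => hC.FM_transpose hy)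
  rw [pdM_transpose, pdM_neg] at h
  simp only [Coords.DFM, Matrix.transpose_sub, Matrix.transpose_mul, h, hC.FM_transpose hx,
    Matrix.transpose_transpose]
  noncomm_ring

/-- Kostant's identity `∇_a F_bc = - R_bca^d ξ_d` for a Killing field. -/
theorem kostant_up (hx : x ∈ U) (a b c : Fin 4) :
    C.DFM a x b c = - ∑ d, riemUp C.g x b c a d * C.eta x d := by
  have h1 := hC.ricci_identity hx a b c
  have h2 := hC.ricci_identity hx b c a
  have h3 := hC.ricci_identity hx c a b
  have t : ∀ i j k, C.DFM i x k j = - C.DFM i x j k := fun i j k =>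
    congrFun₂ (hC.DFM_transpose hx i) j k
  have hb : ∑ d, riemUp C.g x a b c d * C.eta x d + ∑ d, riemUp C.g x b c a d * C.eta x d
      + ∑ d, riemUp C.g x c a b d * C.eta x d = 0 := by
    rw [← Finset.sum_add_distrib, ← Finset.sum_add_distrib]
    exact Finset.sum_eq_zero fun d _ => by
      rw [← add_mul, ← add_mul, hC.metric.riemUp_cyclic hx, zero_mul]
  linarith [t a b c, t b c a, t c a b]

theorem kostant (hx : x ∈ U) (a b c : Fin 4) :
    C.DFM a x b c = - ∑ d, riem C.g x b c a d * C.ξ x d := by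
  rw [hC.kostant_up hx, Coords.riemUp_eta]

theorem ξ_eq_raise (hx : x ∈ U) (b : Fin 4) : C.ξ x b = ∑ m, ginv C.g x b m * C.eta x m := by
  have h : ∀ m, ∑ e, ginv C.g x b e * C.g x e m = (1 : Matrix (Fin 4) (Fin 4) ℝ) b m := fun m =>
    congrFun₂ (hC.metric.inv_mul hx) b m
  simp only [Coords.eta, lower1, Finset.mul_sum]
  rw [Finset.sum_comm]
  simp only [← mul_assoc, ← Finset.sum_mul, h, Matrix.one_apply]
  simp

theorem pd_ξ (hx : x ∈ U) (a b : Fin 4) : pd a (fun y => C.ξ y b) x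
    = ∑ m, ginv C.g x b m * C.F x a m - ∑ c, chr C.g x b a c * C.ξ x c := by
  have hg := hC.metric
  have h1 : pd a (fun y => C.ξ y b) x = pd a (fun y => ∑ m, ginv C.g y b m * C.eta y m) x :=
    pd_congr a ((hg.mem_nhds hx |> eventually_of_mem) fun y hy => hC.ξ_eq_raise hy b)
  rw [h1, pd_sum_mul a (hg.smooth_ginv hx b) (hC.smooth_eta hx)]
  have h2 : ∀ m, pd a (fun y => ginv C.g y b m) x
      = - (∑ c, chr C.g x b a c * ginv C.g x c m + ∑ c, ginv C.g x b c * chr C.g x m a c) :=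
    fun m => congrFun₂ (hg.pdM_inv hx a) b m
  simp only [h2, Coords.pd_eta, mul_add, neg_add, add_mul, Finset.sum_add_distrib]
  have h3 : ∑ c, chr C.g x b a c * C.ξ x c
      = ∑ m, (∑ c, chr C.g x b a c * ginv C.g x c m) * C.eta x m := by
    simp only [hC.ξ_eq_raise hx, Finset.mul_sum, Finset.sum_mul]
    rw [Finset.sum_comm]
    exact Finset.sum_congr rfl fun d _ => Finset.sum_congr rfl fun e _ => by ring
  have h4 : ∑ m, ginv C.g x b m * ∑ c, chr C.g x c a m * C.eta x c
      = ∑ m, (∑ c, ginv C.g x b c * chr C.g x m a c) * C.eta x m := by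
    simp only [Finset.mul_sum, Finset.sum_mul]
    rw [Finset.sum_comm]
    exact Finset.sum_congr rfl fun d _ => Finset.sum_congr rfl fun e _ => by ring
  rw [h3, h4]
  simp only [neg_mul, Finset.sum_neg_distrib]
  ring

theorem pd_lam (hx : x ∈ U) (a : Fin 4) : pd a C.lam x = 2 * ∑ b, C.F x a b * C.ξ x b := by
  have h1 : C.lam = fun y => ∑ b, C.eta y b * C.ξ y b := rfl
  rw [h1, pd_sum_mul a (hC.smooth_eta hx) (hC.smooth_ξ x hx)]
  simp only [Coords.pd_eta, hC.pd_ξ hx, add_mul, mul_sub, Finset.sum_add_distrib,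
    Finset.sum_sub_distrib]
  have h2 : ∑ b, C.eta x b * ∑ m, ginv C.g x b m * C.F x a m = ∑ b, C.F x a b * C.ξ x b := by
    simp only [hC.ξ_eq_raise hx, Finset.mul_sum]
    rw [Finset.sum_comm]
    refine Finset.sum_congr rfl fun d _ => Finset.sum_congr rfl fun e _ => ?_
    rw [hC.metric.ginv_symm hx d e]; ring
  have h3 : ∑ b, C.eta x b * ∑ c, chr C.g x b a c * C.ξ x c
      = ∑ b, (∑ c, chr C.g x c a b * C.eta x c) * C.ξ x b := by
    simp only [Finset.mul_sum, Finset.sum_mul]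
    rw [Finset.sum_comm]
    exact Finset.sum_congr rfl fun d _ => Finset.sum_congr rfl fun e _ => by ring
  rw [h2, h3]; ring

theorem smooth_lam (hx : x ∈ U) : ContDiffAt ℝ ∞ C.lam x :=
  ContDiffAt.sum fun b _ => (hC.smooth_eta hx b).mul (hC.smooth_ξ x hx b)

theorem smooth_E (s : ℤˣ) (hx : x ∈ U) : ContDiffAt ℝ ∞ (C.E s) x :=
  (hC.smooth_lam hx).add (contDiffAt_const.mul (hC.smooth_om x hx))

/-- The one-form `σ^±` is the differential of the Ernst potential. -/
theorem pd_E (s : ℤˣ) (hx : x ∈ U) (a : Fin 4) : pd a (C.E s) x = C.sigma s x a := by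
  unfold Coords.E
  rw [pd_add a (diffAt_of_smooth (hC.smooth_lam hx))
    ((diffAt_of_smooth (hC.smooth_om x hx)).const_mul _),
    pd_const_mul a _ (diffAt_of_smooth (hC.smooth_om x hx)), hC.pd_lam hx, hC.twist x hx]
  simp only [Coords.twist, Coords.sigma, Coords.SF, add_mul, Finset.sum_add_distrib,
    Finset.mul_sum, Finset.sum_mul, mul_add]
  congr 1
  refine Finset.sum_congr rfl fun b _ => Finset.sum_congr rfl fun c _ =>
    Finset.sum_congr rfl fun d _ => by ring

theorem raise2_SF (s : ℤˣ) (hx : x ∈ U) (a b : Fin 4) :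
    raise2 C.g x (C.SF s x) a b = C.KM s x a b :=
  raise2_sd hC.metric hx s (C.FM x) (hC.FM_transpose hx) a b

theorem sigmaUp_eq (s : ℤˣ) (hx : x ∈ U) (e : Fin 4) :
    C.sigmaUp s x e = 2 * ∑ b, C.KM s x e b * C.eta x b := by
  simp only [← hC.raise2_SF s hx, Coords.sigmaUp, raise1, Coords.sigma, raise2, Finset.sum_mul,
    Finset.mul_sum, hC.ξ_eq_raise hx]
  conv_rhs => rw [Finset.sum_comm]
  refine Finset.sum_congr rfl fun a _ => ?_
  rw [Finset.sum_comm]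
  refine Finset.sum_congr rfl fun b _ => Finset.sum_congr rfl fun c _ => ?_
  rw [hC.metric.ginv_symm hx b c]; ring

/-- Covariant derivative of `𝓕^{± ab}`. -/
theorem pd_KM (s : ℤˣ) (hx : x ∈ U) (e a b : Fin 4) : pd e (fun y => C.KM s y a b) x
    = upSD C.g s x (C.DFM e x) a b - ∑ m, chr C.g x a e m * C.KM s x m b
      - ∑ m, C.KM s x a m * chr C.g x b e m := by
  have h := congrFun₂ (covD_upSD hC.metric hx s (hC.smooth_FM hx)
    (fun y hy => hC.FM_transpose hy) e) a b
  simp only [Matrix.add_apply] at h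
  have h' : upSD C.g s x (C.DFM e x) a b = pd e (fun y => C.KM s y a b) x
    + ∑ m, chr C.g x a e m * C.KM s x m b + ∑ m, C.KM s x a m * chr C.g x b e m := h.symm
  rw [h']; ring

theorem smooth_sigmaUp (s : ℤˣ) (hx : x ∈ U) (e : Fin 4) :
    ContDiffAt ℝ ∞ (fun y => C.sigmaUp s y e) x := by
  refine (contDiffAt_const.mul (ContDiffAt.sum fun b (_ : b ∈ Finset.univ) =>
    (hC.smooth_KM s hx e b).mul (hC.smooth_eta hx b))).congr_of_eventuallyEq
      (f := fun y => 2 * ∑ b, C.KM s y e b * C.eta y b) ?_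
  exact (hC.metric.mem_nhds hx |> eventually_of_mem) fun y hy => hC.sigmaUp_eq s hy e

theorem divergence_sigmaUp (s : ℤˣ) (hx : x ∈ U) :
    divergence C.g (C.sigmaUp s) x
      = 2 * ∑ a, ∑ b, upSD C.g s x (C.DFM a x) a b * C.eta x b
        + 2 * ∑ a, ∑ b, C.F x a b * C.KM s x a b := by
  have h1 : ∀ a, pd a (fun y => C.sigmaUp s y a) x = 2 * ∑ b,
      (pd a (fun y => C.KM s y a b) x * C.eta x b
        + C.KM s x a b * pd a (fun y => C.eta y b) x) := by
    intro a
    rw [pd_congr a ((hC.metric.mem_nhds hx |> eventually_of_mem) fun y hy =>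
      hC.sigmaUp_eq s hy a), pd_const_mul, pd_sum_mul a (hC.smooth_KM s hx a) (hC.smooth_eta hx)]
    exact diffAt_of_smooth (ContDiffAt.sum fun b _ =>
      (hC.smooth_KM s hx a b).mul (hC.smooth_eta hx b))
  simp only [divergence, h1, hC.sigmaUp_eq s hx, hC.pd_KM s hx, Coords.pd_eta, sub_mul, mul_add,
    Finset.sum_add_distrib, Finset.sum_sub_distrib, Finset.mul_sum, Finset.sum_mul]
  have t1 : ∀ a, ∑ b, ∑ m, 2 * (chr C.g x a a m * C.KM s x m b * C.eta x b)
      = ∑ m, ∑ b, chr C.g x a a m * (2 * (C.KM s x m b * C.eta x b)) := by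
    intro a
    rw [Finset.sum_comm]
    exact Finset.sum_congr rfl fun _ _ => Finset.sum_congr rfl fun _ _ => by ring
  have t2 : ∀ a, ∑ b, ∑ m, 2 * (C.KM s x a b * (chr C.g x m a b * C.eta x m))
      = ∑ b, ∑ m, 2 * (C.KM s x a m * chr C.g x b a m * C.eta x b) := by
    intro a
    rw [Finset.sum_comm]
    exact Finset.sum_congr rfl fun _ _ => Finset.sum_congr rfl fun _ _ => by ring
  simp only [mul_sub, Finset.sum_sub_distrib, Finset.mul_sum, t1, t2]
  have t3 : ∑ a, ∑ b, 2 * (C.KM s x a b * C.F x a b) = ∑ a, ∑ b, 2 * (C.F x a b * C.KM s x a b) :=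
    Finset.sum_congr rfl fun _ _ => Finset.sum_congr rfl fun _ _ => by ring
  rw [t3]; ring

end IsLocalSolution

/-! ### Gradient and Laplacian of `(𝓕^±)²` -/

section SumSwap

variable {ι : Type*} [Fintype ι]

theorem sum_rotate {α β γ : Type*} [Fintype α] [Fintype β] [Fintype γ] (f : ι → α → β → γ → ℝ) :
    ∑ m, ∑ a, ∑ b, ∑ d, f m a b d = ∑ a, ∑ b, ∑ d, ∑ m, f m a b d := by
  rw [Finset.sum_comm]
  refine Finset.sum_congr rfl fun a _ => ?_
  rw [Finset.sum_comm]
  exact Finset.sum_congr rfl fun b _ => Finset.sum_comm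

theorem sum_pair_comm {α β γ : Type*} [Fintype α] [Fintype β] [Fintype γ] (f : ι → α → β → γ → ℝ) :
    ∑ a, ∑ b, ∑ c, ∑ d, f a b c d = ∑ c, ∑ d, ∑ a, ∑ b, f a b c d := by
  rw [sum_rotate, sum_rotate fun b c d a => f a b c d]

variable (f : ι → ι → ι → ι → ℝ)

theorem sum_swap_thd_fth : ∑ a, ∑ b, ∑ d, ∑ m, f a b d m = ∑ a, ∑ b, ∑ d, ∑ m, f a b m d :=
  Finset.sum_congr rfl fun _ _ => Finset.sum_congr rfl fun _ _ => Finset.sum_comm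

theorem sum_swap_snd_fth : ∑ a, ∑ b, ∑ d, ∑ m, f a b d m = ∑ a, ∑ b, ∑ d, ∑ m, f a m d b := by
  refine Finset.sum_congr rfl fun a _ => ?_
  have h : ∀ h : ι → ι → ι → ℝ, ∑ b, ∑ d, ∑ m, h b d m = ∑ d, ∑ b, ∑ m, h b d m :=
    fun h => Finset.sum_comm
  rw [h, h fun b d m => f a m d b]
  exact Finset.sum_congr rfl fun d _ => Finset.sum_comm

theorem sum_swap_fst_fth : ∑ a, ∑ b, ∑ d, ∑ m, f a b d m = ∑ a, ∑ b, ∑ d, ∑ m, f m b d a := by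
  have h : ∀ h : ι → ι → ι → ι → ℝ,
      ∑ a, ∑ b, ∑ d, ∑ m, h a b d m = ∑ b, ∑ a, ∑ d, ∑ m, h a b d m := fun h => Finset.sum_comm
  rw [h, h fun a b d m => f m b d a]
  refine Finset.sum_congr rfl fun b _ => ?_
  have h' : ∀ h : ι → ι → ι → ℝ, ∑ a, ∑ d, ∑ m, h a d m = ∑ d, ∑ a, ∑ m, h a d m :=
    fun h => Finset.sum_comm
  rw [h', h' fun a d m => f m b d a]
  exact Finset.sum_congr rfl fun d _ => Finset.sum_comm

end SumSwap

theorem dualM_dualM (K : Matrix (Fin 4) (Fin 4) ℝ) (hK : K.transpose = -K) :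
    dualM (dualM K) = K := by
  have h : ∀ i j, K j i = - K i j := fun i j => congrFun₂ hK i j
  have h0 : ∀ i, K i i = 0 := fun i => by linarith [h i i]
  ext a b
  fin_cases a <;> fin_cases b <;>
    simp [dualM, h0, h 0 1, h 0 2, h 0 3, h 1 2, h 1 3, h 2 3]

theorem sgn_mul_self (s : ℤˣ) : sgn s * sgn s = 1 := by
  rcases Int.units_eq_one_or s with rfl | rfl <;> simp [sgn]

theorem sgn_neg (s : ℤˣ) : sgn (-s) = - sgn s := by simp [sgn]

/-- The contracted second Bianchi identity of a Ricci-flat metric: `∇_e R_abc^e = 0`. -/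
theorem IsMetricOn.divergence_riemUp {n : ℕ} {g : Eucl n → Fin n → Fin n → ℝ} {x : Eucl n}
    {U : Set (Eucl n)} (hg : IsMetricOn g U) (hric : ∀ y ∈ U, ∀ a b, ric g y a b = 0)
    (hx : x ∈ U) (a b c : Fin n) :
    ∑ e, (pd e (fun y => riemUp g y a b c e) x
      + ∑ m, chr g x e e m * riemUp g x a b c m
      - ∑ m, chr g x m e c * riemUp g x a b m e
      - ∑ m, chr g x m e a * riemUp g x m b c e
      - ∑ m, chr g x m e b * riemUp g x a m c e) = 0 := by
  have hB : ∀ e, (pd e (fun y => riemUp g y a b c e) x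
        + ∑ m, chr g x e e m * riemUp g x a b c m - ∑ m, riemUp g x a b m e * chr g x m e c)
      + (pd a (fun y => riemUp g y b e c e) x
        + ∑ m, chr g x e a m * riemUp g x b e c m - ∑ m, riemUp g x b e m e * chr g x m a c)
      + (pd b (fun y => riemUp g y e a c e) x
        + ∑ m, chr g x e b m * riemUp g x e a c m - ∑ m, riemUp g x e a m e * chr g x m b c)
      = 0 := fun e => congrFun₂ (hg.second_bianchi hx e a b) e c
  have hR : ∀ y ∈ U, ∀ i j, ∑ e, riemUp g y i e j e = 0 := fun y hy i j => by
    rw [← hg.ric_eq_trace hy, hric y hy]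
  have hR' : ∀ y ∈ U, ∀ i j, ∑ e, riemUp g y e i j e = 0 := fun y hy i j => by
    have h : ∀ e, riemUp g y e i j e = - riemUp g y i e j e := fun e => riemUp_swap i e j e
    simp only [h, Finset.sum_neg_distrib, hR y hy, neg_zero]
  have p1 : ∑ e, pd a (fun y => riemUp g y b e c e) x = 0 := by
    rw [← pd_sum _ _ fun e _ => diffAt_of_smooth (hg.smooth_riemUp hx b e c e),
      pd_congr (h := fun _ => 0) a ((hg.mem_nhds hx |> eventually_of_mem) fun y hy => hR y hy b c),
      pd_const]
  have p2 : ∑ e, pd b (fun y => riemUp g y e a c e) x = 0 := by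
    rw [← pd_sum _ _ fun e _ => diffAt_of_smooth (hg.smooth_riemUp hx e a c e),
      pd_congr (h := fun _ => 0) b ((hg.mem_nhds hx |> eventually_of_mem) fun y hy => hR' y hy a c),
      pd_const]
  have q1 : ∑ e, ∑ m, riemUp g x b e m e * chr g x m a c = 0 := by
    rw [Finset.sum_comm]
    exact Finset.sum_eq_zero fun m _ => by rw [← Finset.sum_mul, hR x hx, zero_mul]
  have q2 : ∑ e, ∑ m, riemUp g x e a m e * chr g x m b c = 0 := by
    rw [Finset.sum_comm]
    exact Finset.sum_eq_zero fun m _ => by rw [← Finset.sum_mul, hR' x hx, zero_mul]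
  have r1 : ∑ e, ∑ m, chr g x e a m * riemUp g x b e c m
      = - ∑ e, ∑ m, chr g x m e a * riemUp g x m b c e := by
    rw [Finset.sum_comm, ← Finset.sum_neg_distrib]
    refine Finset.sum_congr rfl fun e _ => ?_
    rw [← Finset.sum_neg_distrib]
    exact Finset.sum_congr rfl fun m _ => by rw [riemUp_swap m b, hg.chr_symm hx m a e]; ring
  have r2 : ∑ e, ∑ m, chr g x e b m * riemUp g x e a c m
      = - ∑ e, ∑ m, chr g x m e b * riemUp g x a m c e := by
    rw [Finset.sum_comm, ← Finset.sum_neg_distrib]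
    refine Finset.sum_congr rfl fun e _ => ?_
    rw [← Finset.sum_neg_distrib]
    exact Finset.sum_congr rfl fun m _ => by rw [riemUp_swap a m, hg.chr_symm hx m b e]; ring
  have r3 : ∑ e, ∑ m, riemUp g x a b m e * chr g x m e c
      = ∑ e, ∑ m, chr g x m e c * riemUp g x a b m e :=
    Finset.sum_congr rfl fun _ _ => Finset.sum_congr rfl fun _ _ => mul_comm _ _
  have h := Finset.sum_eq_zero (s := Finset.univ) fun e _ => hB e
  simp only [Finset.sum_add_distrib, Finset.sum_sub_distrib, p1, p2, q1, q2, r1, r2, r3] at h ⊢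
  linarith

namespace IsLocalSolution

variable {C : Coords} {U : Set (Eucl 4)} {x : Eucl 4} (hC : IsLocalSolution C U)
include hC

/-- `(𝓕^±)² = 2 F_ab 𝓕^{± ab}`. -/
theorem SFsq_eq (s : ℤˣ) (hx : x ∈ U) :
    C.SFsq s x = 2 * ∑ a, ∑ b, C.FM x a b * C.KM s x a b := by
  have hg := hC.metric
  set t : Matrix (Fin 4) (Fin 4) ℝ := C.FM x
    + (sgn s * Real.sqrt (gM C.g x).det) • dualM ((gM C.g x)⁻¹ * C.FM x * (gM C.g x)⁻¹) with ht
  have hSF : ∀ a b, C.SF s x a b = t a b := fun a b =>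
    sd_eq hg hx s (C.FM x) (hC.FM_transpose hx) a b
  have hup : (gM C.g x)⁻¹ * t * (gM C.g x)⁻¹ = C.KM s x := by
    ext a b
    rw [← hC.raise2_SF s hx, ← raise2_eq hg hx]
    simp only [raise2, hSF]
  have hant := conj_antisymm (hg.transpose_inv hx) (hC.FM_transpose hx)
  have htt : t.transpose = -t := by
    rw [ht, Matrix.transpose_add, Matrix.transpose_smul, dualM_transpose, hC.FM_transpose hx]
    simp [smul_neg, add_comm]
  have hq := Real.sqrt_pos.2 (hg.det_pos hx)
  have h2 : upSD C.g s x t = (2 : ℝ) • C.KM s x := by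
    have hc : sgn s / Real.sqrt (gM C.g x).det * (sgn s * Real.sqrt (gM C.g x).det) = 1 := by
      field_simp
      rw [sq, sgn_mul_self]
    rw [upSD, hup, ht, dualM_add, dualM_smul, dualM_dualM _ hant, smul_add, smul_smul, hc,
      one_smul, two_smul]
    congr 1
    rw [Coords.KM, upSD, add_comm]
  have h3 := upSD_pairing_symm (g := C.g) (x := x) s (hC.FM_transpose hx) htt
  rw [h2] at h3
  simp only [Coords.SFsq, normSq2, hC.raise2_SF s hx, hSF]
  rw [show upSD C.g s x (C.FM x) = C.KM s x from rfl] at h3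
  rw [← h3]
  simp only [Matrix.smul_apply, smul_eq_mul, Finset.mul_sum]
  exact Finset.sum_congr rfl fun _ _ => Finset.sum_congr rfl fun _ _ => by ring

theorem smooth_SFsq (s : ℤˣ) (hx : x ∈ U) : ContDiffAt ℝ ∞ (C.SFsq s) x := by
  refine (contDiffAt_const.mul (ContDiffAt.sum fun a (_ : a ∈ Finset.univ) =>
    ContDiffAt.sum fun b (_ : b ∈ Finset.univ) =>
      (hC.smooth_FM hx a b).mul (hC.smooth_KM s hx a b))).congr_of_eventuallyEq
        (f := fun y => 2 * ∑ a, ∑ b, C.FM y a b * C.KM s y a b) ?_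
  exact (hC.metric.mem_nhds hx |> eventually_of_mem) fun y hy => hC.SFsq_eq s hy

theorem pd_SFsq (s : ℤˣ) (hx : x ∈ U) (c : Fin 4) :
    pd c (C.SFsq s) x = 4 * ∑ a, ∑ b, C.DFM c x a b * C.KM s x a b := by
  have hF : ∀ a b, pd c (fun y => C.FM y a b) x = C.DFM c x a b
      + ∑ m, chr C.g x m c a * C.FM x m b + ∑ m, C.FM x a m * chr C.g x m c b := by
    intro a b
    have e : C.DFM c x a b = pd c (fun y => C.FM y a b) x
      - ∑ m, chr C.g x m c a * C.FM x m b - ∑ m, C.FM x a m * chr C.g x m c b := rfl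
    rw [e]; ring
  have hsm : ∀ a, ContDiffAt ℝ ∞ (fun y => ∑ b, C.FM y a b * C.KM s y a b) x := fun a =>
    ContDiffAt.sum fun b _ => (hC.smooth_FM hx a b).mul (hC.smooth_KM s hx a b)
  rw [pd_congr c ((hC.metric.mem_nhds hx |> eventually_of_mem) fun y hy => hC.SFsq_eq s hy),
    pd_const_mul c _ (diffAt_of_smooth (ContDiffAt.sum fun a _ => hsm a)),
    pd_sum _ _ fun a _ => diffAt_of_smooth (hsm a)]
  simp only [pd_sum_mul c (hC.smooth_FM hx _) (hC.smooth_KM s hx _), hF, hC.pd_KM s hx]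
  have h3 := upSD_pairing_symm (g := C.g) (x := x) s (hC.FM_transpose hx) (hC.DFM_transpose hx c)
  rw [show upSD C.g s x (C.FM x) = C.KM s x from rfl] at h3
  simp only [add_mul, mul_sub, Finset.sum_add_distrib, Finset.sum_sub_distrib, h3]
  have t1 : ∑ a, ∑ b, (∑ m, chr C.g x m c a * C.FM x m b) * C.KM s x a b
      = ∑ a, ∑ b, C.FM x a b * ∑ m, chr C.g x a c m * C.KM s x m b := by
    simp only [Finset.sum_mul, Finset.mul_sum]
    have h : ∀ h : Fin 4 → Fin 4 → Fin 4 → ℝ, ∑ a, ∑ b, ∑ m, h a b m = ∑ b, ∑ a, ∑ m, h a b m :=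
      fun h => Finset.sum_comm
    rw [h, h fun a b m => C.FM x a b * (chr C.g x a c m * C.KM s x m b)]
    refine Finset.sum_congr rfl fun b _ => ?_
    rw [Finset.sum_comm]
    exact Finset.sum_congr rfl fun _ _ => Finset.sum_congr rfl fun _ _ => by ring
  have t2 : ∑ a, ∑ b, (∑ m, C.FM x a m * chr C.g x m c b) * C.KM s x a b
      = ∑ a, ∑ b, C.FM x a b * ∑ m, C.KM s x a m * chr C.g x b c m := by
    simp only [Finset.sum_mul, Finset.mul_sum]
    refine Finset.sum_congr rfl fun b _ => ?_
    rw [Finset.sum_comm]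
    exact Finset.sum_congr rfl fun _ _ => Finset.sum_congr rfl fun _ _ => by ring
  rw [t1, t2]; ring

/-- The gradient of `(𝓕^±)²` is `4 R_abd^e 𝓕^{± ab} ξ^d`. -/
theorem grad_SFsq (s : ℤˣ) (hx : x ∈ U) (e : Fin 4) :
    raise1 C.g x (fun c => pd c (C.SFsq s) x) e = 4 * C.Y s x e := by
  have hg := hC.metric
  have h1 : ∀ a b d, riemUp C.g x a b d e = - ∑ c, ginv C.g x e c * riem C.g x a b c d := by
    intro a b d
    rw [hg.riem_raise hx, ← Finset.sum_neg_distrib]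
    refine Finset.sum_congr rfl fun c _ => ?_
    rw [hg.riem_antisymm_right hx, hg.ginv_symm hx]; ring
  simp only [raise1, hC.pd_SFsq s hx, hC.kostant hx, Coords.Y, h1]
  simp only [Finset.mul_sum, Finset.sum_mul, neg_mul, mul_neg, Finset.sum_neg_distrib]
  rw [sum_rotate fun c a b d =>
    ginv C.g x e c * (4 * (riem C.g x a b c d * C.ξ x d * C.KM s x a b))]
  congr 1
  refine Finset.sum_congr rfl fun _ _ => Finset.sum_congr rfl fun _ _ =>
    Finset.sum_congr rfl fun _ _ => Finset.sum_congr rfl fun _ _ => by ring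

theorem smooth_Y (s : ℤˣ) (hx : x ∈ U) (e : Fin 4) : ContDiffAt ℝ ∞ (fun y => C.Y s y e) x :=
  ContDiffAt.sum fun a _ => ContDiffAt.sum fun b _ => ContDiffAt.sum fun d _ =>
    ((hC.metric.smooth_riemUp hx a b d e).mul (hC.smooth_KM s hx a b)).mul (hC.smooth_ξ x hx d)

theorem divergence_Y (s : ℤˣ) (hx : x ∈ U) : divergence C.g (C.Y s) x
    = ∑ e, ∑ a, ∑ b, ∑ d, riemUp C.g x a b d e * upSD C.g s x (C.DFM e x) a b * C.ξ x d
      + ∑ e, ∑ a, ∑ b, ∑ d, riemUp C.g x a b d e * C.KM s x a b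
          * ∑ m, ginv C.g x d m * C.F x e m := by
  have hg := hC.metric
  have hR := fun a b d e => hg.smooth_riemUp hx a b d e
  have hK := fun a b => hC.smooth_KM s hx a b
  have hξ := hC.smooth_ξ x hx
  have hpd : ∀ e, pd e (fun y => C.Y s y e) x = ∑ a, ∑ b, ∑ d,
      (pd e (fun y => riemUp C.g y a b d e) x * C.KM s x a b * C.ξ x d
        + riemUp C.g x a b d e * pd e (fun y => C.KM s y a b) x * C.ξ x d
        + riemUp C.g x a b d e * C.KM s x a b * pd e (fun y => C.ξ y d) x) := by
    intro e
    simp only [Coords.Y]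
    have h3 := fun a b d => ((hR a b d e).mul (hK a b)).mul (hξ d)
    have h2 := fun a b => ContDiffAt.sum (s := Finset.univ) fun d _ => h3 a b d
    rw [pd_sum _ _ fun a _ => diffAt_of_smooth (ContDiffAt.sum fun b _ => h2 a b)]
    refine Finset.sum_congr rfl fun a _ => ?_
    rw [pd_sum _ _ fun b _ => diffAt_of_smooth (h2 a b)]
    refine Finset.sum_congr rfl fun b _ => ?_
    rw [pd_sum _ _ fun d _ => diffAt_of_smooth (h3 a b d)]
    refine Finset.sum_congr rfl fun d _ => ?_
    rw [pd_mul e (diffAt_of_smooth ((hR a b d e).mul (hK a b))) (diffAt_of_smooth (hξ d)),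
      pd_mul e (diffAt_of_smooth (hR a b d e)) (diffAt_of_smooth (hK a b))]
    ring
  have hdf : ∑ e, ∑ a, ∑ b, ∑ d, (pd e (fun y => riemUp C.g y a b d e) x
      + ∑ m, chr C.g x e e m * riemUp C.g x a b d m
      - ∑ m, chr C.g x m e d * riemUp C.g x a b m e
      - ∑ m, chr C.g x m e a * riemUp C.g x m b d e
      - ∑ m, chr C.g x m e b * riemUp C.g x a m d e) * C.KM s x a b * C.ξ x d = 0 := by
    rw [sum_rotate]
    refine Finset.sum_eq_zero fun a _ => Finset.sum_eq_zero fun b _ =>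
      Finset.sum_eq_zero fun d _ => ?_
    rw [← Finset.sum_mul, ← Finset.sum_mul, hg.divergence_riemUp hC.ricciFlat hx, zero_mul,
      zero_mul]
  simp only [divergence, hpd, hC.pd_KM s hx, hC.pd_ξ hx]
  simp only [add_mul, sub_mul, mul_sub, Finset.sum_add_distrib, Finset.sum_sub_distrib] at hdf ⊢
  have g1 : ∑ e, ∑ m, chr C.g x e e m * C.Y s x m = ∑ e, ∑ a, ∑ b, ∑ d,
      (∑ m, chr C.g x e e m * riemUp C.g x a b d m) * C.KM s x a b * C.ξ x d := by
    refine Finset.sum_congr rfl fun e _ => ?_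
    simp only [Coords.Y, Finset.mul_sum, Finset.sum_mul]
    rw [sum_rotate fun m a b d => chr C.g x e e m * (riemUp C.g x a b d m * C.KM s x a b * C.ξ x d)]
    refine Finset.sum_congr rfl fun _ _ => Finset.sum_congr rfl fun _ _ =>
      Finset.sum_congr rfl fun _ _ => Finset.sum_congr rfl fun _ _ => by ring
  have g2 : ∑ e, ∑ a, ∑ b, ∑ d, riemUp C.g x a b d e * (∑ m, chr C.g x a e m * C.KM s x m b)
      * C.ξ x d = ∑ e, ∑ a, ∑ b, ∑ d,
      (∑ m, chr C.g x m e a * riemUp C.g x m b d e) * C.KM s x a b * C.ξ x d := by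
    refine Finset.sum_congr rfl fun e _ => ?_
    simp only [Finset.mul_sum, Finset.sum_mul]
    rw [sum_swap_fst_fth]
    refine Finset.sum_congr rfl fun _ _ => Finset.sum_congr rfl fun _ _ =>
      Finset.sum_congr rfl fun _ _ => Finset.sum_congr rfl fun _ _ => by ring
  have g3 : ∑ e, ∑ a, ∑ b, ∑ d, riemUp C.g x a b d e * (∑ m, C.KM s x a m * chr C.g x b e m)
      * C.ξ x d = ∑ e, ∑ a, ∑ b, ∑ d,
      (∑ m, chr C.g x m e b * riemUp C.g x a m d e) * C.KM s x a b * C.ξ x d := by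
    refine Finset.sum_congr rfl fun e _ => ?_
    simp only [Finset.mul_sum, Finset.sum_mul]
    rw [sum_swap_snd_fth]
    refine Finset.sum_congr rfl fun _ _ => Finset.sum_congr rfl fun _ _ =>
      Finset.sum_congr rfl fun _ _ => Finset.sum_congr rfl fun _ _ => by ring
  have g4 : ∑ e, ∑ a, ∑ b, ∑ d, riemUp C.g x a b d e * C.KM s x a b
      * (∑ c, chr C.g x d e c * C.ξ x c) = ∑ e, ∑ a, ∑ b, ∑ d,
      (∑ m, chr C.g x m e d * riemUp C.g x a b m e) * C.KM s x a b * C.ξ x d := by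
    refine Finset.sum_congr rfl fun e _ => ?_
    simp only [Finset.mul_sum, Finset.sum_mul]
    rw [sum_swap_thd_fth]
    refine Finset.sum_congr rfl fun _ _ => Finset.sum_congr rfl fun _ _ =>
      Finset.sum_congr rfl fun _ _ => Finset.sum_congr rfl fun _ _ => by ring
  rw [g1, g2, g3, g4]
  linarith

end IsLocalSolution

/-! ### Frames of self-dual two-forms -/

/-- Integer components of the standard basis of the two-forms on Euclidean `ℝ⁴` which are
self-dual (`s = 1`) or anti-self-dual (`s = -1`). -/
def etaInt (s : ℤ) : Fin 3 → Matrix (Fin 4) (Fin 4) ℤ :=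
  ![!![0, 1, 0, 0; -1, 0, 0, 0; 0, 0, 0, s; 0, 0, -s, 0],
    !![0, 0, 1, 0; 0, 0, 0, -s; -1, 0, 0, 0; 0, s, 0, 0],
    !![0, 0, 0, 1; 0, 0, s, 0; 0, -s, 0, 0; -1, 0, 0, 0]]

/-- The standard basis of the (anti-)self-dual two-forms on Euclidean `ℝ⁴`. -/
def etaSymbol (s : ℤˣ) (p : Fin 3) : Matrix (Fin 4) (Fin 4) ℝ :=
  Matrix.of fun i j => (etaInt s p i j : ℝ)

theorem etaSymbol_transpose (s : ℤˣ) (p : Fin 3) :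
    (etaSymbol s p).transpose = - etaSymbol s p := by
  have h : ∀ s : ℤˣ, ∀ p i j, etaInt s p j i = - etaInt s p i j := by decide +kernel
  ext i j
  simp only [etaSymbol, Matrix.transpose_apply, Matrix.neg_apply, Matrix.of_apply]
  exact_mod_cast h s p i j

theorem etaSymbol_clifford (s : ℤˣ) (p q : Fin 3) :
    etaSymbol s p * etaSymbol s q + etaSymbol s q * etaSymbol s p
      = if p = q then (-2 : ℝ) • 1 else 0 := by
  have h : ∀ s : ℤˣ, ∀ p q i j, ∑ k, etaInt s p i k * etaInt s q k j
      + ∑ k, etaInt s q i k * etaInt s p k j = if p = q ∧ i = j then -2 else 0 := by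
    decide +kernel
  ext i j
  have h' : ∑ k, (etaInt s p i k : ℝ) * etaInt s q k j + ∑ k, (etaInt s q i k : ℝ) * etaInt s p k j
      = if p = q ∧ i = j then -2 else 0 := by exact_mod_cast h s p q i j
  simp only [Matrix.add_apply, Matrix.mul_apply, etaSymbol, Matrix.of_apply, h']
  by_cases hpq : p = q <;> by_cases hij : i = j <;> simp [hpq, hij]

theorem etaSymbol_contract (s : ℤˣ) (t : Fin 4 → Fin 4 → ℝ) (ht : ∀ i j, t j i = - t i j)
    (p : Fin 3) : ∑ a, ∑ b, etaSymbol s p a b * t a b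
      = ![2 * (t 0 1 + sgn s * t 2 3), 2 * (t 0 2 - sgn s * t 1 3),
        2 * (t 0 3 + sgn s * t 1 2)] p := by
  fin_cases p <;>
    simp [etaSymbol, etaInt, sgn, Fin.sum_univ_four, ht 0 1, ht 0 2, ht 0 3, ht 1 2, ht 1 3,
      ht 2 3] <;> ring

/-- For an antisymmetric matrix, (anti-)self-duality amounts to three scalar equations. -/
theorem eq_smul_dualM (s : ℤˣ) (t : Matrix (Fin 4) (Fin 4) ℝ) (ht : ∀ i j, t j i = - t i j)
    (h1 : t 0 1 = sgn s * t 2 3) (h2 : t 0 2 = - (sgn s * t 1 3)) (h3 : t 0 3 = sgn s * t 1 2) :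
    t = sgn s • dualM t := by
  have hs := sgn_mul_self s
  have h0 : ∀ i, t i i = 0 := fun i => by linarith [ht i i]
  have e1 : t 2 3 = sgn s * t 0 1 := by rw [h1, ← mul_assoc, hs, one_mul]
  have e2 : t 1 3 = - (sgn s * t 0 2) := by rw [h2, mul_neg, ← mul_assoc, hs, one_mul, neg_neg]
  have e3 : t 1 2 = sgn s * t 0 3 := by rw [h3, ← mul_assoc, hs, one_mul]
  have d : dualM t = !![0, t 2 3, -t 1 3, t 1 2; -t 2 3, 0, t 0 3, -t 0 2; t 1 3, -t 0 3, 0, t 0 1;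
    -t 1 2, t 0 2, -t 0 1, 0] := rfl
  ext i j
  rw [d]
  fin_cases i <;> fin_cases j <;> simp only [Matrix.smul_apply, smul_eq_mul, Fin.isValue,
    Fin.zero_eta, Fin.mk_one, Fin.reduceFinMk, Matrix.of_apply, Matrix.cons_val, h0, mul_zero] <;>
    linarith [ht 0 1, ht 0 2, ht 0 3, ht 1 2, ht 1 3, ht 2 3]

/-- `etaSymbol s` is an orthogonal basis of the image of `t ↦ t ± *t`, in which the components of
the image are pairings with `t` itself. -/
theorem etaSymbol_projection (s : ℤˣ) (t : Matrix (Fin 4) (Fin 4) ℝ) (ht : t.transpose = -t) :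
    t + sgn s • dualM t = ∑ p, ((1 / 2) * ∑ a, ∑ b, etaSymbol s p a b * t a b) • etaSymbol s p := by
  have h : ∀ i j, t j i = - t i j := fun i j => congrFun₂ ht i j
  have h0 : ∀ i, t i i = 0 := fun i => by linarith [h i i]
  have hs := sgn_mul_self s
  simp only [etaSymbol_contract s t h, Fin.sum_univ_three]
  ext i j
  simp only [Matrix.add_apply, Matrix.smul_apply, smul_eq_mul]
  have hsc : ((s : ℤ) : ℝ) = sgn s := rfl
  fin_cases i <;> fin_cases j <;>
    simp [etaSymbol, etaInt, dualM, h0, h 0 1, h 0 2, h 0 3, h 1 2, h 1 3, h 2 3, hsc] <;>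
    first
    | ring1
    | linear_combination (-t 2 3) * hs
    | linear_combination (t 2 3) * hs
    | linear_combination (-t 1 3) * hs
    | linear_combination (t 1 3) * hs
    | linear_combination (-t 1 2) * hs
    | linear_combination (t 1 2) * hs

/-- The symmetries of the curvature tensor of a Ricci-flat metric in an orthonormal frame. -/
structure IsRicciFlatCurvature (R : Fin 4 → Fin 4 → Fin 4 → Fin 4 → ℝ) : Prop where
  swap_left : ∀ a b c d, R b a c d = - R a b c d
  swap_right : ∀ a b c d, R a b d c = - R a b c d
  pair : ∀ a b c d, R a b c d = R c d a b
  cyclic : ∀ a b c d, R a b c d + R b c a d + R c a b d = 0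
  ricci : ∀ a b, ∑ c, R c a c b = 0

/-- The self-dual part of a Ricci-flat curvature tensor, contracted in its first pair with a
self-dual two-form, is self-dual in the second pair: there is no mixed block. -/
theorem IsRicciFlatCurvature.contract_eta {R : Fin 4 → Fin 4 → Fin 4 → Fin 4 → ℝ}
    (hR : IsRicciFlatCurvature R) (s : ℤˣ) (p : Fin 3) :
    (Matrix.of fun k l => ∑ i, ∑ j, etaSymbol s p i j * R i j k l)
      = sgn s • dualM (Matrix.of fun k l => ∑ i, ∑ j, etaSymbol s p i j * R i j k l) := by
  obtain ⟨hl, hr, hp, -, hric⟩ := hR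
  have ric : ∀ a b, R 0 a 0 b + R 1 a 1 b + R 2 a 2 b + R 3 a 3 b = 0 := fun a b => by
    rw [← hric a b, Fin.sum_univ_four]
  have zl : ∀ a c d, R a a c d = 0 := fun a c d => by linarith [hl a a c d]
  have zr : ∀ a c d, R c d a a = 0 := fun a c d => by linarith [hr c d a a]
  have red : ∀ a b c d, R b a c d = - R a b c d := hl
  have hs := sgn_mul_self s
  have e : ∀ k l, (Matrix.of fun k l => ∑ i, ∑ j, etaSymbol s p i j * R i j k l :
      Matrix (Fin 4) (Fin 4) ℝ) k l = ![2 * (R 0 1 k l + sgn s * R 2 3 k l),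
        2 * (R 0 2 k l - sgn s * R 1 3 k l), 2 * (R 0 3 k l + sgn s * R 1 2 k l)] p := fun k l =>
    etaSymbol_contract s (fun i j => R i j k l) (fun i j => hl i j k l) p
  have r00 := ric 0 0
  have r11 := ric 1 1
  have r22 := ric 2 2
  have r33 := ric 3 3
  have r01 := ric 0 1
  have r02 := ric 0 2
  have r03 := ric 0 3
  have r12 := ric 1 2
  have r13 := ric 1 3
  have r23 := ric 2 3
  simp only [zl, zr, red 0 1, red 0 2, red 0 3, red 1 2, red 1 3, red 2 3, hr _ _ 0 1, hr _ _ 0 2,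
    hr _ _ 0 3, hr _ _ 1 2, hr _ _ 1 3, hr _ _ 2 3] at r00 r11 r22 r33 r01 r02 r03 r12 r13 r23
  have pr := hp 0 1 0 2
  have p2 := hp 0 1 0 3
  have p3 := hp 0 1 1 2
  have p4 := hp 0 1 1 3
  have p5 := hp 0 1 2 3
  have p6 := hp 0 2 0 3
  have p7 := hp 0 2 1 2
  have p8 := hp 0 2 1 3
  have p9 := hp 0 2 2 3
  have p10 := hp 0 3 1 2
  have p11 := hp 0 3 1 3
  have p12 := hp 0 3 2 3
  have p13 := hp 1 2 1 3
  have p14 := hp 1 2 2 3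
  have p15 := hp 1 3 2 3
  have hs' : ∀ y, sgn s * (sgn s * y) = y := fun y => by rw [← mul_assoc, hs, one_mul]
  apply eq_smul_dualM
  · intro i j
    rw [e, e]
    fin_cases p <;> simp [hr _ _ i j] <;> ring
  all_goals
    rw [e, e]
    fin_cases p <;>
    simp only [Fin.isValue, Fin.zero_eta, Fin.mk_one, Fin.reduceFinMk, Matrix.cons_val]
  all_goals rcases Int.units_eq_one_or s with rfl | rfl
  all_goals simp only [sgn, Units.val_one, Units.val_neg, Int.cast_one, Int.cast_neg]
  all_goals linarith

/-- The (anti-)self-dual block of the curvature is trace-free, by the first Bianchi identity and the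
vanishing of the scalar curvature. -/
theorem IsRicciFlatCurvature.trace_eta {R : Fin 4 → Fin 4 → Fin 4 → Fin 4 → ℝ}
    (hR : IsRicciFlatCurvature R) (s : ℤˣ) :
    ∑ p, ∑ k, ∑ l, etaSymbol s p k l * ∑ i, ∑ j, etaSymbol s p i j * R i j k l = 0 := by
  obtain ⟨hl, hr, hp, hc, hric⟩ := hR
  have ric : ∀ a b, R 0 a 0 b + R 1 a 1 b + R 2 a 2 b + R 3 a 3 b = 0 := fun a b => by
    rw [← hric a b, Fin.sum_univ_four]
  have zl : ∀ a c d, R a a c d = 0 := fun a c d => by linarith [hl a a c d]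
  have e : ∀ p k l, ∑ i, ∑ j, etaSymbol s p i j * R i j k l
      = ![2 * (R 0 1 k l + sgn s * R 2 3 k l),
        2 * (R 0 2 k l - sgn s * R 1 3 k l), 2 * (R 0 3 k l + sgn s * R 1 2 k l)] p := fun p k l =>
    etaSymbol_contract s (fun i j => R i j k l) (fun i j => hl i j k l) p
  have e2 : ∀ p, ∑ k, ∑ l, etaSymbol s p k l * ∑ i, ∑ j, etaSymbol s p i j * R i j k l = _ :=
    fun p => etaSymbol_contract s (fun k l => ∑ i, ∑ j, etaSymbol s p i j * R i j k l)
      (fun k l => by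
        rw [← Finset.sum_neg_distrib]
        refine Finset.sum_congr rfl fun i _ => ?_
        rw [← Finset.sum_neg_distrib]
        exact Finset.sum_congr rfl fun j _ => by rw [hr i j k l, mul_neg]) p
  simp only [Fin.sum_univ_three, e2]
  simp only [e, Matrix.cons_val]
  have r00 := ric 0 0
  have r11 := ric 1 1
  have r22 := ric 2 2
  have r33 := ric 3 3
  simp only [zl, hl 0 1, hl 0 2, hl 0 3, hl 1 2, hl 1 3, hl 2 3, hr _ _ 0 1, hr _ _ 0 2,
    hr _ _ 0 3, hr _ _ 1 2, hr _ _ 1 3, hr _ _ 2 3] at r00 r11 r22 r33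
  have c1 := hc 0 1 2 3
  rw [hl 0 2] at c1
  have c2 := hc 1 2 0 3
  have h3 := hp 2 3 0 1
  have h4 := hp 1 3 0 2
  have h5 := hp 1 2 0 3
  rcases Int.units_eq_one_or s with rfl | rfl
  all_goals simp only [sgn, Units.val_one, Units.val_neg, Int.cast_one, Int.cast_neg]
  all_goals linarith

open scoped MatrixOrder Matrix.Norms.L2Operator in
/-- Existence of a positively oriented orthonormal frame, whose vectors are the columns of `B`. -/
theorem IsMetricOn.exists_frame {g : Eucl 4 → Fin 4 → Fin 4 → ℝ} {U : Set (Eucl 4)} {x : Eucl 4}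
    (hg : IsMetricOn g U) (hx : x ∈ U) : ∃ B : Matrix (Fin 4) (Fin 4) ℝ,
      B * B.transpose = (gM g x)⁻¹ ∧ B.transpose * gM g x * B = 1
        ∧ B.det = 1 / Real.sqrt (gM g x).det := by
  have hpos : (gM g x)⁻¹.PosDef := (hg.posDef x hx).inv
  obtain ⟨b, hb⟩ := CStarAlgebra.nonneg_iff_eq_star_mul_self.mp hpos.posSemidef.nonneg
  have hp := hg.det_pos hx
  have hq := Real.sqrt_pos.2 hp
  -- it suffices to find such a `B` with positive determinant
  have key : ∀ B : Matrix (Fin 4) (Fin 4) ℝ, B * B.transpose = (gM g x)⁻¹ → 0 < B.det →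
      B.transpose * gM g x * B = 1 ∧ B.det = 1 / Real.sqrt (gM g x).det := by
    intro B hB hdet
    have hu : IsUnit B.det := hdet.ne'.isUnit
    constructor
    · have h1 : B * (B.transpose * gM g x) = 1 := by rw [← mul_assoc, hB, hg.inv_mul hx]
      exact mul_eq_one_comm.mp h1
    · have h1 := congrArg Matrix.det hB
      rw [Matrix.det_mul, Matrix.det_transpose, Matrix.det_nonsing_inv, Ring.inverse_eq_inv'] at h1
      rw [eq_div_iff hq.ne']
      have h2 : (B.det * Real.sqrt (gM g x).det) ^ 2 = 1 := by
        rw [mul_pow, Real.sq_sqrt hp.le, sq, h1, inv_mul_cancel₀ hp.ne']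
      have h3 : 0 < B.det * Real.sqrt (gM g x).det := mul_pos hdet hq
      nlinarith
  have hb' : b.transpose * b.transpose.transpose = (gM g x)⁻¹ := by
    rw [hb, Matrix.transpose_transpose, Matrix.star_eq_conjTranspose,
      Matrix.conjTranspose_eq_transpose_of_trivial]
  have hdet : b.det ≠ 0 := by
    intro h0
    have h1 := congrArg Matrix.det hb'
    rw [Matrix.det_mul, Matrix.transpose_transpose, h0, mul_zero] at h1
    exact hpos.det_pos.ne h1
  rcases lt_or_gt_of_ne hdet with h | h
  · set D : Matrix (Fin 4) (Fin 4) ℝ := Matrix.diagonal ![-1, 1, 1, 1] with hD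
    have hDD : D * D.transpose = 1 := by
      rw [hD, Matrix.diagonal_transpose, Matrix.diagonal_mul_diagonal, ← Matrix.diagonal_one]
      congr 1
      ext i
      fin_cases i <;> simp
    have hB : (b.transpose * D) * (b.transpose * D).transpose = (gM g x)⁻¹ := by
      rw [Matrix.transpose_mul, mul_assoc, ← mul_assoc D, hDD, one_mul, hb']
    have hd : 0 < (b.transpose * D).det := by
      rw [Matrix.det_mul, Matrix.det_transpose, hD, Matrix.det_diagonal]
      simp [Fin.prod_univ_four, h]
    exact ⟨_, hB, key _ hB hd⟩
  · exact ⟨_, hb', key _ hb' (by rwa [Matrix.det_transpose])⟩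

/-- `Θ` is a basis of the (anti-)self-dual bivectors at `x`, satisfying the quaternion relations,
and `w` is the matrix of the (anti-)self-dual Weyl tensor of the Ricci-flat metric in this basis. -/
structure IsSDFrame (g : Eucl 4 → Fin 4 → Fin 4 → ℝ) (s : ℤˣ) (x : Eucl 4)
    (Θ : Fin 3 → Matrix (Fin 4) (Fin 4) ℝ) (w : Matrix (Fin 3) (Fin 3) ℝ) : Prop where
  antisymm : ∀ p, (Θ p).transpose = - Θ p
  -- orthogonality and the relation `Θ_p² = -1` of unit imaginary quaternions
  clifford : ∀ p q, Θ p * gM g x * Θ q + Θ q * gM g x * Θ p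
    = if p = q then (-2 : ℝ) • (gM g x)⁻¹ else 0
  upSD_eq : ∀ t : Matrix (Fin 4) (Fin 4) ℝ, t.transpose = -t →
    upSD g s x t = ∑ p, ((1 / 2) * ∑ a, ∑ b, Θ p a b * t a b) • Θ p
  riem_eq : ∀ p c d, ∑ a, ∑ b, Θ p a b * riem g x a b c d
    = 2 * ∑ q, w p q * (gM g x * Θ q * gM g x) c d
  w_symm : w.transpose = w
  w_trace : w.trace = 0

/-- Moving a change of basis from one side of the pairing of two matrices to the other. -/
theorem sum_mul_conj (B η t : Matrix (Fin 4) (Fin 4) ℝ) :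
    ∑ a, ∑ b, (B * η * B.transpose) a b * t a b
      = ∑ i, ∑ j, η i j * (B.transpose * t * B) i j := by
  have h1 : ∀ t u : Matrix (Fin 4) (Fin 4) ℝ,
      ∑ a, ∑ b, u a b * t a b = (u.transpose * t).trace := by
    intro t u
    simp only [Matrix.trace, Matrix.diag, Matrix.mul_apply, Matrix.transpose_apply]
    exact Finset.sum_comm
  rw [h1, h1, Matrix.transpose_mul, Matrix.transpose_mul, Matrix.transpose_transpose,
    Matrix.mul_assoc, Matrix.trace_mul_comm]
  simp only [Matrix.mul_assoc]

/-- The standard basis `etaSymbol`, carried to `x` by a positively oriented orthonormal frame. -/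
theorem IsMetricOn.exists_sdFrame {g : Eucl 4 → Fin 4 → Fin 4 → ℝ} {U : Set (Eucl 4)}
    {x : Eucl 4} (hg : IsMetricOn g U) (hx : x ∈ U) (hric : ∀ a b, ric g x a b = 0) (s : ℤˣ) :
    ∃ Θ w, IsSDFrame g s x Θ w := by
  obtain ⟨B, hBB, hBG, hdet⟩ := hg.exists_frame hx
  have hBi : (gM g x * B) * B.transpose = 1 := by rw [mul_assoc, hBB, hg.mul_inv hx]
  have hBi' : B * (B.transpose * gM g x) = 1 := by rw [← mul_assoc, hBB, hg.inv_mul hx]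
  -- the curvature in the frame
  set R : Fin 4 → Fin 4 → Fin 4 → Fin 4 → ℝ := fun i j k l =>
    ∑ a, ∑ b, ∑ c, ∑ d, B a i * B b j * B c k * B d l * riem g x a b c d with hRdef
  have hR : IsRicciFlatCurvature R := by
    have hneg : ∀ f h : Fin 4 → Fin 4 → Fin 4 → Fin 4 → ℝ, (∀ a b c d, f a b c d = - h a b c d) →
        ∑ a, ∑ b, ∑ c, ∑ d, f a b c d = - ∑ a, ∑ b, ∑ c, ∑ d, h a b c d := by
      intro f h H
      simp only [H, Finset.sum_neg_distrib]
    have s12 : ∀ f : Fin 4 → Fin 4 → Fin 4 → Fin 4 → ℝ,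
        ∑ a, ∑ b, ∑ c, ∑ d, f a b c d = ∑ a, ∑ b, ∑ c, ∑ d, f b a c d := fun f => Finset.sum_comm
    have s23 : ∀ f : Fin 4 → Fin 4 → Fin 4 → Fin 4 → ℝ,
        ∑ a, ∑ b, ∑ c, ∑ d, f a b c d = ∑ a, ∑ b, ∑ c, ∑ d, f a c b d := fun f =>
      Finset.sum_congr rfl fun a _ => Finset.sum_comm
    have s34 : ∀ f : Fin 4 → Fin 4 → Fin 4 → Fin 4 → ℝ,
        ∑ a, ∑ b, ∑ c, ∑ d, f a b c d = ∑ a, ∑ b, ∑ c, ∑ d, f a b d c := fun f =>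
      Finset.sum_congr rfl fun a _ => Finset.sum_congr rfl fun b _ => Finset.sum_comm
    constructor
    · intro i j k l
      rw [hRdef]
      simp only
      rw [s12]
      refine hneg _ _ fun a b c d => ?_
      rw [riem_swap a b]; ring
    · intro i j k l
      rw [hRdef]
      simp only
      rw [s34]
      refine hneg _ _ fun a b c d => ?_
      rw [hg.riem_antisymm_right hx a b d c]; ring
    · intro i j k l
      rw [hRdef]
      simp only
      rw [s23, s12, s34, s23]
      refine Finset.sum_congr rfl fun a _ => Finset.sum_congr rfl fun b _ =>
        Finset.sum_congr rfl fun c _ => Finset.sum_congr rfl fun d _ => ?_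
      rw [hg.riem_pair hx c d a b]; ring
    · intro i j k l
      rw [hRdef]
      simp only
      rw [s23 fun a b c d => B a j * B b k * B c i * B d l * riem g x a b c d,
        s12 fun a b c d => B a j * B c k * B b i * B d l * riem g x a c b d,
        s12 fun a b c d => B a k * B b i * B c j * B d l * riem g x a b c d,
        s23 fun a b c d => B b k * B a i * B c j * B d l * riem g x b a c d]
      simp only [← Finset.sum_add_distrib]
      refine Finset.sum_eq_zero fun a _ => Finset.sum_eq_zero fun b _ =>
        Finset.sum_eq_zero fun c _ => Finset.sum_eq_zero fun d _ => ?_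
      linear_combination (B a i * B b j * B c k * B d l) * hg.riem_cyclic hx a b c d
    · intro i j
      have hB : ∀ a c, ∑ k, B a k * B c k = ginv g x a c := fun a c => congrFun₂ hBB a c
      have h1 : ∑ k, R k i k j = ∑ b, ∑ d, B b i * B d j * ric g x b d := by
        have hr : ∀ b d, ric g x b d = ∑ a, ∑ c, (∑ k, B a k * B c k) * riem g x a b c d := by
          intro b d
          simp only [hB]
          unfold ric
          rw [Finset.sum_comm]
          exact Finset.sum_congr rfl fun a _ => Finset.sum_congr rfl fun c _ => by
            rw [hg.ginv_symm hx]
        simp only [hr, hRdef]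
        simp only [Finset.mul_sum, Finset.sum_mul]
        rw [Finset.sum_comm]
        rw [Finset.sum_congr rfl fun a _ => sum_rotate
          fun k b c d => B a k * B b i * B c k * B d j * riem g x a b c d]
        rw [s12]
        refine Finset.sum_congr rfl fun b _ => ?_
        rw [Finset.sum_congr rfl fun a _ => Finset.sum_comm, Finset.sum_comm]
        refine Finset.sum_congr rfl fun d _ => Finset.sum_congr rfl fun a _ =>
          Finset.sum_congr rfl fun c _ => Finset.sum_congr rfl fun k _ => by ring
      rw [h1]
      simp [hric]
  set w : Matrix (Fin 3) (Fin 3) ℝ := Matrix.of fun p q =>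
    (1 / 8) * ∑ k, ∑ l, etaSymbol s q k l * ∑ i, ∑ j, etaSymbol s p i j * R i j k l with hw
  have hcontr : ∀ p k l, ∑ i, ∑ j, etaSymbol s p i j * R i j k l
      = 2 * ∑ q, w p q * etaSymbol s q k l := by
    intro p k l
    set t : Matrix (Fin 4) (Fin 4) ℝ :=
      Matrix.of fun k l => ∑ i, ∑ j, etaSymbol s p i j * R i j k l with ht
    have h1 : t = sgn s • dualM t := hR.contract_eta s p
    have htt : t.transpose = -t := by
      rw [h1, Matrix.transpose_smul, dualM_transpose, smul_neg]
    have h2 := etaSymbol_projection s t htt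
    rw [← h1] at h2
    have h3 := congrFun₂ h2 k l
    simp only [Matrix.add_apply, Matrix.sum_apply, Matrix.smul_apply, smul_eq_mul] at h3
    have h4 : ∀ q, w p q = (1 / 8) * ∑ a, ∑ b, etaSymbol s q a b * t a b := fun q => rfl
    change t k l = _
    have h5 : t k l = (1 / 2) * ∑ q, 1 / 2 * (∑ a, ∑ b, etaSymbol s q a b * t a b)
        * etaSymbol s q k l := by linarith
    rw [h5, Finset.mul_sum, Finset.mul_sum]
    exact Finset.sum_congr rfl fun q _ => by rw [h4]; ring
  refine ⟨fun p => B * etaSymbol s p * B.transpose, w, ?_, ?_, ?_, ?_, ?_, ?_⟩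
  · intro p
    simp [Matrix.transpose_mul, etaSymbol_transpose, mul_assoc]
  · intro p q
    have h : ∀ p q, B * etaSymbol s p * B.transpose * gM g x * (B * etaSymbol s q * B.transpose)
        = B * (etaSymbol s p * etaSymbol s q) * B.transpose := by
      intro p q
      calc _ = B * etaSymbol s p * (B.transpose * gM g x * B) * etaSymbol s q * B.transpose := by
            simp only [mul_assoc]
        _ = _ := by rw [hBG]; simp only [mul_assoc, one_mul]
    rw [h, h, ← add_mul, ← mul_add, etaSymbol_clifford]
    split_ifs
    · rw [Matrix.mul_smul, Matrix.smul_mul, mul_one, hBB]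
    · simp
  · intro t ht
    have htt : (B.transpose * t * B).transpose = -(B.transpose * t * B) := by
      simp [Matrix.transpose_mul, ht, mul_assoc]
    have h1 : upSD g s x t = B * (B.transpose * t * B + sgn s • dualM (B.transpose * t * B))
        * B.transpose := by
      rw [mul_add, add_mul, Matrix.mul_smul, Matrix.smul_mul, dualM_conj B t ht, hdet, upSD, ← hBB,
        smul_smul]
      simp only [mul_assoc, mul_one_div]
    rw [h1, etaSymbol_projection s _ htt]
    simp only [sum_mul_conj, Finset.mul_sum, Finset.sum_mul, Matrix.mul_smul, Matrix.smul_mul]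
  · intro p c d
    set X : Matrix (Fin 4) (Fin 4) ℝ := Matrix.of fun c d =>
      ∑ a, ∑ b, (B * etaSymbol s p * B.transpose) a b * riem g x a b c d with hX
    have h1 : B.transpose * X * B = (2 : ℝ) • ∑ q, w p q • etaSymbol s q := by
      ext k l
      have h2 : (B.transpose * X * B) k l = ∑ i, ∑ j, etaSymbol s p i j * R i j k l := by
        have e1 : ∀ c d, X c d = ∑ i, ∑ j, etaSymbol s p i j
            * ∑ a, ∑ b, B a i * B b j * riem g x a b c d := by
          intro c d
          have := sum_mul_conj B (etaSymbol s p) (Matrix.of fun a b => riem g x a b c d)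
          refine this.trans ?_
          refine Finset.sum_congr rfl fun i _ => Finset.sum_congr rfl fun j _ => ?_
          simp only [Matrix.mul_apply, Matrix.transpose_apply, Matrix.of_apply, Finset.sum_mul]
          rw [Finset.sum_comm]
          congr 1
          exact Finset.sum_congr rfl fun i _ => Finset.sum_congr rfl fun j _ => by ring
        have e2 : ∀ i j, R i j k l = ∑ c, ∑ d, B c k * B d l
            * ∑ a, ∑ b, B a i * B b j * riem g x a b c d := by
          intro i j
          rw [hRdef]
          simp only [Finset.mul_sum]
          rw [sum_pair_comm]
          refine Finset.sum_congr rfl fun a _ => Finset.sum_congr rfl fun b _ =>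
            Finset.sum_congr rfl fun c _ => Finset.sum_congr rfl fun d _ => by ring
        have e3 : (B.transpose * X * B) k l = ∑ c, ∑ d, B c k * B d l * X c d := by
          simp only [Matrix.mul_apply, Matrix.transpose_apply, Finset.sum_mul]
          rw [Finset.sum_comm]
          exact Finset.sum_congr rfl fun c _ => Finset.sum_congr rfl fun d _ => by ring
        rw [e3]
        obtain ⟨Q, hQ⟩ : ∃ Q : Fin 4 → Fin 4 → Fin 4 → Fin 4 → ℝ,
          ∀ i j c d, ∑ a, ∑ b, B a i * B b j * riem g x a b c d = Q i j c d :=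
        ⟨_, fun _ _ _ _ => rfl⟩
        simp only [e1, e2, hQ, Finset.mul_sum]
        rw [sum_pair_comm]
        refine Finset.sum_congr rfl fun i _ => Finset.sum_congr rfl fun j _ =>
          Finset.sum_congr rfl fun c _ => Finset.sum_congr rfl fun d _ => by ring
      rw [h2, hcontr]
      simp [Matrix.sum_apply]
    have h3 : X = (gM g x * B) * (B.transpose * X * B) * (B.transpose * gM g x) := by
      calc X = ((gM g x * B) * B.transpose) * X * (B * (B.transpose * gM g x)) := by
            rw [hBi, hBi', one_mul, mul_one]
        _ = _ := by simp only [mul_assoc]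
    change X c d = _
    rw [h3, h1]
    simp only [Matrix.mul_smul, Matrix.smul_mul, Matrix.mul_sum, Matrix.sum_mul, Matrix.smul_apply,
      Matrix.sum_apply, smul_eq_mul, mul_assoc]
  · ext p q
    simp only [hw, Matrix.transpose_apply, Matrix.of_apply]
    congr 1
    simp only [Finset.mul_sum]
    rw [sum_pair_comm]
    refine Finset.sum_congr rfl fun i _ => Finset.sum_congr rfl fun j _ =>
      Finset.sum_congr rfl fun k _ => Finset.sum_congr rfl fun l _ => ?_
    rw [hR.pair k l i j]; ring
  · simp only [Matrix.trace, Matrix.diag, hw, Matrix.of_apply]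
    rw [← Finset.mul_sum, hR.trace_eta, mul_zero]

/-! ### The Killing field in a frame of self-dual bivectors -/

open Matrix in
/-- The vector field `Θ_p^{ab} ξ_b`. -/
def frameVec (C : Coords) (x : Eucl 4) (Θ : Fin 3 → Matrix (Fin 4) (Fin 4) ℝ) (p : Fin 3) :
    Fin 4 → ℝ := (Θ p).mulVec (C.eta x)

/-- The coefficients of `𝓕^{± ab}` in the frame `Θ`. -/
def frameCoef (C : Coords) (x : Eucl 4) (Θ : Fin 3 → Matrix (Fin 4) (Fin 4) ℝ) (p : Fin 3) : ℝ :=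
  (1 / 2) * ∑ a, ∑ b, Θ p a b * C.FM x a b

section

variable {C : Coords} {U : Set (Eucl 4)} {x : Eucl 4} {s : ℤˣ}
  {Θ : Fin 3 → Matrix (Fin 4) (Fin 4) ℝ} {w : Matrix (Fin 3) (Fin 3) ℝ}

namespace IsLocalSolution

variable (hC : IsLocalSolution C U) (hx : x ∈ U) (hΘ : IsSDFrame C.g s x Θ w)
include hC hx hΘ

theorem KM_eq_sum : C.KM s x = ∑ p, frameCoef C x Θ p • Θ p :=
  hΘ.upSD_eq _ (hC.FM_transpose hx)

theorem SFsq_eq_sum : C.SFsq s x = 4 * ∑ p, frameCoef C x Θ p ^ 2 := by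
  rw [hC.SFsq_eq s hx, hC.KM_eq_sum hx hΘ]
  simp only [Matrix.sum_apply, Matrix.smul_apply, smul_eq_mul, Finset.mul_sum]
  have h : ∀ p, 4 * frameCoef C x Θ p ^ 2
      = ∑ a, ∑ b, 2 * (C.FM x a b * (frameCoef C x Θ p * Θ p a b)) := by
    intro p
    have e : ∑ a, ∑ b, 2 * (C.FM x a b * (frameCoef C x Θ p * Θ p a b))
        = 4 * frameCoef C x Θ p * ((1 / 2) * ∑ a, ∑ b, Θ p a b * C.FM x a b) := by
      simp only [Finset.mul_sum]
      exact Finset.sum_congr rfl fun _ _ => Finset.sum_congr rfl fun _ _ => by ring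
    rw [e, ← frameCoef]; ring
  simp only [h]
  rw [Finset.sum_comm]
  conv_rhs => rw [Finset.sum_comm]
  rw [Finset.sum_comm]
  refine Finset.sum_congr rfl fun a _ => ?_
  exact Finset.sum_comm

theorem sigmaUp_eq_sum (a : Fin 4) :
    C.sigmaUp s x a = ∑ p, (2 * frameCoef C x Θ p) * frameVec C x Θ p a := by
  rw [hC.sigmaUp_eq s hx, hC.KM_eq_sum hx hΘ]
  simp only [Matrix.sum_apply, Matrix.smul_apply, smul_eq_mul, frameVec, Matrix.mulVec, dotProduct,
    Finset.mul_sum, Finset.sum_mul]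
  rw [Finset.sum_comm]
  exact Finset.sum_congr rfl fun _ _ => Finset.sum_congr rfl fun _ _ => by ring

omit hΘ in
theorem lam_eq_eta : C.lam x = C.eta x ⬝ᵥ (gM C.g x)⁻¹.mulVec (C.eta x) := by
  have h : (gM C.g x)⁻¹.mulVec (C.eta x) = C.ξ x := funext fun a => (hC.ξ_eq_raise hx a).symm
  rw [h]; rfl

/-- The vectors `Θ_p^{ab} ξ_b` are orthogonal, with square `λ`. -/
theorem frameVec_inner (p q : Fin 3) : ∑ a, lower1 C.g x (frameVec C x Θ p) a * frameVec C x Θ q a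
    = if p = q then C.lam x else 0 := by
  have h1 : ∀ p q, ∑ a, lower1 C.g x (frameVec C x Θ p) a * frameVec C x Θ q a
      = - (C.eta x ⬝ᵥ (Θ p * gM C.g x * Θ q).mulVec (C.eta x)) := by
    intro p q
    change (gM C.g x).mulVec ((Θ p).mulVec (C.eta x)) ⬝ᵥ (Θ q).mulVec (C.eta x) = _
    rw [Matrix.mulVec_mulVec, ← Matrix.vecMul_transpose, ← Matrix.dotProduct_mulVec,
      Matrix.transpose_mul, hΘ.antisymm, hC.metric.transpose_gM hx, Matrix.mulVec_mulVec,
      Matrix.neg_mul, Matrix.neg_mul, Matrix.neg_mulVec, dotProduct_neg]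
  have h2 : C.eta x ⬝ᵥ (Θ q * gM C.g x * Θ p).mulVec (C.eta x)
      = C.eta x ⬝ᵥ (Θ p * gM C.g x * Θ q).mulVec (C.eta x) := by
    rw [Matrix.dotProduct_mulVec, ← Matrix.mulVec_transpose, dotProduct_comm, Matrix.transpose_mul,
      Matrix.transpose_mul, hΘ.antisymm, hΘ.antisymm, hC.metric.transpose_gM hx]
    simp only [Matrix.neg_mul, Matrix.mul_neg, neg_neg, Matrix.mul_assoc]
  have h3 := congrArg (fun A => C.eta x ⬝ᵥ A.mulVec (C.eta x)) (hΘ.clifford p q)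
  simp only [Matrix.add_mulVec, dotProduct_add, h2] at h3
  rw [h1]
  split_ifs at h3 ⊢ with hpq
  · rw [Matrix.smul_mulVec, dotProduct_smul, ← hC.lam_eq_eta hx] at h3
    simp only [smul_eq_mul] at h3
    linarith
  · simp at h3
    linarith

theorem sum_frameVec_inner (α β : Fin 3 → ℝ) :
    ∑ a, lower1 C.g x (fun a => ∑ p, α p * frameVec C x Θ p a) a * ∑ q, β q * frameVec C x Θ q a
      = C.lam x * ∑ p, α p * β p := by
  have h1 : ∀ a, lower1 C.g x (fun a => ∑ p, α p * frameVec C x Θ p a) a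
      = ∑ p, α p * lower1 C.g x (frameVec C x Θ p) a := by
    intro a
    simp only [lower1, Finset.mul_sum]
    rw [Finset.sum_comm]
    exact Finset.sum_congr rfl fun _ _ => Finset.sum_congr rfl fun _ _ => by ring
  simp only [h1]
  have h2 : ∀ a, (∑ p, α p * lower1 C.g x (frameVec C x Θ p) a) * ∑ q, β q * frameVec C x Θ q a
      = ∑ p, ∑ q, α p * β q * (lower1 C.g x (frameVec C x Θ p) a * frameVec C x Θ q a) := by
    intro a
    rw [Finset.sum_mul_sum]
    exact Finset.sum_congr rfl fun _ _ => Finset.sum_congr rfl fun _ _ => by ring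
  simp only [h2]
  rw [Finset.sum_comm, Finset.mul_sum]
  refine Finset.sum_congr rfl fun p _ => ?_
  rw [Finset.sum_comm]
  simp only [← Finset.mul_sum, hC.frameVec_inner hx hΘ]
  simp; ring

/-- The curvature contracted with a frame bivector and the Killing field. -/
theorem riemUp_frame (p : Fin 3) (e : Fin 4) :
    ∑ a, ∑ b, ∑ d, riemUp C.g x a b d e * Θ p a b * C.ξ x d
      = - 2 * ∑ q, w p q * frameVec C x Θ q e := by
  have h1 : ∀ d, ∑ a, ∑ b, riemUp C.g x a b d e * Θ p a b
      = ∑ m, (2 * ∑ q, w p q * (gM C.g x * Θ q * gM C.g x) d m) * ginv C.g x m e := by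
    intro d
    simp only [← hΘ.riem_eq, hC.metric.riem_raise hx, Finset.sum_mul]
    conv_rhs => rw [Finset.sum_comm]
    refine Finset.sum_congr rfl fun a _ => ?_
    rw [Finset.sum_comm]
    exact Finset.sum_congr rfl fun _ _ => Finset.sum_congr rfl fun _ _ => by ring
  have h2 : ∀ q d, ∑ m, (gM C.g x * Θ q * gM C.g x) d m * ginv C.g x m e
      = (gM C.g x * Θ q) d e := by
    intro q d
    have h : (gM C.g x * Θ q * gM C.g x * (gM C.g x)⁻¹) d e = (gM C.g x * Θ q) d e := by
      rw [mul_assoc _ (gM C.g x), hC.metric.mul_inv hx, mul_one]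
    exact h
  have h3 : ∀ q, ∑ d, (gM C.g x * Θ q) d e * C.ξ x d = - frameVec C x Θ q e := by
    intro q
    have h : (gM C.g x * Θ q).transpose.mulVec (C.ξ x) = - (Θ q).mulVec (C.eta x) := by
      rw [Matrix.transpose_mul, hΘ.antisymm, hC.metric.transpose_gM hx, ← Matrix.mulVec_mulVec,
        Matrix.neg_mulVec]
      rfl
    exact congrFun h e
  have h4 : ∑ a, ∑ b, ∑ d, riemUp C.g x a b d e * Θ p a b * C.ξ x d
      = ∑ d, (∑ a, ∑ b, riemUp C.g x a b d e * Θ p a b) * C.ξ x d := by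
    simp only [Finset.sum_mul]
    conv_rhs => rw [Finset.sum_comm]
    exact Finset.sum_congr rfl fun a _ => Finset.sum_comm
  have h5 : ∀ d, ∑ m, (2 * ∑ q, w p q * (gM C.g x * Θ q * gM C.g x) d m) * ginv C.g x m e
      = 2 * ∑ q, w p q * (gM C.g x * Θ q) d e := by
    intro d
    simp only [← h2, Finset.mul_sum, Finset.sum_mul]
    rw [Finset.sum_comm]
    exact Finset.sum_congr rfl fun _ _ => Finset.sum_congr rfl fun _ _ => by ring
  rw [h4]
  simp only [h1, h5]
  have h6 : ∑ q, w p q * frameVec C x Θ q e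
      = - ∑ q, w p q * ∑ d, (gM C.g x * Θ q) d e * C.ξ x d := by
    simp only [h3, mul_neg, Finset.sum_neg_distrib, neg_neg]
  rw [h6]
  simp only [Finset.mul_sum, Finset.sum_mul, neg_mul, mul_neg, neg_neg, Finset.sum_neg_distrib]
  rw [Finset.sum_comm]
  exact Finset.sum_congr rfl fun _ _ => Finset.sum_congr rfl fun _ _ => by ring

theorem Y_eq_sum (e : Fin 4) : C.Y s x e
    = ∑ q, (-2 * ∑ p, frameCoef C x Θ p * w p q) * frameVec C x Θ q e := by
  have h1 : C.Y s x e = ∑ p, frameCoef C x Θ p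
      * ∑ a, ∑ b, ∑ d, riemUp C.g x a b d e * Θ p a b * C.ξ x d := by
    rw [Coords.Y, hC.KM_eq_sum hx hΘ]
    simp only [Matrix.sum_apply, Matrix.smul_apply, smul_eq_mul, Finset.mul_sum, Finset.sum_mul]
    conv_rhs => rw [sum_rotate]
    refine Finset.sum_congr rfl fun _ _ => Finset.sum_congr rfl fun _ _ =>
      Finset.sum_congr rfl fun _ _ => Finset.sum_congr rfl fun _ _ => by ring
  rw [h1]
  simp only [hC.riemUp_frame hx hΘ, Finset.mul_sum, Finset.sum_mul]
  rw [Finset.sum_comm]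
  exact Finset.sum_congr rfl fun _ _ => Finset.sum_congr rfl fun _ _ => by ring

/-- `D_e 𝓕^{± ab}` in the frame. -/
theorem upSD_DFM (e : Fin 4) : upSD C.g s x (C.DFM e x)
    = ∑ p, (- ∑ q, w p q * lower1 C.g x (frameVec C x Θ q) e) • Θ p := by
  rw [hΘ.upSD_eq _ (hC.DFM_transpose hx e)]
  refine Finset.sum_congr rfl fun p _ => ?_
  congr 1
  have h1 : ∑ a, ∑ b, Θ p a b * C.DFM e x a b
      = - ∑ d, (∑ a, ∑ b, Θ p a b * riem C.g x a b e d) * C.ξ x d := by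
    simp only [hC.kostant hx, Finset.sum_mul, mul_neg, Finset.sum_neg_distrib, Finset.mul_sum]
    congr 1
    conv_rhs => rw [Finset.sum_comm]
    refine Finset.sum_congr rfl fun a _ => ?_
    rw [Finset.sum_comm]
    exact Finset.sum_congr rfl fun _ _ => Finset.sum_congr rfl fun _ _ => by ring
  have h2 : ∀ q, ∑ d, (gM C.g x * Θ q * gM C.g x) e d * C.ξ x d
      = lower1 C.g x (frameVec C x Θ q) e := by
    intro q
    have h : (gM C.g x * Θ q * gM C.g x).mulVec (C.ξ x)
        = (gM C.g x).mulVec ((Θ q).mulVec ((gM C.g x).mulVec (C.ξ x))) := by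
      simp only [Matrix.mulVec_mulVec, Matrix.mul_assoc]
    exact congrFun h e
  rw [h1]
  simp only [hΘ.riem_eq, ← h2, Finset.mul_sum, Finset.sum_mul, mul_neg]
  rw [Finset.sum_comm]
  congr 1
  exact Finset.sum_congr rfl fun _ _ => Finset.sum_congr rfl fun _ _ => by ring

/-- `div σ^± = (𝓕^±)²`: the curvature term is the trace of `w`, since `⟨Θ_p ξ, Θ_q ξ⟩ = λ δ_pq`. -/
theorem divergence_sigmaUp_eq_of_frame : divergence C.g (C.sigmaUp s) x = C.SFsq s x := by
  rw [hC.divergence_sigmaUp s hx, hC.SFsq_eq s hx]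
  have h1 : ∑ a, ∑ b, upSD C.g s x (C.DFM a x) a b * C.eta x b
      = - ∑ p, ∑ q, w p q * ∑ a, lower1 C.g x (frameVec C x Θ q) a * frameVec C x Θ p a := by
    simp only [hC.upSD_DFM hx hΘ, Matrix.sum_apply, Matrix.smul_apply, smul_eq_mul, frameVec,
      Matrix.mulVec, dotProduct, Finset.mul_sum, Finset.sum_mul, neg_mul, Finset.sum_neg_distrib]
    congr 1
    rw [sum_pair_comm]
    exact Finset.sum_congr rfl fun _ _ => Finset.sum_congr rfl fun _ _ =>
      Finset.sum_congr rfl fun _ _ => Finset.sum_congr rfl fun _ _ => by ring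
  have h2 : ∑ p, ∑ q, w p q * ∑ a, lower1 C.g x (frameVec C x Θ q) a * frameVec C x Θ p a = 0 := by
    simp only [hC.frameVec_inner hx hΘ]
    have ht : ∑ p, w p p = 0 := hΘ.w_trace
    simp [← Finset.sum_mul, ht]
  rw [h1, h2]
  simp [Coords.FM]

/-- The divergence of `Y`, a quarter of the Laplacian of `(𝓕^±)²`: one term comes from the
derivative of `𝓕^±`, which is curvature by `kostant`, and one from the derivative of `ξ`. -/
theorem divergence_Y_eq_of_frame : divergence C.g (C.Y s) x
    = 2 * C.lam x * ∑ p, ∑ q, w p q ^ 2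
      - 4 * ∑ p, ∑ q, frameCoef C x Θ p * w p q * frameCoef C x Θ q := by
  rw [hC.divergence_Y s hx]
  have h1 : ∑ e, ∑ a, ∑ b, ∑ d, riemUp C.g x a b d e * upSD C.g s x (C.DFM e x) a b * C.ξ x d
      = 2 * C.lam x * ∑ p, ∑ q, w p q ^ 2 := by
    have e1 : ∀ e, ∑ a, ∑ b, ∑ d, riemUp C.g x a b d e * upSD C.g s x (C.DFM e x) a b * C.ξ x d
        = ∑ p, (- ∑ q, w p q * lower1 C.g x (frameVec C x Θ q) e)
          * ∑ a, ∑ b, ∑ d, riemUp C.g x a b d e * Θ p a b * C.ξ x d := by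
      intro e
      rw [hC.upSD_DFM hx hΘ]
      obtain ⟨α, hα⟩ : ∃ α : Fin 3 → ℝ,
          ∀ p, - ∑ q, w p q * lower1 C.g x (frameVec C x Θ q) e = α p :=
        ⟨_, fun _ => rfl⟩
      simp only [hα, Matrix.sum_apply, Matrix.smul_apply, smul_eq_mul, Finset.mul_sum,
        Finset.sum_mul]
      conv_rhs => rw [sum_rotate]
      refine Finset.sum_congr rfl fun _ _ => Finset.sum_congr rfl fun _ _ =>
        Finset.sum_congr rfl fun _ _ => Finset.sum_congr rfl fun _ _ => by ring
    simp only [e1, hC.riemUp_frame hx hΘ]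
    rw [Finset.sum_comm, Finset.mul_sum]
    refine Finset.sum_congr rfl fun p _ => ?_
    have e2 := hC.sum_frameVec_inner hx hΘ (w p) (w p)
    have e3 : ∀ a, lower1 C.g x (fun a => ∑ q, w p q * frameVec C x Θ q a) a
        = ∑ q, w p q * lower1 C.g x (frameVec C x Θ q) a := by
      intro a
      simp only [lower1, Finset.mul_sum]
      rw [Finset.sum_comm]
      exact Finset.sum_congr rfl fun _ _ => Finset.sum_congr rfl fun _ _ => by ring
    simp only [e3] at e2
    calc _ = 2 * ∑ a, (∑ q, w p q * lower1 C.g x (frameVec C x Θ q) a)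
          * ∑ q, w p q * frameVec C x Θ q a := by
          rw [Finset.mul_sum]
          exact Finset.sum_congr rfl fun _ _ => by ring
      _ = _ := by
          rw [e2, Finset.sum_congr rfl fun q _ => (sq (w p q)).symm]; ring
  have h2 : ∑ e, ∑ a, ∑ b, ∑ d, riemUp C.g x a b d e * C.KM s x a b
      * ∑ m, ginv C.g x d m * C.F x e m
      = - 4 * ∑ p, ∑ q, frameCoef C x Θ p * w p q * frameCoef C x Θ q := by
    have e1 : ∀ d e, ∑ a, ∑ b, riemUp C.g x a b d e * C.KM s x a b
        = 2 * ∑ p, ∑ q, frameCoef C x Θ p * w p q * (gM C.g x * Θ q) d e := by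
      intro d e
      have f1 : ∑ a, ∑ b, riemUp C.g x a b d e * C.KM s x a b
          = ∑ p, frameCoef C x Θ p * ∑ m, (∑ a, ∑ b, Θ p a b * riem C.g x a b d m)
            * ginv C.g x m e := by
        rw [hC.KM_eq_sum hx hΘ]
        simp only [hC.metric.riem_raise hx, Matrix.sum_apply, Matrix.smul_apply, smul_eq_mul,
          Finset.mul_sum, Finset.sum_mul]
        conv_rhs => rw [sum_pair_comm]
        refine Finset.sum_congr rfl fun _ _ => Finset.sum_congr rfl fun _ _ =>
          Finset.sum_congr rfl fun _ _ => Finset.sum_congr rfl fun _ _ => by ring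
      have f2 : ∀ q, ∑ m, (gM C.g x * Θ q * gM C.g x) d m * ginv C.g x m e
          = (gM C.g x * Θ q) d e := by
        intro q
        have h : (gM C.g x * Θ q * gM C.g x * (gM C.g x)⁻¹) d e = (gM C.g x * Θ q) d e := by
          rw [mul_assoc _ (gM C.g x), hC.metric.mul_inv hx, mul_one]
        exact h
      rw [f1]
      simp only [hΘ.riem_eq, ← f2, Finset.mul_sum, Finset.sum_mul]
      refine Finset.sum_congr rfl fun p _ => ?_
      rw [Finset.sum_comm]
      exact Finset.sum_congr rfl fun _ _ => Finset.sum_congr rfl fun _ _ => by ring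
    have e2 : ∀ q, ∑ e, ∑ d, (gM C.g x * Θ q) d e * ∑ m, ginv C.g x d m * C.F x e m
        = - 2 * frameCoef C x Θ q := by
      intro q
      have f1 : ∀ m e, ∑ d, ginv C.g x d m * (gM C.g x * Θ q) d e = Θ q m e := by
        intro m e
        have h : ((gM C.g x)⁻¹ * (gM C.g x * Θ q)) m e = Θ q m e := by
          rw [← mul_assoc, hC.metric.inv_mul hx, one_mul]
        rw [← h, Matrix.mul_apply]
        exact Finset.sum_congr rfl fun d _ => by rw [hC.metric.ginv_symm hx]; rfl
      have f2 : - 2 * frameCoef C x Θ q = ∑ e, ∑ m, Θ q m e * C.F x e m := by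
        rw [frameCoef, Finset.sum_comm]
        simp only [← mul_assoc, Finset.mul_sum]
        refine Finset.sum_congr rfl fun a _ => Finset.sum_congr rfl fun b _ => ?_
        have := hC.killing x hx a b
        rw [show C.FM x b a = C.F x b a from rfl, eq_neg_of_add_eq_zero_left this]; ring
      rw [f2]
      refine Finset.sum_congr rfl fun e _ => ?_
      simp only [← f1, Finset.mul_sum, Finset.sum_mul]
      rw [Finset.sum_comm]
      exact Finset.sum_congr rfl fun _ _ => Finset.sum_congr rfl fun _ _ => by ring
    have e3 : ∀ e, ∑ a, ∑ b, ∑ d, riemUp C.g x a b d e * C.KM s x a b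
        * ∑ m, ginv C.g x d m * C.F x e m
        = ∑ d, (∑ a, ∑ b, riemUp C.g x a b d e * C.KM s x a b)
          * ∑ m, ginv C.g x d m * C.F x e m := by
      intro e
      obtain ⟨β, hβ⟩ : ∃ β : Fin 4 → ℝ, ∀ d, ∑ m, ginv C.g x d m * C.F x e m = β d :=
        ⟨_, fun _ => rfl⟩
      simp only [hβ, Finset.sum_mul]
      conv_rhs => rw [Finset.sum_comm]
      exact Finset.sum_congr rfl fun a _ => Finset.sum_comm
    simp only [e3, e1]
    have e4 : - 4 * ∑ p, ∑ q, frameCoef C x Θ p * w p q * frameCoef C x Θ q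
        = 2 * ∑ p, ∑ q, frameCoef C x Θ p * w p q * (- 2 * frameCoef C x Θ q) := by
      simp only [Finset.mul_sum]
      exact Finset.sum_congr rfl fun _ _ => Finset.sum_congr rfl fun _ _ => by ring
    rw [e4]
    simp only [← e2]
    obtain ⟨β, hβ⟩ : ∃ β : Fin 4 → Fin 4 → ℝ, ∀ d e, ∑ m, ginv C.g x d m * C.F x e m = β d e :=
      ⟨_, fun _ _ => rfl⟩
    simp only [hβ, Finset.mul_sum, Finset.sum_mul]
    rw [sum_pair_comm]
    exact Finset.sum_congr rfl fun _ _ => Finset.sum_congr rfl fun _ _ =>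
      Finset.sum_congr rfl fun _ _ => Finset.sum_congr rfl fun _ _ => by ring
  rw [h1, h2]; ring

end IsLocalSolution

end

/-! ### Algebra of the tensors `𝓦`, `𝓘` and `𝓢` -/

section

variable {g : Eucl 4 → Fin 4 → Fin 4 → ℝ} {U : Set (Eucl 4)} {x : Eucl 4} {s : ℤˣ}
  {Θ : Fin 3 → Matrix (Fin 4) (Fin 4) ℝ} {w : Matrix (Fin 3) (Fin 3) ℝ}

/-- The covariant two-form `Θ_ab` of a bivector `Θ^{ab}`. -/
def lowerM (g : Eucl 4 → Fin 4 → Fin 4 → ℝ) (x : Eucl 4) (Θ : Matrix (Fin 4) (Fin 4) ℝ) :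
    Matrix (Fin 4) (Fin 4) ℝ := gM g x * Θ * gM g x

/-- Lowering both indices of `t^{ab} ± ½ ε^{abcd} t_cd` gives `t_ab ± ½ ε_ab^{cd} t_cd`. -/
theorem sd_eq_lower (hg : IsMetricOn g U) (hx : x ∈ U) (s : ℤˣ) (t : Matrix (Fin 4) (Fin 4) ℝ)
    (ht : t.transpose = -t) (a b : Fin 4) :
    t a b + sgn s * (1 / 2) * ∑ c, ∑ d, vol g x a b c d * raise2 g x t c d
      = lowerM g x (upSD g s x t) a b := by
  set u : Matrix (Fin 4) (Fin 4) ℝ := Matrix.of fun a b => t a b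
    + sgn s * (1 / 2) * ∑ c, ∑ d, vol g x a b c d * raise2 g x t c d with hu
  have h : (gM g x)⁻¹ * u * (gM g x)⁻¹ = upSD g s x t := by
    ext a b
    rw [← raise2_sd hg hx s t ht, ← raise2_eq hg hx]; rfl
  rw [lowerM, ← h]
  have h2 : gM g x * ((gM g x)⁻¹ * u * (gM g x)⁻¹) * gM g x
      = (gM g x * (gM g x)⁻¹) * u * ((gM g x)⁻¹ * gM g x) := by simp only [mul_assoc]
  rw [h2, hg.mul_inv hx, hg.inv_mul hx, one_mul, mul_one]
  rfl

theorem raise2_lowerM (hg : IsMetricOn g U) (hx : x ∈ U) (α : Fin 3 → ℝ) (c d : Fin 4) :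
    raise2 g x (fun a b => ∑ p, α p * lowerM g x (Θ p) a b) c d = ∑ p, α p * Θ p c d := by
  have h : (fun a b => ∑ p, α p * lowerM g x (Θ p) a b)
      = (∑ p, α p • lowerM g x (Θ p) : Matrix (Fin 4) (Fin 4) ℝ) := by
    ext a b
    simp [Matrix.sum_apply]
  have h2 : ∀ p, (gM g x)⁻¹ * lowerM g x (Θ p) * (gM g x)⁻¹ = Θ p := by
    intro p
    calc _ = ((gM g x)⁻¹ * gM g x) * Θ p * (gM g x * (gM g x)⁻¹) := by
          simp only [lowerM, mul_assoc]
      _ = _ := by rw [hg.mul_inv hx, hg.inv_mul hx, one_mul, mul_one]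
  rw [h, raise2_eq hg hx]
  simp only [Matrix.mul_sum, Matrix.sum_mul, Matrix.mul_smul, Matrix.smul_mul, h2,
    Matrix.sum_apply, Matrix.smul_apply, smul_eq_mul]

namespace IsSDFrame

variable (hΘ : IsSDFrame g s x Θ w) (hg : IsMetricOn g U) (hx : x ∈ U)
include hΘ hg hx

theorem lowerM_transpose (p : Fin 3) : (lowerM g x (Θ p)).transpose = - lowerM g x (Θ p) := by
  rw [lowerM, Matrix.transpose_mul, Matrix.transpose_mul, hΘ.antisymm, hg.transpose_gM hx]
  simp only [Matrix.mul_neg, Matrix.neg_mul, Matrix.mul_assoc]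

theorem pairing (p q : Fin 3) :
    ∑ a, ∑ b, lowerM g x (Θ p) a b * Θ q a b = if p = q then 4 else 0 := by
  have h1 : ∀ p q, ∑ a, ∑ b, lowerM g x (Θ p) a b * Θ q a b
      = - (gM g x * (Θ p * gM g x * Θ q)).trace := by
    intro p q
    have e : ∑ a, ∑ b, lowerM g x (Θ p) a b * Θ q a b
        = ((lowerM g x (Θ p)).transpose * Θ q).trace := by
      simp only [Matrix.trace, Matrix.diag, Matrix.mul_apply, Matrix.transpose_apply]
      exact Finset.sum_comm
    rw [e, hΘ.lowerM_transpose hg hx, Matrix.neg_mul, Matrix.trace_neg, lowerM]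
    simp only [Matrix.mul_assoc]
  have h2 : (gM g x * (Θ q * gM g x * Θ p)).trace = (gM g x * (Θ p * gM g x * Θ q)).trace := by
    rw [← Matrix.mul_assoc, ← Matrix.mul_assoc, Matrix.mul_assoc (gM g x * Θ q),
      Matrix.trace_mul_comm]
    simp only [Matrix.mul_assoc]
  have h3 := congrArg (fun A => (gM g x * A).trace) (hΘ.clifford p q)
  simp only [mul_add, Matrix.trace_add, h2] at h3
  rw [h1]
  split_ifs at h3 ⊢
  · rw [Matrix.mul_smul, hg.mul_inv hx, Matrix.trace_smul, Matrix.trace_one] at h3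
    simp at h3
    linarith
  · simp at h3
    linarith

theorem pairing_sum (α : Fin 3 → ℝ) (q : Fin 3) :
    ∑ a, ∑ b, (∑ p, α p * lowerM g x (Θ p) a b) * Θ q a b = 4 * α q := by
  have h : ∑ a, ∑ b, (∑ p, α p * lowerM g x (Θ p) a b) * Θ q a b
      = ∑ p, α p * ∑ a, ∑ b, lowerM g x (Θ p) a b * Θ q a b := by
    simp only [Finset.mul_sum, Finset.sum_mul]
    conv_rhs => rw [Finset.sum_comm]
    refine Finset.sum_congr rfl fun a _ => ?_
    rw [Finset.sum_comm]
    exact Finset.sum_congr rfl fun _ _ => Finset.sum_congr rfl fun _ _ => by ring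
  rw [h]
  simp only [hΘ.pairing hg hx]
  simp; ring

theorem pairing_sum' (α β : Fin 3 → ℝ) :
    ∑ a, ∑ b, (∑ p, α p * lowerM g x (Θ p) a b) * ∑ q, β q * Θ q a b = 4 * ∑ p, α p * β p := by
  have h : ∑ a, ∑ b, (∑ p, α p * lowerM g x (Θ p) a b) * ∑ q, β q * Θ q a b
      = ∑ q, β q * ∑ a, ∑ b, (∑ p, α p * lowerM g x (Θ p) a b) * Θ q a b := by
    obtain ⟨t, ht⟩ : ∃ t : Fin 4 → Fin 4 → ℝ, ∀ a b, ∑ p, α p * lowerM g x (Θ p) a b = t a b :=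
      ⟨_, fun _ _ => rfl⟩
    simp only [ht, Finset.mul_sum]
    conv_rhs => rw [Finset.sum_comm]
    refine Finset.sum_congr rfl fun a _ => ?_
    rw [Finset.sum_comm]
    exact Finset.sum_congr rfl fun _ _ => Finset.sum_congr rfl fun _ _ => by ring
  rw [h]
  simp only [hΘ.pairing_sum hg hx, Finset.mul_sum]
  exact Finset.sum_congr rfl fun _ _ => by ring

theorem normSq2_sum (α : Fin 3 → ℝ) :
    normSq2 g x (fun a b => ∑ p, α p * lowerM g x (Θ p) a b) = 4 * ∑ p, α p ^ 2 := by
  simp only [normSq2, raise2_lowerM hg hx, hΘ.pairing_sum' hg hx, sq]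

theorem normSq4_sum (T : Fin 3 → Fin 3 → ℝ) :
    normSq4 g x (fun a b c d => ∑ p, ∑ q, T p q * (lowerM g x (Θ p) a b * lowerM g x (Θ q) c d))
      = 16 * ∑ p, ∑ q, T p q ^ 2 := by
  have e1 : ∀ a b c d, ∑ p, ∑ q, T p q * (lowerM g x (Θ p) a b * lowerM g x (Θ q) c d)
      = ∑ q, (∑ p, T p q * lowerM g x (Θ p) a b) * lowerM g x (Θ q) c d := by
    intro a b c d
    simp only [Finset.sum_mul]
    rw [Finset.sum_comm]
    exact Finset.sum_congr rfl fun _ _ => Finset.sum_congr rfl fun _ _ => by ring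
  have e2 : ∀ a b c d, ∑ q, (∑ p, T p q * lowerM g x (Θ p) a b) * Θ q c d
      = ∑ p, (∑ q, T p q * Θ q c d) * lowerM g x (Θ p) a b := by
    intro a b c d
    simp only [Finset.sum_mul]
    rw [Finset.sum_comm]
    exact Finset.sum_congr rfl fun _ _ => Finset.sum_congr rfl fun _ _ => by ring
  have e3 : ∀ a b c d, ∑ p, (∑ q, T p q * Θ q c d) * Θ p a b
      = ∑ q, (∑ p, T p q * Θ p a b) * Θ q c d := by
    intro a b c d
    simp only [Finset.sum_mul]
    rw [Finset.sum_comm]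
    exact Finset.sum_congr rfl fun _ _ => Finset.sum_congr rfl fun _ _ => by ring
  simp only [normSq4, e1, raise2_lowerM hg hx, e2, e3, hΘ.pairing_sum' hg hx]
  have e4 : ∑ a, ∑ b, 4 * ∑ q, (∑ p, T p q * lowerM g x (Θ p) a b) * ∑ p, T p q * Θ p a b
      = 4 * ∑ q, ∑ a, ∑ b, (∑ p, T p q * lowerM g x (Θ p) a b) * ∑ p, T p q * Θ p a b := by
    simp only [← Finset.mul_sum]
    congr 1
    conv_rhs => rw [Finset.sum_comm]
    exact Finset.sum_congr rfl fun a _ => Finset.sum_comm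
  rw [e4]
  simp only [hΘ.pairing_sum' hg hx, ← Finset.mul_sum]
  rw [Finset.sum_comm, ← mul_assoc]
  norm_num
  exact Finset.sum_congr rfl fun _ _ => Finset.sum_congr rfl fun _ _ => by ring

/-- The identity `𝓘_abcd = ¼ Σ_p Θ_p,ab Θ_p,cd`. -/
theorem identity_eq (a b c d : Fin 4) :
    (1 / 4) * (g x a c * g x b d - g x a d * g x b c + sgn s * vol g x a b c d)
      = (1 / 4) * ∑ p, lowerM g x (Θ p) a b * lowerM g x (Θ p) c d := by
  set t : Matrix (Fin 4) (Fin 4) ℝ := gM g x * elemAnti c d * gM g x with ht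
  have htt : t.transpose = -t := by
    rw [ht]
    exact conj_antisymm (hg.transpose_gM hx) (elemAnti_transpose c d)
  have hte : ∀ a b, t a b = g x a c * g x b d - g x a d * g x b c := by
    intro a b
    rw [hg.symm x hx b d, hg.symm x hx b c]
    simp [ht, Matrix.mul_apply, elemAnti, gM, mul_sub, sub_mul, Finset.sum_sub_distrib]
  have hr : ∀ e f, raise2 g x t e f = elemAnti c d e f := by
    intro e f
    rw [raise2_eq hg hx, ht]
    have h2 : (gM g x)⁻¹ * (gM g x * elemAnti c d * gM g x) * (gM g x)⁻¹
        = ((gM g x)⁻¹ * gM g x) * elemAnti c d * (gM g x * (gM g x)⁻¹) := by simp only [mul_assoc]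
    rw [h2, hg.mul_inv hx, hg.inv_mul hx, one_mul, mul_one]
  have h1 := sd_eq_lower hg hx s t htt a b
  simp only [hr] at h1
  rw [vol_contract _ (elemAnti_transpose c d), ← permSymbol_eq_dualM] at h1
  have hv : vol g x a b c d = Real.sqrt (gM g x).det * permSymbol a b c d := rfl
  have hθ : ∀ p, ∑ a, ∑ b, Θ p a b * t a b = 2 * lowerM g x (Θ p) c d := by
    intro p
    have e : ∀ c d, lowerM g x (Θ p) c d = ∑ a, ∑ b, Θ p a b * (g x a c * g x b d) := by
      intro c d
      simp only [lowerM, Matrix.mul_apply, Finset.sum_mul, gM, Matrix.of_apply]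
      rw [Finset.sum_comm]
      refine Finset.sum_congr rfl fun a _ => Finset.sum_congr rfl fun b _ => ?_
      rw [hg.symm x hx a c]; ring
    have e' : lowerM g x (Θ p) d c = - lowerM g x (Θ p) c d :=
      congrFun₂ (hΘ.lowerM_transpose hg hx p) c d
    have : ∑ a, ∑ b, Θ p a b * t a b = lowerM g x (Θ p) c d - lowerM g x (Θ p) d c := by
      simp only [hte, e, mul_sub, Finset.sum_sub_distrib]
    rw [this, e']; ring
  rw [hΘ.upSD_eq t htt, lowerM] at h1
  simp only [hθ, Matrix.mul_sum, Matrix.sum_mul, Matrix.mul_smul, Matrix.smul_mul,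
    Matrix.sum_apply, Matrix.smul_apply, smul_eq_mul] at h1
  rw [hte] at h1
  rw [hv]
  have h2 : ∑ p, 1 / 2 * (2 * lowerM g x (Θ p) c d) * (gM g x * Θ p * gM g x) a b
      = ∑ p, lowerM g x (Θ p) a b * lowerM g x (Θ p) c d :=
    Finset.sum_congr rfl fun p _ => by
      rw [show gM g x * Θ p * gM g x = lowerM g x (Θ p) from rfl]; ring
  rw [h2] at h1
  rw [← h1]; ring

/-- Combinations of the frame two-forms are (anti-)self-dual. -/
theorem isSelfDual_sum (α : Fin 3 → ℝ) (a b : Fin 4) :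
    ∑ p, α p * lowerM g x (Θ p) a b = sgn s * (1 / 2) * ∑ c, ∑ d, vol g x a b c d
      * raise2 g x (fun a b => ∑ p, α p * lowerM g x (Θ p) a b) c d := by
  set t : Matrix (Fin 4) (Fin 4) ℝ := Matrix.of fun a b => ∑ p, α p * lowerM g x (Θ p) a b with ht
  have htt : t.transpose = -t := by
    ext a b
    simp only [ht, Matrix.transpose_apply, Matrix.of_apply, Matrix.neg_apply,
      ← Finset.sum_neg_distrib]
    refine Finset.sum_congr rfl fun p _ => ?_
    rw [show lowerM g x (Θ p) b a = - lowerM g x (Θ p) a b from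
      congrFun₂ (hΘ.lowerM_transpose hg hx p) a b, mul_neg]
  have h1 := sd_eq_lower hg hx s t htt a b
  rw [hΘ.upSD_eq t htt, lowerM] at h1
  have h2 : ∀ p, ∑ a, ∑ b, Θ p a b * t a b = 4 * α p := by
    intro p
    rw [← hΘ.pairing_sum hg hx α p]
    exact Finset.sum_congr rfl fun _ _ => Finset.sum_congr rfl fun _ _ => mul_comm _ _
  simp only [h2, Matrix.mul_sum, Matrix.sum_mul, Matrix.mul_smul, Matrix.smul_mul,
    Matrix.sum_apply, Matrix.smul_apply, smul_eq_mul] at h1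
  have h3 : ∑ p, 1 / 2 * (4 * α p) * (gM g x * Θ p * gM g x) a b = 2 * t a b := by
    simp only [ht, Matrix.of_apply, Finset.mul_sum]
    exact Finset.sum_congr rfl fun p _ => by
      rw [show gM g x * Θ p * gM g x = lowerM g x (Θ p) from rfl]; ring
  rw [h3] at h1
  change t a b = sgn s * (1 / 2) * ∑ c, ∑ d, vol g x a b c d * raise2 g x t c d
  linarith

end IsSDFrame

end

/-! ### Linear algebra in three dimensions -/

/-- The largest eigenvalue of a symmetric trace-free `3 × 3` matrix is at most `√(2/3)` times its
Frobenius norm. With `v = T f`, this is the Cauchy–Schwarz inequality for `T` and the trace-free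
symmetric part of `v ⊗ f`, whose pairing with `T` is `|v|²`. -/
theorem traceFree_mulVec_le (T : Fin 3 → Fin 3 → ℝ) (hT : ∀ p q, T q p = T p q)
    (htr : ∑ p, T p p = 0) (f : Fin 3 → ℝ) :
    3 * ∑ p, (∑ q, T p q * f q) ^ 2 ≤ 2 * ((∑ p, f p ^ 2) * ∑ p, ∑ q, T p q ^ 2) := by
  obtain ⟨v, hv⟩ : ∃ v : Fin 3 → ℝ, ∀ p, ∑ q, T p q * f q = v p := ⟨_, fun _ => rfl⟩
  simp only [hv]
  set V := ∑ p, v p ^ 2 with hV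
  set N := ∑ p, f p ^ 2 with hN
  set c := ∑ p, v p * f p with hc
  -- the trace-free symmetric part of `v ⊗ f`
  set A : Fin 3 × Fin 3 → ℝ := fun i =>
    (1 / 2) * (v i.1 * f i.2 + f i.1 * v i.2) - (if i.1 = i.2 then c / 3 else 0) with hA
  have h1 : ∑ i : Fin 3 × Fin 3, T i.1 i.2 * A i = V := by
    have e1 : ∑ p, ∑ q, T p q * (v p * f q) = V := by
      rw [hV]
      refine Finset.sum_congr rfl fun p _ => ?_
      rw [sq]
      nth_rewrite 2 [← hv p]
      rw [Finset.sum_mul]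
      exact Finset.sum_congr rfl fun q _ => by ring
    have e2 : ∑ p, ∑ q, T p q * (f p * v q) = V := by
      rw [← e1, Finset.sum_comm]
      exact Finset.sum_congr rfl fun p _ => Finset.sum_congr rfl fun q _ => by rw [hT]; ring
    have e3 : ∑ p, ∑ q, T p q * (if p = q then c / 3 else 0) = 0 := by
      simp [← Finset.sum_mul, htr]
    rw [Fintype.sum_prod_type]
    simp only [hA, mul_sub, Finset.sum_sub_distrib, e3, sub_zero]
    have : ∑ p, ∑ q, T p q * (1 / 2 * (v p * f q + f p * v q))
        = (1 / 2) * (∑ p, ∑ q, T p q * (v p * f q) + ∑ p, ∑ q, T p q * (f p * v q)) := by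
      simp only [Finset.mul_sum, ← Finset.sum_add_distrib]
      exact Finset.sum_congr rfl fun p _ => Finset.sum_congr rfl fun q _ => by ring
    rw [this, e1, e2]; ring
  have h2 : ∑ i, A i ^ 2 = (1 / 2) * (V * N) + c ^ 2 / 6 := by
    rw [Fintype.sum_prod_type]
    simp [hA, hV, hN, hc, Fin.sum_univ_three]
    ring
  have h3 : c ^ 2 ≤ V * N := Finset.sum_mul_sq_le_sq_mul_sq _ _ _
  have h4 := Finset.sum_mul_sq_le_sq_mul_sq Finset.univ (fun i : Fin 3 × Fin 3 => T i.1 i.2) A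
  rw [h1, h2, Fintype.sum_prod_type] at h4
  simp only at h4
  set Q := ∑ p, ∑ q, T p q ^ 2 with hQ
  have hQ0 : 0 ≤ Q := Finset.sum_nonneg fun _ _ => Finset.sum_nonneg fun _ _ => sq_nonneg _
  have hV0 : 0 ≤ V := Finset.sum_nonneg fun _ _ => sq_nonneg _
  have hN0 : 0 ≤ N := Finset.sum_nonneg fun _ _ => sq_nonneg _
  rcases hV0.eq_or_lt with h | h
  · rw [← h]
    have := mul_nonneg hN0 hQ0
    linarith
  · have h5 : V * V ≤ V * (2 / 3 * (N * Q)) := by nlinarith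
    have h6 := le_of_mul_le_mul_left h5 h
    linarith

/-- Two independent vectors orthogonal to a nonzero vector of `ℝ³`. -/
theorem exists_orthogonal_pair (f : Fin 3 → ℝ) (hf : f ≠ 0) : ∃ α β : Fin 3 → ℝ,
    ∑ p, f p * α p = 0 ∧ ∑ p, f p * β p = 0 ∧
      ∀ a b : ℝ, (∀ p, a * α p + b * β p = 0) → a = 0 ∧ b = 0 := by
  have h : f 0 ≠ 0 ∨ f 1 ≠ 0 ∨ f 2 ≠ 0 := by
    by_contra! h
    exact hf (funext fun p => by fin_cases p <;> simp [h])
  rcases h with h | h | h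
  · refine ⟨![-f 1, f 0, 0], ![-f 2, 0, f 0], ?_, ?_, fun a b hab => ⟨?_, ?_⟩⟩
    · simp [Fin.sum_univ_three]; ring
    · simp [Fin.sum_univ_three]; ring
    · simpa [h] using hab 1
    · simpa [h] using hab 2
  · refine ⟨![f 1, -f 0, 0], ![0, -f 2, f 1], ?_, ?_, fun a b hab => ⟨?_, ?_⟩⟩
    · simp [Fin.sum_univ_three]; ring
    · simp [Fin.sum_univ_three]; ring
    · simpa [h] using hab 0
    · simpa [h] using hab 2
  · refine ⟨![f 2, 0, -f 0], ![0, f 2, -f 1], ?_, ?_, fun a b hab => ⟨?_, ?_⟩⟩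
    · simp [Fin.sum_univ_three]; ring
    · simp [Fin.sum_univ_three]; ring
    · simpa [h] using hab 0
    · simpa [h] using hab 1

/-! ### The tensor `𝓢` of a Killing field -/

namespace IsLocalSolution

variable {C : Coords} {U : Set (Eucl 4)} {x : Eucl 4} {s : ℤˣ}
  {Θ : Fin 3 → Matrix (Fin 4) (Fin 4) ℝ} {w : Matrix (Fin 3) (Fin 3) ℝ}
  (hC : IsLocalSolution C U) (hx : x ∈ U) (hΘ : IsSDFrame C.g s x Θ w)

/-- The matrix of `𝓢^±` in the frame `Θ`. -/
def sMatrix (C : Coords) (s : ℤˣ) (x : Eucl 4) (Θ : Fin 3 → Matrix (Fin 4) (Fin 4) ℝ)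
    (w : Matrix (Fin 3) (Fin 3) ℝ) (p q : Fin 3) : ℝ :=
  w p q - 6 / (1 - C.E s x) * (frameCoef C x Θ p * frameCoef C x Θ q
    - if p = q then (1 / 3) * ∑ r, frameCoef C x Θ r ^ 2 else 0)

include hC hx

theorem weyl_eq_riem (a b c d : Fin 4) : weyl C.g x a b c d = riem C.g x a b c d := by
  simp [weyl, scal, hC.ricciFlat x hx]

include hΘ

theorem SF_eq_sum (a b : Fin 4) :
    C.SF s x a b = ∑ p, frameCoef C x Θ p * lowerM C.g x (Θ p) a b := by
  have h := sd_eq_lower hC.metric hx s (C.FM x) (hC.FM_transpose hx) a b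
  have h2 : C.SF s x a b = lowerM C.g x (C.KM s x) a b := h
  rw [h2, hC.KM_eq_sum hx hΘ, lowerM]
  simp only [Matrix.mul_sum, Matrix.sum_mul, Matrix.mul_smul, Matrix.smul_mul, Matrix.sum_apply,
    Matrix.smul_apply, smul_eq_mul]
  rfl

theorem SW_eq_sum (a b c d : Fin 4) : C.SW s x a b c d
    = ∑ p, ∑ q, w p q * (lowerM C.g x (Θ p) a b * lowerM C.g x (Θ q) c d) := by
  set t : Matrix (Fin 4) (Fin 4) ℝ := Matrix.of fun c d => riem C.g x a b c d with ht
  have htt : t.transpose = -t := by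
    ext c d
    exact hC.metric.riem_antisymm_right hx a b d c
  have h := sd_eq_lower hC.metric hx s t htt c d
  have hw : weyl C.g x a b = t := funext₂ fun c d => hC.weyl_eq_riem hx a b c d
  have h2 : C.SW s x a b c d = lowerM C.g x (upSD C.g s x t) c d := by
    rw [← h, Coords.SW, hw]
  have h3 : ∀ q, ∑ e, ∑ f, Θ q e f * t e f = 2 * ∑ p, w p q * lowerM C.g x (Θ p) a b := by
    intro q
    have e : ∀ p, w p q = w q p := fun p => congrFun₂ hΘ.w_symm q p
    simp only [e]
    rw [show ∑ p, w q p * lowerM C.g x (Θ p) a b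
      = ∑ p, w q p * (gM C.g x * Θ p * gM C.g x) a b from rfl, ← hΘ.riem_eq]
    exact Finset.sum_congr rfl fun e _ => Finset.sum_congr rfl fun f _ => by
      rw [← hC.metric.riem_pair hx a b e f]; rfl
  rw [h2, hΘ.upSD_eq t htt, lowerM]
  simp only [h3, Matrix.mul_smul, Matrix.smul_mul,
    Matrix.sum_apply, Matrix.smul_apply, smul_eq_mul, Finset.mul_sum, Finset.sum_mul]
  rw [Finset.sum_comm]
  refine Finset.sum_congr rfl fun p _ => Finset.sum_congr rfl fun q _ => ?_
  rw [show gM C.g x * Θ q * gM C.g x = lowerM C.g x (Θ q) from rfl]; ring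

theorem S_eq_sum (a b c d : Fin 4) : C.S s x a b c d
    = ∑ p, ∑ q, sMatrix C s x Θ w p q * (lowerM C.g x (Θ p) a b * lowerM C.g x (Θ q) c d) := by
  have h1 : C.SF s x a b * C.SF s x c d = ∑ p, ∑ q, frameCoef C x Θ p * frameCoef C x Θ q
      * (lowerM C.g x (Θ p) a b * lowerM C.g x (Θ q) c d) := by
    rw [hC.SF_eq_sum hx hΘ, hC.SF_eq_sum hx hΘ, Finset.sum_mul_sum]
    exact Finset.sum_congr rfl fun p _ => Finset.sum_congr rfl fun q _ => by ring
  have h2 : (1 / 3) * C.SFsq s x * C.II s x a b c d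
      = ∑ p, ∑ q, (if p = q then (1 / 3) * ∑ r, frameCoef C x Θ r ^ 2 else 0)
      * (lowerM C.g x (Θ p) a b * lowerM C.g x (Θ q) c d) := by
    rw [Coords.II, hΘ.identity_eq hC.metric hx, hC.SFsq_eq_sum hx hΘ]
    simp only [ite_mul, zero_mul, Finset.sum_ite_eq, Finset.mem_univ, if_true, ← Finset.mul_sum]
    ring
  have h3 : ∑ p, ∑ q, sMatrix C s x Θ w p q * (lowerM C.g x (Θ p) a b * lowerM C.g x (Θ q) c d)
      = ∑ p, ∑ q, w p q * (lowerM C.g x (Θ p) a b * lowerM C.g x (Θ q) c d)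
        - 6 / (1 - C.E s x) * (∑ p, ∑ q, frameCoef C x Θ p * frameCoef C x Θ q
          * (lowerM C.g x (Θ p) a b * lowerM C.g x (Θ q) c d)
          - ∑ p, ∑ q, (if p = q then (1 / 3) * ∑ r, frameCoef C x Θ r ^ 2 else 0)
          * (lowerM C.g x (Θ p) a b * lowerM C.g x (Θ q) c d)) := by
    simp only [Finset.mul_sum (a := 6 / (1 - C.E s x)), ← Finset.sum_sub_distrib]
    exact Finset.sum_congr rfl fun p _ => Finset.sum_congr rfl fun q _ => by
      rw [sMatrix]; ring
  rw [h3, ← h1, ← h2, ← hC.SW_eq_sum hx hΘ, Coords.S]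
  ring

theorem Ssq_eq_sum : C.Ssq s x = 16 * ∑ p, ∑ q, sMatrix C s x Θ w p q ^ 2 := by
  rw [← hΘ.normSq4_sum hC.metric hx, Coords.Ssq]
  congr 1
  funext a b c d
  exact hC.S_eq_sum hx hΘ a b c d

theorem FSsq_eq_sum : C.FSsq s x
    = 64 * ∑ p, (∑ q, sMatrix C s x Θ w p q * frameCoef C x Θ q) ^ 2 := by
  have h1 : ∀ e f, ∑ a, ∑ b, C.S s x e f a b * raise2 C.g x (C.SF s x) a b
      = ∑ p, (4 * ∑ q, sMatrix C s x Θ w p q * frameCoef C x Θ q) * lowerM C.g x (Θ p) e f := by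
    intro e f
    have hr : ∀ a b, raise2 C.g x (C.SF s x) a b = ∑ r, frameCoef C x Θ r * Θ r a b := by
      intro a b
      rw [← raise2_lowerM hC.metric hx]
      congr 1
      exact funext₂ fun a b => hC.SF_eq_sum hx hΘ a b
    have e1 : ∀ a b, C.S s x e f a b
        = ∑ q, (∑ p, sMatrix C s x Θ w p q * lowerM C.g x (Θ p) e f) * lowerM C.g x (Θ q) a b := by
      intro a b
      rw [hC.S_eq_sum hx hΘ]
      simp only [Finset.sum_mul]
      rw [Finset.sum_comm]
      exact Finset.sum_congr rfl fun _ _ => Finset.sum_congr rfl fun _ _ => by ring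
    simp only [e1, hr, hΘ.pairing_sum' hC.metric hx]
    simp only [Finset.sum_mul, Finset.mul_sum]
    rw [Finset.sum_comm]
    exact Finset.sum_congr rfl fun _ _ => Finset.sum_congr rfl fun _ _ => by ring
  rw [Coords.FSsq]
  simp only [h1]
  rw [hΘ.normSq2_sum hC.metric hx]
  simp only [Finset.mul_sum]
  refine Finset.sum_congr rfl fun p _ => ?_
  rw [← Finset.mul_sum]; ring

omit hC hx in
theorem sMatrix_symm (p q : Fin 3) : sMatrix C s x Θ w q p = sMatrix C s x Θ w p q := by
  have e : w q p = w p q := congrFun₂ hΘ.w_symm p q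
  simp only [sMatrix, e, eq_comm (a := q), mul_comm (frameCoef C x Θ q)]

omit hC hx in
theorem sMatrix_trace : ∑ p, sMatrix C s x Θ w p p = 0 := by
  have ht : w 0 0 + w 1 1 + w 2 2 = 0 := by
    have := hΘ.w_trace
    rwa [Matrix.trace, Fin.sum_univ_three] at this
  simp only [sMatrix, Fin.sum_univ_three, if_true]
  linear_combination ht

/-- `(𝓕^± 𝓢^±)² ≤ ⅔ (𝓕^±)² (𝓢^±)²`. -/
theorem FSsq_le_of_frame : 3 * C.FSsq s x ≤ 2 * (C.SFsq s x * C.Ssq s x) := by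
  rw [hC.FSsq_eq_sum hx hΘ, hC.Ssq_eq_sum hx hΘ, hC.SFsq_eq_sum hx hΘ]
  have h := traceFree_mulVec_le (sMatrix C s x Θ w) (sMatrix_symm hΘ)
    (sMatrix_trace hΘ) (frameCoef C x Θ)
  linarith

/-- Equality `(𝓕^±)² (𝓢^±)² = (𝓕^± 𝓢^±)²` contradicts the factor `⅔` in `FSsq_le_of_frame` unless
`𝓢^± = 0`. Then `𝓦^±` is a multiple of the trace-free part of `𝓕^± ⊗ 𝓕^±`, which acts by a scalar
on the plane of self-dual two-forms orthogonal to `𝓕^±`. -/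
theorem isAlgSpecial_of_frame (hP : C.SFsq s x ≠ 0) (hS : C.SFsq s x * C.Ssq s x = C.FSsq s x) :
    C.IsAlgSpecial s x := by
  have hP' := hC.SFsq_eq_sum hx hΘ
  have hS' := hC.Ssq_eq_sum hx hΘ
  have hle := hC.FSsq_le_of_frame hx hΘ
  have hF0 : 0 ≤ C.SFsq s x := by
    rw [hP']; exact mul_nonneg (by norm_num) (Finset.sum_nonneg fun _ _ => sq_nonneg _)
  have hFpos : 0 < C.SFsq s x := lt_of_le_of_ne hF0 hP.symm
  have hS0 : 0 ≤ C.Ssq s x := by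
    rw [hS']
    exact mul_nonneg (by norm_num)
      (Finset.sum_nonneg fun _ _ => Finset.sum_nonneg fun _ _ => sq_nonneg _)
  have hSz : C.Ssq s x = 0 := by
    have h1 : C.SFsq s x * C.Ssq s x ≤ 0 := by rw [← hS] at hle; linarith
    nlinarith
  have hz : ∀ p q, sMatrix C s x Θ w p q = 0 := by
    rw [hSz] at hS'
    have h1 : ∑ p, ∑ q, sMatrix C s x Θ w p q ^ 2 = 0 := by linarith
    intro p q
    have h2 := (Finset.sum_eq_zero_iff_of_nonneg fun p _ =>
      Finset.sum_nonneg fun q _ => sq_nonneg _).1 h1 p (Finset.mem_univ p)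
    have h3 := (Finset.sum_eq_zero_iff_of_nonneg fun q _ => sq_nonneg _).1 h2 q (Finset.mem_univ q)
    exact pow_eq_zero_iff (two_ne_zero) |>.1 h3
  have hf : frameCoef C x Θ ≠ 0 := by
    intro h
    rw [hP', h] at hP
    simp at hP
  obtain ⟨α, β, hα, hβ, hind⟩ := exists_orthogonal_pair _ hf
  have hanti : ∀ (γ : Fin 3 → ℝ) (a b : Fin 4), ∑ p, γ p * lowerM C.g x (Θ p) a b
      = - ∑ p, γ p * lowerM C.g x (Θ p) b a := by
    intro γ a b
    rw [← Finset.sum_neg_distrib]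
    refine Finset.sum_congr rfl fun p _ => ?_
    rw [show lowerM C.g x (Θ p) a b = - lowerM C.g x (Θ p) b a from
      congrFun₂ (hΘ.lowerM_transpose hC.metric hx p) b a, mul_neg]
  -- `𝓦` acts on the orthogonal complement of `𝓕` by a scalar
  have heig : ∀ γ : Fin 3 → ℝ, ∑ p, frameCoef C x Θ p * γ p = 0 → ∀ a b,
      ∑ c, ∑ d, C.SW s x a b c d
        * raise2 C.g x (fun a b => ∑ p, γ p * lowerM C.g x (Θ p) a b) c d
      = (- 8 / (1 - C.E s x) * ∑ r, frameCoef C x Θ r ^ 2)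
        * ∑ p, γ p * lowerM C.g x (Θ p) a b := by
    intro γ hγ a b
    have e1 : ∀ c d, C.SW s x a b c d
        = ∑ q, (∑ p, w p q * lowerM C.g x (Θ p) a b) * lowerM C.g x (Θ q) c d := by
      intro c d
      rw [hC.SW_eq_sum hx hΘ]
      simp only [Finset.sum_mul]
      rw [Finset.sum_comm]
      exact Finset.sum_congr rfl fun _ _ => Finset.sum_congr rfl fun _ _ => by ring
    simp only [e1, raise2_lowerM hC.metric hx, hΘ.pairing_sum' hC.metric hx]
    have hw : ∀ p q, w p q = 6 / (1 - C.E s x) * (frameCoef C x Θ p * frameCoef C x Θ q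
        - if p = q then (1 / 3) * ∑ r, frameCoef C x Θ r ^ 2 else 0) := by
      intro p q
      have := hz p q
      rw [sMatrix] at this
      linarith
    have e2 : ∀ p, ∑ q, w p q * γ q
        = - 2 / (1 - C.E s x) * (∑ r, frameCoef C x Θ r ^ 2) * γ p := by
      intro p
      obtain ⟨N, hN⟩ : ∃ N, ∑ r, frameCoef C x Θ r ^ 2 = N := ⟨_, rfl⟩
      have : ∑ q, w p q * γ q = 6 / (1 - C.E s x) * (frameCoef C x Θ p
          * ∑ q, frameCoef C x Θ q * γ q)
            - ∑ q, (if p = q then 2 / (1 - C.E s x) * N * γ q else 0) := by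
        simp only [hw, hN, Finset.mul_sum, ← Finset.sum_sub_distrib]
        refine Finset.sum_congr rfl fun q _ => ?_
        split_ifs <;> ring
      rw [this, hγ, hN]
      simp; ring
    have e3 : ∑ q, (∑ p, w p q * lowerM C.g x (Θ p) a b) * γ q
        = ∑ p, (∑ q, w p q * γ q) * lowerM C.g x (Θ p) a b := by
      simp only [Finset.sum_mul]
      rw [Finset.sum_comm]
      exact Finset.sum_congr rfl fun _ _ => Finset.sum_congr rfl fun _ _ => by ring
    rw [e3]
    simp only [e2, mul_assoc, ← Finset.mul_sum]
    ring
  refine ⟨- 8 / (1 - C.E s x) * ∑ r, frameCoef C x Θ r ^ 2,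
    fun a b => ∑ p, α p * lowerM C.g x (Θ p) a b, fun a b => ∑ p, β p * lowerM C.g x (Θ p) a b,
    ?_, ⟨hanti α, hΘ.isSelfDual_sum hC.metric hx α⟩, ⟨hanti β, hΘ.isSelfDual_sum hC.metric hx β⟩,
    heig α hα, heig β hβ⟩
  rw [LinearIndependent.pair_iff]
  intro a b hab
  refine hind a b fun p => ?_
  have h1 := hΘ.pairing_sum hC.metric hx (fun p => a * α p + b * β p) p
  have h2 : ∀ c d, ∑ q, (a * α q + b * β q) * lowerM C.g x (Θ q) c d = 0 := by
    intro c d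
    have h3 := congrFun₂ hab c d
    simp only [Pi.add_apply, Pi.smul_apply, smul_eq_mul, Pi.zero_apply] at h3
    rw [← h3, Finset.mul_sum, Finset.mul_sum, ← Finset.sum_add_distrib]
    exact Finset.sum_congr rfl fun _ _ => by ring
  simp only [h2, zero_mul, Finset.sum_const_zero] at h1
  linarith

end IsLocalSolution

/-! ### The divergence identity -/

section

variable {n : ℕ} {f h : Eucl n → ℝ} {x : Eucl n}

/-- `f` is differentiable at `x` with `∂_i f = d`. -/
def HasPd (i : Fin n) (f : Eucl n → ℝ) (d : ℝ) (x : Eucl n) : Prop :=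
  DifferentiableAt ℝ f x ∧ pd i f x = d

theorem HasPd.mul {i : Fin n} {d d' : ℝ} (hf : HasPd i f d x) (hh : HasPd i h d' x) :
    HasPd i (fun y => f y * h y) (d * h x + f x * d') x :=
  ⟨hf.1.mul hh.1, by rw [pd_mul i hf.1 hh.1, hf.2, hh.2]⟩

theorem HasPd.add {i : Fin n} {d d' : ℝ} (hf : HasPd i f d x) (hh : HasPd i h d' x) :
    HasPd i (fun y => f y + h y) (d + d') x :=
  ⟨hf.1.add hh.1, by rw [pd_add i hf.1 hh.1, hf.2, hh.2]⟩

theorem HasPd.const_mul {i : Fin n} {d : ℝ} (c : ℝ) (hf : HasPd i f d x) :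
    HasPd i (fun y => c * f y) (c * d) x :=
  ⟨hf.1.const_mul c, by rw [pd_const_mul i c hf.1, hf.2]⟩

theorem HasPd.const_add {i : Fin n} {d : ℝ} (c : ℝ) (hf : HasPd i f d x) :
    HasPd i (fun y => c + f y) d x :=
  ⟨hf.1.const_add c, by rw [pd_add i (differentiableAt_const c) hf.1, pd_const, hf.2, zero_add]⟩

theorem HasPd.inv {i : Fin n} {d : ℝ} (hf : HasPd i f d x) (h0 : f x ≠ 0) :
    HasPd i (fun y => (f y)⁻¹) (-((f x)⁻¹ * (f x)⁻¹ * d)) x :=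
  ⟨hf.1.inv h0, by rw [pd_comp (φ := fun t => t⁻¹) i (hasDerivAt_inv h0) hf.1, hf.2]; field_simp⟩

variable {g : Eucl n → Fin n → Fin n → ℝ} {X Z : Eucl n → Fin n → ℝ}

theorem divergence_congr (h : ∀ᶠ y in 𝓝 x, ∀ a, X y a = Z y a) :
    divergence g X x = divergence g Z x := by
  simp only [divergence]
  refine Finset.sum_congr rfl fun a _ => ?_
  rw [pd_congr a (h.mono fun y hy => hy a)]
  congr 1
  exact Finset.sum_congr rfl fun b _ => by rw [h.self_of_nhds b]

theorem divergence_mul (hf : DifferentiableAt ℝ f x)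
    (hX : ∀ a, DifferentiableAt ℝ (fun y => X y a) x) :
    divergence g (fun y a => f y * X y a) x
      = f x * divergence g X x + ∑ a, pd a f x * X x a := by
  simp only [divergence]
  rw [Finset.mul_sum, ← Finset.sum_add_distrib]
  refine Finset.sum_congr rfl fun a _ => ?_
  rw [pd_mul a hf (hX a), mul_add, Finset.mul_sum]
  rw [show ∑ b, f x * (chr g x a a b * X x b) = ∑ b, chr g x a a b * (f x * X x b) from
    Finset.sum_congr rfl fun _ _ => by ring]
  ring

theorem divergence_add (hX : ∀ a, DifferentiableAt ℝ (fun y => X y a) x)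
    (hZ : ∀ a, DifferentiableAt ℝ (fun y => Z y a) x) :
    divergence g (fun y a => X y a + Z y a) x = divergence g X x + divergence g Z x := by
  simp only [divergence]
  rw [← Finset.sum_add_distrib]
  refine Finset.sum_congr rfl fun a _ => ?_
  rw [pd_add a (hX a) (hZ a)]
  simp only [mul_add, Finset.sum_add_distrib]
  ring

/-- The square root in the definition of `|s^±|` is absorbed into the exponent. -/
theorem hasDerivAt_sqrt_rpow {t : ℝ} (ht : 0 < t) (β : ℝ) :
    HasDerivAt (fun t => Real.sqrt t ^ β) (β / 2 * Real.sqrt t ^ β / t) t := by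
  have h := (Real.hasDerivAt_sqrt ht.ne').rpow_const (p := β) (Or.inl (Real.sqrt_pos.2 ht).ne')
  convert h using 1
  rw [Real.rpow_sub_one (Real.sqrt_pos.2 ht).ne']
  have h2 := Real.mul_self_sqrt ht.le
  have h3 := (Real.sqrt_pos.2 ht).ne'
  nth_rewrite 2 [← h2]
  field_simp

theorem lower1_raise1 {U : Set (Eucl n)} (hg : IsMetricOn g U) (hx : x ∈ U) (v : Fin n → ℝ)
    (a : Fin n) : lower1 g x (raise1 g x v) a = v a := by
  have h : (gM g x).mulVec ((gM g x)⁻¹.mulVec v) = v := by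
    rw [Matrix.mulVec_mulVec, hg.mul_inv hx, Matrix.one_mulVec]
  exact congrFun h a

end

namespace Coords

variable {C : Coords}

theorem lam_eq_half (s : ℤˣ) (x : Eucl 4) : C.lam x = (1 / 2) * (C.E s x + C.E (-s) x) := by
  simp only [E, sgn_neg]; ring

/-- `J^±` in terms of `σ^±` and `σ^∓`, the Ernst potentials entering as perfect squares. -/
theorem J_eq (s : ℤˣ) (x : Eucl 4) (a : Fin 4) : C.J s x a
    = ((1 - C.E s x) ^ 2 * C.sigmaUp (-s) x a - (1 + C.E (-s) x) ^ 2 * C.sigmaUp s x a)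
      * ((C.lam x)⁻¹ * (C.lam x)⁻¹) / 2 := by
  rcases Int.units_eq_one_or s with rfl | rfl
  · simp only [J, JT, JD, JE, sgn, Units.val_one, Int.cast_one]
    field_simp; ring
  · simp only [J, JT, JD, JE, sgn, neg_neg, Units.val_neg, Units.val_one, Int.cast_neg,
      Int.cast_one]
    field_simp; ring

end Coords

namespace IsLocalSolution

variable {C : Coords} {U : Set (Eucl 4)} {x : Eucl 4} (hC : IsLocalSolution C U)
include hC

theorem exists_frame (hx : x ∈ U) (s : ℤˣ) : ∃ Θ w, IsSDFrame C.g s x Θ w :=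
  hC.metric.exists_sdFrame hx (hC.ricciFlat x hx) s

theorem divergence_sigmaUp_eq (s : ℤˣ) (hx : x ∈ U) :
    divergence C.g (C.sigmaUp s) x = C.SFsq s x := by
  obtain ⟨Θ, w, hΘ⟩ := hC.exists_frame hx s
  exact hC.divergence_sigmaUp_eq_of_frame hx hΘ

theorem SFsq_nonneg (s : ℤˣ) (hx : x ∈ U) : 0 ≤ C.SFsq s x := by
  obtain ⟨Θ, w, hΘ⟩ := hC.exists_frame hx s
  rw [hC.SFsq_eq_sum hx hΘ]
  exact mul_nonneg (by norm_num) (Finset.sum_nonneg fun _ _ => sq_nonneg _)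

theorem sigma_eq_lower (s : ℤˣ) (hx : x ∈ U) (a : Fin 4) :
    C.sigma s x a = lower1 C.g x (C.sigmaUp s x) a :=
  (lower1_raise1 hC.metric hx _ a).symm

theorem pd_SFsq_eq_lower (s : ℤˣ) (hx : x ∈ U) (a : Fin 4) :
    pd a (C.SFsq s) x = 4 * lower1 C.g x (C.Y s x) a := by
  rw [← lower1_raise1 hC.metric hx (fun c => pd c (C.SFsq s) x) a]
  have : raise1 C.g x (fun c => pd c (C.SFsq s) x) = fun e => 4 * C.Y s x e :=
    funext fun e => hC.grad_SFsq s hx e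
  rw [this]
  simp only [lower1, Finset.mul_sum]
  exact Finset.sum_congr rfl fun b _ => by ring

theorem hasPd_E (s : ℤˣ) (hx : x ∈ U) (a : Fin 4) : HasPd a (C.E s) (C.sigma s x a) x :=
  ⟨diffAt_of_smooth (hC.smooth_E s hx), hC.pd_E s hx a⟩

theorem hasPd_lam (s : ℤˣ) (hx : x ∈ U) (a : Fin 4) :
    HasPd a C.lam ((1 / 2) * (C.sigma s x a + C.sigma (-s) x a)) x := by
  have h : C.lam = fun y => (1 / 2) * (C.E s y + C.E (-s) y) := funext (C.lam_eq_half s)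
  rw [h]
  exact ((hC.hasPd_E s hx a).add (hC.hasPd_E (-s) hx a)).const_mul _

theorem hasPd_sAbs_rpow (s : ℤˣ) (β : ℝ) (hx : x ∈ U) (hP : C.SFsq s x ≠ 0) (hE : C.E s x ≠ 1)
    (a : Fin 4) : HasPd a (fun y => C.sAbs s y ^ β) (β * C.sAbs s x ^ β
      * (2 * (C.SFsq s x)⁻¹ * lower1 C.g x (C.Y s x) a
        + 2 * (1 - C.E s x)⁻¹ * C.sigma s x a)) x := by
  have hP0 : 0 < C.SFsq s x := lt_of_le_of_ne (hC.SFsq_nonneg s hx) hP.symm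
  have hu : 1 - C.E s x ≠ 0 := sub_ne_zero.2 hE.symm
  have hu1 : HasPd a (fun y => 1 + (-1) * C.E s y) (-1 * C.sigma s x a) x :=
    ((hC.hasPd_E s hx a).const_mul (-1)).const_add 1
  have hu2 : (fun y => 1 + (-1) * C.E s y) = fun y => 1 - C.E s y := by funext y; ring
  rw [hu2] at hu1
  have hv := hu1.inv hu
  have hP1 : HasPd a (C.SFsq s) (4 * lower1 C.g x (C.Y s x) a) x :=
    ⟨diffAt_of_smooth (hC.smooth_SFsq s hx), hC.pd_SFsq_eq_lower s hx a⟩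
  have hq := hP1.mul ((hv.mul hv).mul (hv.mul hv))
  have hq2 : (fun y => C.SFsq s y * ((1 - C.E s y)⁻¹ * (1 - C.E s y)⁻¹
      * ((1 - C.E s y)⁻¹ * (1 - C.E s y)⁻¹))) = fun y => C.SFsq s y / (1 - C.E s y) ^ 4 := by
    funext y
    rw [div_eq_mul_inv, ← inv_pow]; ring
  rw [hq2] at hq
  have hpos : 0 < C.SFsq s x / (1 - C.E s x) ^ 4 := div_pos hP0 (by positivity)
  have hd := hasDerivAt_sqrt_rpow hpos β
  refine ⟨DifferentiableAt.comp (g := fun t => Real.sqrt t ^ β) x hd.differentiableAt hq.1, ?_⟩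
  have := pd_comp (f := fun y => C.SFsq s y / (1 - C.E s y) ^ 4) a hd hq.1
  rw [hq.2] at this
  refine this.trans ?_
  change β / 2 * C.sAbs s x ^ β / _ * _ = _
  field_simp
  ring

/-- Where `λ (𝓕^±)² (1 - 𝓔^±) ≠ 0`, the current is a combination of `σ^±`, `σ^∓` and the gradient
of `(𝓕^±)²`. -/
theorem Psi_eq (s : ℤˣ) (β : ℝ) (hx : x ∈ U) (hP : C.SFsq s x ≠ 0) (hE : C.E s x ≠ 1)
    (a : Fin 4) : C.Psi s β x a
      = ((1 / 4) * ((1 + (-1) * C.E s x) * (1 + (-1) * C.E s x) * ((C.lam x)⁻¹ * (C.lam x)⁻¹))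
          * C.sAbs s x ^ β) * C.sigmaUp (-s) x a
        + ((β * ((1 + C.E (-s) x) * (C.lam x)⁻¹)
          + (-1 / 4) * ((1 + C.E (-s) x) * (1 + C.E (-s) x) * ((C.lam x)⁻¹ * (C.lam x)⁻¹)))
          * C.sAbs s x ^ β) * C.sigmaUp s x a
        + (β * ((1 + C.E (-s) x) * (1 + (-1) * C.E s x) * ((C.lam x)⁻¹ * (C.SFsq s x)⁻¹))
          * C.sAbs s x ^ β) * C.Y s x a := by
  have hu : 1 - C.E s x ≠ 0 := sub_ne_zero.2 hE.symm
  have h1 : ∀ b, pd b (fun y => C.sAbs s y ^ β) x = β * C.sAbs s x ^ β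
      * (2 * (C.SFsq s x)⁻¹ * lower1 C.g x (C.Y s x) b
        + 2 * (1 - C.E s x)⁻¹ * C.sigma s x b) := fun b =>
    (hC.hasPd_sAbs_rpow s β hx hP hE b).2
  have h2 : raise1 C.g x (lower1 C.g x (C.Y s x)) a = C.Y s x a := by
    have h : (gM C.g x)⁻¹.mulVec ((gM C.g x).mulVec (C.Y s x)) = C.Y s x := by
      rw [Matrix.mulVec_mulVec, hC.metric.inv_mul hx, Matrix.one_mulVec]
    exact congrFun h a
  have h3 : raise1 C.g x (fun b => pd b (fun y => C.sAbs s y ^ β) x) a = β * C.sAbs s x ^ β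
      * (2 * (C.SFsq s x)⁻¹ * C.Y s x a + 2 * (1 - C.E s x)⁻¹ * C.sigmaUp s x a) := by
    rw [← h2]
    simp only [h1, raise1, Coords.sigmaUp, Finset.mul_sum, ← Finset.sum_add_distrib]
    exact Finset.sum_congr rfl fun b _ => by ring
  rw [Coords.Psi, h3, C.J_eq]
  have h4 : (1 - C.E s x) * (1 - C.E s x)⁻¹ = 1 := mul_inv_cancel₀ hu
  linear_combination (β * C.sAbs s x ^ β * (1 + C.E (-s) x) * (C.lam x)⁻¹ * C.sigmaUp s x a) * h4

/-- Pairings of `σ^±` and of the gradient of `(𝓕^±)²`, in a frame of self-dual bivectors. -/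
theorem inner_of_frame (hx : x ∈ U) {s : ℤˣ} {Θ : Fin 3 → Matrix (Fin 4) (Fin 4) ℝ}
    {w : Matrix (Fin 3) (Fin 3) ℝ} (hΘ : IsSDFrame C.g s x Θ w) :
    (∑ a, lower1 C.g x (C.sigmaUp s x) a * C.sigmaUp s x a = C.lam x * C.SFsq s x) ∧
    (∑ a, lower1 C.g x (C.sigmaUp s x) a * C.Y s x a = -4 * C.lam x
      * ∑ q, (∑ p, frameCoef C x Θ p * w p q) * frameCoef C x Θ q) ∧
    (∑ a, lower1 C.g x (C.Y s x) a * C.Y s x a = 4 * C.lam x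
      * ∑ q, (∑ p, frameCoef C x Θ p * w p q) ^ 2) := by
  have h1 : C.sigmaUp s x = fun a => ∑ p, (2 * frameCoef C x Θ p) * frameVec C x Θ p a :=
    funext (hC.sigmaUp_eq_sum hx hΘ)
  have h2 : C.Y s x
      = fun e => ∑ q, (-2 * ∑ p, frameCoef C x Θ p * w p q) * frameVec C x Θ q e :=
    funext (hC.Y_eq_sum hx hΘ)
  refine ⟨?_, ?_, ?_⟩
  · rw [h1, hC.SFsq_eq_sum hx hΘ]
    refine (hC.sum_frameVec_inner hx hΘ (fun p => 2 * frameCoef C x Θ p)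
      (fun p => 2 * frameCoef C x Θ p)).trans ?_
    simp only [Finset.mul_sum]
    exact Finset.sum_congr rfl fun p _ => by ring
  · rw [h1, h2]
    refine (hC.sum_frameVec_inner hx hΘ (fun p => 2 * frameCoef C x Θ p)
      (fun q => -2 * ∑ p, frameCoef C x Θ p * w p q)).trans ?_
    rw [Finset.mul_sum, Finset.mul_sum]
    exact Finset.sum_congr rfl fun p _ => by ring
  · rw [h2]
    refine (hC.sum_frameVec_inner hx hΘ (fun q => -2 * ∑ p, frameCoef C x Θ p * w p q)
      (fun q => -2 * ∑ p, frameCoef C x Θ p * w p q)).trans ?_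
    rw [Finset.mul_sum, Finset.mul_sum]
    exact Finset.sum_congr rfl fun p _ => by ring

theorem lower1_inner_comm (hx : x ∈ U) (v w : Fin 4 → ℝ) :
    ∑ a, lower1 C.g x v a * w a = ∑ a, lower1 C.g x w a * v a := by
  simp only [lower1, Finset.sum_mul]
  rw [Finset.sum_comm]
  refine Finset.sum_congr rfl fun a _ => Finset.sum_congr rfl fun b _ => ?_
  rw [hC.metric.symm x hx b a]; ring

omit hC in
/-- The invariants `(𝓢^±)²` and `(𝓕^± 𝓢^±)²` in terms of the matrix `w` of `𝓦^±` and the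
coefficients `f` of `𝓕^±`. -/
theorem sMatrix_invariants {Θ : Fin 3 → Matrix (Fin 4) (Fin 4) ℝ} {s : ℤˣ}
    {w : Matrix (Fin 3) (Fin 3) ℝ} (hΘ : IsSDFrame C.g s x Θ w) (k : ℝ)
    (hk : k = (1 - C.E s x)⁻¹) :
    (∑ p, ∑ q, sMatrix C s x Θ w p q ^ 2
      = ∑ p, ∑ q, w p q ^ 2
        - 12 * k * ∑ q, (∑ p, frameCoef C x Θ p * w p q) * frameCoef C x Θ q
        + 24 * k ^ 2 * (∑ p, frameCoef C x Θ p ^ 2) ^ 2) ∧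
    (∑ p, (∑ q, sMatrix C s x Θ w p q * frameCoef C x Θ q) ^ 2
      = ∑ q, (∑ p, frameCoef C x Θ p * w p q) ^ 2
        - 8 * k * (∑ p, frameCoef C x Θ p ^ 2)
          * ∑ q, (∑ p, frameCoef C x Θ p * w p q) * frameCoef C x Θ q
        + 16 * k ^ 2 * (∑ p, frameCoef C x Θ p ^ 2) ^ 3) := by
  have ht : w 2 2 = - w 0 0 - w 1 1 := by
    have := hΘ.w_trace
    rw [Matrix.trace, Fin.sum_univ_three] at this
    simp only [Matrix.diag_apply] at this
    linarith
  have h10 : w 1 0 = w 0 1 := congrFun₂ hΘ.w_symm 0 1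
  have h20 : w 2 0 = w 0 2 := congrFun₂ hΘ.w_symm 0 2
  have h21 : w 2 1 = w 1 2 := congrFun₂ hΘ.w_symm 1 2
  have h6 : 6 / (1 - C.E s x) = 6 * k := by rw [hk, div_eq_mul_inv]
  simp only [sMatrix, Fin.sum_univ_three, h6, h10, h20, h21, ht, Fin.isValue, if_true,
    show ((0 : Fin 3) = 1) = False by simp, show ((0 : Fin 3) = 2) = False by simp,
    show ((1 : Fin 3) = 0) = False by simp, show ((1 : Fin 3) = 2) = False by simp,
    show ((2 : Fin 3) = 0) = False by simp, show ((2 : Fin 3) = 1) = False by simp, if_false]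
  constructor <;> ring

/-- The divergence identity in a coordinate domain. By `Psi_eq` the divergence is a combination of
the divergences and the pairwise inner products of `σ^±`, `σ^∓` and `Y`; a frame turns these into
invariants of `f` and `w`, and the terms which involve the opposite chirality cancel. -/
theorem divergence_Psi (s : ℤˣ) (β : ℝ) (hx : x ∈ U) (hl : C.lam x ≠ 0) (hP : C.SFsq s x ≠ 0)
    (hE : C.E s x ≠ 1) :
    (∀ a, DifferentiableAt ℝ (fun y => C.Psi s β y a) x) ∧
    divergence C.g (C.Psi s β) x
      = (1 + C.E (-s) x) * (1 - C.E s x) / (2 * C.lam x) * C.V s β x * C.sAbs s x ^ β := by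
  have hu0 : 1 - C.E s x ≠ 0 := sub_ne_zero.2 hE.symm
  -- the formula for the current holds near `x`
  have hev : ∀ᶠ y in 𝓝 x, y ∈ U ∧ C.SFsq s y ≠ 0 ∧ C.E s y ≠ 1 :=
    Filter.Eventually.and (hC.metric.mem_nhds hx)
      (((hC.smooth_SFsq s hx).continuousAt.eventually_ne hP).and
      ((hC.smooth_E s hx).continuousAt.eventually_ne hE))
  have hPsi : ∀ᶠ y in 𝓝 x, ∀ a, C.Psi s β y a = _ :=
    hev.mono fun y hy a => hC.Psi_eq s β hy.1 hy.2.1 hy.2.2 a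
  -- derivatives of the coefficients
  have hu : ∀ a, HasPd a (fun y => 1 + (-1) * C.E s y) (-1 * C.sigma s x a) x := fun a =>
    ((hC.hasPd_E s hx a).const_mul (-1)).const_add 1
  have hw : ∀ a, HasPd a (fun y => 1 + C.E (-s) y) (C.sigma (-s) x a) x := fun a =>
    (hC.hasPd_E (-s) hx a).const_add 1
  have hi := fun a => (hC.hasPd_lam s hx a).inv hl
  have hP1 : ∀ a, HasPd a (C.SFsq s) (4 * lower1 C.g x (C.Y s x) a) x := fun a =>
    ⟨diffAt_of_smooth (hC.smooth_SFsq s hx), hC.pd_SFsq_eq_lower s hx a⟩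
  have hp := fun a => (hP1 a).inv hP
  have hr := fun a => hC.hasPd_sAbs_rpow s β hx hP hE a
  -- the coefficients of `σ^∓`, `σ^±` and `Y` in `Psi_eq`
  have hf1 := fun a => ((((hu a).mul (hu a)).mul ((hi a).mul (hi a))).const_mul (1 / 4)).mul (hr a)
  have hf2 := fun a => ((((hw a).mul (hi a)).const_mul β).add
    ((((hw a).mul (hw a)).mul ((hi a).mul (hi a))).const_mul (-1 / 4))).mul (hr a)
  have hf3 := fun a => ((((hw a).mul (hu a)).mul ((hi a).mul (hp a))).const_mul β).mul (hr a)
  have dσ : ∀ t a, DifferentiableAt ℝ (fun y => C.sigmaUp t y a) x := fun t a =>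
    diffAt_of_smooth (hC.smooth_sigmaUp t hx a)
  have dY : ∀ a, DifferentiableAt ℝ (fun y => C.Y s y a) x := fun a =>
    diffAt_of_smooth (hC.smooth_Y s hx a)
  have d1 := fun a => (hf1 0).1.fun_mul (dσ (-s) a)
  have d2 := fun a => (hf2 0).1.fun_mul (dσ s a)
  have d3 := fun a => (hf3 0).1.fun_mul (dY a)
  refine ⟨fun a => (((d1 a).fun_add (d2 a)).fun_add (d3 a)).congr_of_eventuallyEq
    (hPsi.mono fun y hy => hy a), ?_⟩
  rw [divergence_congr hPsi,
    divergence_add (fun a => (d1 a).fun_add (d2 a)) d3, divergence_add d1 d2,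
    divergence_mul (hf1 0).1 (dσ (-s)), divergence_mul (hf2 0).1 (dσ s),
    divergence_mul (hf3 0).1 dY, hC.divergence_sigmaUp_eq s hx, hC.divergence_sigmaUp_eq (-s) hx]
  simp only [(hf1 _).2, (hf2 _).2, (hf3 _).2]
  set u := 1 - C.E s x with hud
  rw [show (1 : ℝ) + -1 * C.E s x = u by rw [hud]; ring]
  set w := 1 + C.E (-s) x with hwd
  set ρ := C.sAbs s x ^ β with hρ
  set l := (C.lam x)⁻¹ with hl'
  set κ := (C.SFsq s x)⁻¹ with hκ
  set v := u⁻¹ with hv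
  simp only [hC.sigma_eq_lower _ hx]
  set σ := C.sigmaUp s x with hσ
  set τ := C.sigmaUp (-s) x with hτ
  set Y := C.Y s x with hY
  -- each gradient is a combination of `σ^±`, `σ^∓` and `Y`, because `∇𝓔^± = σ^±`,
  -- `λ = (𝓔^+ + 𝓔^-) / 2` and `∇(𝓕^±)² = 4 Y`
  have s1 : ∀ c₁ c₂ c₃ : ℝ, ∀ X Z : Fin 4 → ℝ, (∀ a, Z a = c₁ * lower1 C.g x σ a
      + c₂ * lower1 C.g x τ a + c₃ * lower1 C.g x Y a) → ∑ a, Z a * X a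
      = c₁ * ∑ a, lower1 C.g x σ a * X a + c₂ * ∑ a, lower1 C.g x τ a * X a
        + c₃ * ∑ a, lower1 C.g x Y a * X a := by
    intro c₁ c₂ c₃ X Z h
    simp only [Finset.mul_sum, ← Finset.sum_add_distrib, h]
    exact Finset.sum_congr rfl fun a _ => by ring
  rw [s1 (ρ * (-(1 / 2) * u * l ^ 2 - (1 / 4) * u ^ 2 * l ^ 3 + (1 / 2) * u ^ 2 * l ^ 2 * β * v))
      (ρ * (-(1 / 4) * u ^ 2 * l ^ 3)) (ρ * ((1 / 2) * u ^ 2 * l ^ 2 * β * κ)) τ _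
      (fun a => by ring),
    s1 (ρ * (-(1 / 2) * β * w * l ^ 2 + (1 / 4) * w ^ 2 * l ^ 3
        + 2 * β * v * (β * w * l - (1 / 4) * w ^ 2 * l ^ 2)))
      (ρ * (β * l - (1 / 2) * β * w * l ^ 2 - (1 / 2) * w * l ^ 2 + (1 / 4) * w ^ 2 * l ^ 3))
      (ρ * (2 * β * κ * (β * w * l - (1 / 4) * w ^ 2 * l ^ 2))) σ _ (fun a => by ring),
    s1 (ρ * (-β * w * l * κ - (1 / 2) * β * w * u * l ^ 2 * κ + 2 * β ^ 2 * w * u * l * κ * v))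
      (ρ * (β * u * l * κ - (1 / 2) * β * w * u * l ^ 2 * κ))
      (ρ * (-4 * β * w * u * l * κ ^ 2 + 2 * β ^ 2 * w * u * l * κ ^ 2)) Y _ (fun a => by ring)]
  -- only `⟨σ^∓, σ^∓⟩` is needed in the opposite chirality, hence a separate frame for it
  obtain ⟨Θ', w', hΘ'⟩ := hC.exists_frame hx (-s)
  obtain ⟨Θ, W, hΘ⟩ := hC.exists_frame hx s
  obtain ⟨i1, i2, i3⟩ := hC.inner_of_frame hx hΘ
  have i4 := (hC.inner_of_frame hx hΘ').1
  rw [← hσ] at i1 i2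
  rw [← hY] at i2 i3
  rw [← hτ] at i4
  rw [hC.lower1_inner_comm hx σ τ, hC.lower1_inner_comm hx Y τ, hC.lower1_inner_comm hx Y σ,
    i1, i2, i3, i4, hC.divergence_Y_eq_of_frame hx hΘ, Coords.V, hC.Ssq_eq_sum hx hΘ,
    hC.FSsq_eq_sum hx hΘ, (sMatrix_invariants hΘ v hv).1, (sMatrix_invariants hΘ v hv).2]
  have hN := hC.SFsq_eq_sum hx hΘ
  have hA : ∑ p, ∑ q, frameCoef C x Θ p * W p q * frameCoef C x Θ q
      = ∑ q, (∑ p, frameCoef C x Θ p * W p q) * frameCoef C x Θ q := by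
    rw [Finset.sum_comm]
    exact Finset.sum_congr rfl fun q _ => by rw [Finset.sum_mul]
  rw [hA]
  have hlam : C.lam x = (1 / 2) * (w - u) := by
    rw [C.lam_eq_half s, hud, hwd]; ring
  -- what remains is an identity between rational functions of the scalars; the mixed products
  -- `q`, `r` and the square `P'` of the opposite chirality drop out of it
  generalize ∑ a, lower1 C.g x τ a * σ a = q at *
  generalize ∑ a, lower1 C.g x τ a * Y a = r at *
  generalize ∑ q, (∑ p, frameCoef C x Θ p * W p q) * frameCoef C x Θ q = A at *
  generalize ∑ q, (∑ p, frameCoef C x Θ p * W p q) ^ 2 = B at *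
  generalize ∑ p, ∑ q, W p q ^ 2 = D at *
  generalize ∑ p, frameCoef C x Θ p ^ 2 = N at *
  have hN' : N = C.SFsq s x / 4 := by rw [hN]; ring
  have hw' : w = u + 2 * C.lam x := by rw [hlam]; ring
  rw [hN', hw', hv, hκ, hl']
  generalize C.lam x = m at *
  generalize C.SFsq s x = P at *
  generalize C.SFsq (-s) x = P' at *
  clear_value u ρ
  field_simp
  ring

end IsLocalSolution

/-! ### The strong maximum principle -/

/-- The gradient of a function. -/
def grad {n : ℕ} (g : Eucl n → Fin n → Fin n → ℝ) (f : Eucl n → ℝ) (x : Eucl n) : Fin n → ℝ :=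
  raise1 g x fun b => pd b f x

section

variable {n : ℕ} {f : Eucl n → ℝ} {x : Eucl n}

theorem fderiv_eq_sum_pd (f : Eucl n → ℝ) (x v : Eucl n) :
    fderiv ℝ f x v = ∑ a, v a * pd a f x := by
  conv_lhs => rw [← (EuclideanSpace.basisFun (Fin n) ℝ).sum_repr v]
  simp [pd]

/-- At a local maximum the differential vanishes and the Hessian is nonpositive. -/
theorem hessian_nonpos_of_isLocalMax (hf : ∀ᶠ y in 𝓝 x, ContDiffAt ℝ ∞ f y) (hmax : IsLocalMax f x)
    (v : Eucl n) : ∑ a, ∑ b, v a * v b * pd a (pd b f) x ≤ 0 := by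
  set γ : ℝ → Eucl n := fun t => x + t • v with hγ
  have hγc : Continuous γ := by fun_prop
  have hγ0 : γ 0 = x := by simp [hγ]
  have hγt : Tendsto γ (𝓝 0) (𝓝 x) := by simpa [hγ0] using hγc.tendsto 0
  have hγd : ∀ t, HasDerivAt γ v t := fun t => by
    have h := ((hasDerivAt_id t).smul_const v).const_add x
    rwa [one_smul] at h
  have hd : ∀ {k : Eucl n → ℝ} {t : ℝ}, DifferentiableAt ℝ k (γ t) →
      HasDerivAt (fun t => k (γ t)) (∑ a, v a * pd a k (γ t)) t := by
    intro k t hk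
    rw [← fderiv_eq_sum_pd]
    exact hk.hasFDerivAt.comp_hasDerivAt t (hγd t)
  have h1 : deriv (fun t => f (γ t)) =ᶠ[𝓝 0] fun t => ∑ b, v b * pd b f (γ t) :=
    (hγt.eventually hf).mono fun t ht => (hd (diffAt_of_smooth ht)).deriv
  have hfx : ContDiffAt ℝ ∞ f x := hf.self_of_nhds
  have h2 : deriv (deriv fun t => f (γ t)) 0 = ∑ a, ∑ b, v a * v b * pd a (pd b f) x := by
    rw [h1.deriv_eq]
    have h3 : ∀ b ∈ (Finset.univ : Finset (Fin n)), HasDerivAt (fun t => v b * pd b f (γ t))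
        (v b * ∑ a, v a * pd a (pd b f) (γ 0)) 0 := fun b _ =>
      (hd (by rw [hγ0]; exact diffAt_of_smooth (contDiffAt_pd b hfx))).const_mul _
    rw [(HasDerivAt.fun_sum h3).deriv, hγ0, Finset.sum_comm]
    simp only [Finset.mul_sum]
    exact Finset.sum_congr rfl fun a _ => Finset.sum_congr rfl fun b _ => by ring
  have hmax' : IsLocalMax (fun t => f (γ t)) 0 := by
    have : ∀ᶠ t in 𝓝 (0 : ℝ), f (γ t) ≤ f x := hγt.eventually hmax
    simpa [IsLocalMax, IsMaxFilter, hγ0] using this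
  by_contra! hpos
  rw [← h2] at hpos
  have hmin := isLocalMin_of_deriv_deriv_pos hpos hmax'.deriv_eq_zero
    (hd (by rw [hγ0]; exact diffAt_of_smooth hfx)).continuousAt
  have hconst : (fun t => f (γ t)) =ᶠ[𝓝 0] fun _ => f x := by
    filter_upwards [hmin, hmax'] with t h1 h2
    simp only [hγ0] at h1 h2
    exact le_antisymm h2 h1
  have h0 : deriv (deriv fun t => f (γ t)) 0 = 0 := by
    rw [hconst.deriv.deriv_eq]; simp
  exact hpos.ne' h0

end

namespace IsMetricOn

variable {n : ℕ} {g : Eucl n → Fin n → Fin n → ℝ} {U : Set (Eucl n)} {f h : Eucl n → ℝ}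
  {x : Eucl n} (hg : IsMetricOn g U)
include hg

theorem smooth_grad (hx : x ∈ U) (hf : ContDiffAt ℝ ∞ f x) (a : Fin n) :
    ContDiffAt ℝ ∞ (fun y => grad g f y a) x := by
  unfold grad raise1
  exact ContDiffAt.sum fun b _ => (hg.smooth_ginv hx a b).mul (contDiffAt_pd b hf)

theorem smooth_divergence_grad (hx : x ∈ U) (hf : ∀ y ∈ U, ContDiffAt ℝ ∞ f y) :
    ContDiffAt ℝ ∞ (divergence g (grad g f)) x :=
  ContDiffAt.sum fun a _ => (contDiffAt_pd a (hg.smooth_grad hx (hf x hx) a)).add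
    (ContDiffAt.sum fun b _ => (hg.smooth_chr hx a a b).mul (hg.smooth_grad hx (hf x hx) b))

open scoped MatrixOrder ComplexOrder Matrix.Norms.L2Operator in
/-- The Laplacian is nonpositive at a local maximum: there it is a sum of Hessian terms along the
rows of a square root of the inverse metric. -/
theorem divergence_grad_nonpos_of_isLocalMax (hx : x ∈ U) (hf : ∀ y ∈ U, ContDiffAt ℝ ∞ f y)
    (hmax : IsLocalMax f x) : divergence g (grad g f) x ≤ 0 := by
  have hz : ∀ b, pd b f x = 0 := fun b => by rw [pd, hmax.fderiv_eq_zero]; rfl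
  have h1 : divergence g (grad g f) x = ∑ a, ∑ b, ginv g x a b * pd a (pd b f) x := by
    simp only [divergence]
    refine Finset.sum_congr rfl fun a _ => ?_
    have e1 : ∀ b, grad g f x b = 0 := fun b => by simp [grad, raise1, hz]
    have e2 : pd a (fun y => grad g f y a) x = ∑ b, ginv g x a b * pd a (pd b f) x := by
      refine (pd_sum_mul a (hg.smooth_ginv hx a) fun b => contDiffAt_pd b (hf x hx)).trans ?_
      simp [hz]
    simp [e1, e2]
  have hpos : (gM g x)⁻¹.PosDef := (hg.posDef x hx).inv
  obtain ⟨B, hB⟩ := CStarAlgebra.nonneg_iff_eq_star_mul_self.mp hpos.posSemidef.nonneg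
  have h2 : ∀ a b, ginv g x a b = ∑ k, B k a * B k b := by
    intro a b
    have := congrFun₂ hB a b
    rw [Matrix.mul_apply] at this
    exact this
  have h3 : divergence g (grad g f) x = ∑ k, ∑ a, ∑ b, B k a * B k b * pd a (pd b f) x := by
    rw [h1, Finset.sum_comm' (t' := Finset.univ) (s' := fun _ => Finset.univ) (by simp)]
    simp only [h2, Finset.sum_mul]
    conv_rhs => rw [Finset.sum_comm]
    rw [Finset.sum_comm]
    refine Finset.sum_congr rfl fun a _ => Finset.sum_comm
  rw [h3]
  exact Finset.sum_nonpos fun k _ => hessian_nonpos_of_isLocalMax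
    ((eventually_of_mem (hg.isOpen.mem_nhds hx)) hf) hmax (WithLp.toLp 2 (B k))

/-- Hopf's argument: a subsolution cannot attain its maximum at an interior point `p` of `U` which
lies on the boundary of a closed ball in the rest of which it is strictly smaller. Otherwise, adding
a small multiple of a strict subsolution `v` with the sign of the ball's defining function would
produce an interior maximum near `p`. -/
theorem not_touching (hf : ∀ y ∈ U, ContDiffAt ℝ ∞ f y)
    (hsub : ∀ y ∈ U, 0 ≤ divergence g (grad g f) y)
    {m : ℝ} (hm : ∀ y ∈ U, f y ≤ m) {c p : Eucl n} (hp : p ∈ U) (hcp : c ≠ p)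
    (hball : ∀ y ∈ U, dist y c ≤ dist p c → y ≠ p → f y < m) : f p < m := by
  by_contra! hfp
  have hfp : f p = m := le_antisymm (hm p hp) hfp
  -- `q` is positive inside the ball and vanishes on its boundary
  set q : Eucl n → ℝ := fun z => dist p c ^ 2 - dist z c ^ 2 with hq
  have hqs : ContDiff ℝ ∞ q := by
    have : q = fun z => dist p c ^ 2 - ‖z - c‖ ^ 2 := by funext z; simp [hq, dist_eq_norm]
    rw [this]
    exact contDiff_const.sub ((contDiff_id.sub contDiff_const).norm_sq ℝ)
  have hqd : ∀ a z, pd a q z = -2 * (z a - c a) := by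
    intro a z
    have h1 : HasFDerivAt q (-(2 • innerSL ℝ (z - c))) z := by
      have h2 := ((hasFDerivAt_id z).sub_const c).norm_sq.const_sub (dist p c ^ 2)
      have : q = fun z => dist p c ^ 2 - ‖z - c‖ ^ 2 := by funext z; simp [hq, dist_eq_norm]
      rw [this]
      simpa using h2
    rw [pd, h1.fderiv]
    simp [EuclideanSpace.inner_single_right]
  have hqp : q p = 0 := by simp [hq]
  set N := ∑ a, pd a q p * grad g q p a with hN
  have hNpos : 0 < N := by
    have hpos : (gM g p)⁻¹.PosDef := (hg.posDef p hp).inv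
    have hne : (fun a => pd a q p) ≠ 0 := by
      intro h0
      refine hcp (PiLp.ext fun a => ?_)
      have := congrFun h0 a
      simp only [hqd, Pi.zero_apply] at this
      linarith
    have := hpos.dotProduct_mulVec_pos hne
    simpa [dotProduct, Matrix.mulVec, hN, grad, raise1, ginv, gM] using this
  -- `v = q + ½ α q²` has Laplacian `Δq + α |∇q|²` where `q = 0`; this `α` makes it positive
  set α := (|divergence g (grad g q) p| + 1) / N with hα
  have hαpos : 0 < α := by positivity
  set v : Eucl n → ℝ := fun z => (1 / 2) * ((2 + α * q z) * q z) with hv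
  have hvs : ContDiff ℝ ∞ v := contDiff_const.mul
    ((contDiff_const.add (contDiff_const.mul hqs)).mul hqs)
  have hqdiff : ∀ z, DifferentiableAt ℝ q z := fun z => diffAt_of_smooth hqs.contDiffAt
  have hvd : ∀ a z, pd a v z = (1 + α * q z) * pd a q z := by
    intro a z
    have h1 : HasPd a q (pd a q z) z := ⟨hqdiff z, rfl⟩
    have h2 := (((h1.const_mul α).const_add 2).mul h1).const_mul (1 / 2)
    rw [h2.2]; ring
  have hLv : divergence g (grad g v) p = divergence g (grad g q) p + α * N := by
    have e1 : grad g v = fun y a => (1 + α * q y) * grad g q y a := by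
      funext y a
      simp only [grad, raise1, hvd, Finset.mul_sum]
      exact Finset.sum_congr rfl fun b _ => by ring
    have h1 : ∀ a, HasPd a (fun y => 1 + α * q y) (α * pd a q p) p := fun a =>
      HasPd.const_add 1 (HasPd.const_mul α ⟨hqdiff p, rfl⟩)
    have hd : DifferentiableAt ℝ (fun y => 1 + α * q y) p :=
      ((hqdiff p).const_mul α).const_add 1
    rw [e1, divergence_mul hd fun a => diffAt_of_smooth (hg.smooth_grad hp hqs.contDiffAt a), hqp,
      hN, Finset.mul_sum]
    simp only [(h1 _).2, mul_zero, add_zero, one_mul, mul_assoc]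
  have hLvpos : 0 < divergence g (grad g v) p := by
    have : α * N = |divergence g (grad g q) p| + 1 := by rw [hα]; field_simp
    rw [hLv, this]
    linarith [neg_abs_le (divergence g (grad g q) p)]
  -- a closed ball around `p` on which `v` is a strict subsolution with the same sign as `q`
  have hnear : ∀ᶠ z in 𝓝 p, z ∈ U ∧ 0 < divergence g (grad g v) z ∧ 0 < 2 + α * q z := by
    refine Filter.Eventually.and (hg.isOpen.mem_nhds hp) (Filter.Eventually.and ?_ ?_)
    · exact (hg.smooth_divergence_grad hp fun y _ => hvs.contDiffAt).continuousAt.eventually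
        (lt_mem_nhds hLvpos)
    · have hc : Continuous fun z => 2 + α * q z :=
        continuous_const.add (continuous_const.mul hqs.continuous)
      exact hc.continuousAt.eventually (lt_mem_nhds (by simp [hqp]))
  obtain ⟨δ, hδ, hball'⟩ := Metric.nhds_basis_closedBall.mem_iff.1 hnear
  -- `f` is bounded away from `m` where the sphere meets the large ball
  obtain ⟨ε, hε, hS⟩ : ∃ ε > 0, ∀ z, dist z p = δ → dist z c ≤ dist p c → f z + ε * v z < m := by
    have hK : IsCompact (Metric.sphere p δ ∩ Metric.closedBall c (dist p c)) :=
      (isCompact_sphere p δ).inter_right Metric.isClosed_closedBall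
    have hsubU : Metric.sphere p δ ∩ Metric.closedBall c (dist p c) ⊆ U := fun z hz =>
      (hball' (Metric.sphere_subset_closedBall hz.1)).1
    have hfc : ContinuousOn f (Metric.sphere p δ ∩ Metric.closedBall c (dist p c)) := fun z hz =>
      (hf z (hsubU hz)).continuousAt.continuousWithinAt
    rcases Set.eq_empty_or_nonempty (Metric.sphere p δ ∩ Metric.closedBall c (dist p c))
      with he | hne
    · refine ⟨1, one_pos, fun z h1 h2 => ?_⟩
      have : z ∈ (∅ : Set (Eucl n)) := he ▸ ⟨h1, h2⟩
      exact this.elim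
    · obtain ⟨z₁, hz₁, hmax₁⟩ := hK.exists_isMaxOn hne hfc
      obtain ⟨z₂, hz₂, hmax₂⟩ := hK.exists_isMaxOn hne hvs.continuous.continuousOn
      have hlt : f z₁ < m := hball z₁ (hsubU hz₁) hz₁.2 (by
        rintro rfl
        have : dist z₁ z₁ = δ := hz₁.1
        rw [dist_self] at this
        exact hδ.ne this)
      refine ⟨(m - f z₁) / (|v z₂| + 1), div_pos (sub_pos.2 hlt) (by positivity), fun z h1 h2 => ?_⟩
      have hzK : z ∈ Metric.sphere p δ ∩ Metric.closedBall c (dist p c) := ⟨h1, h2⟩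
      have hA : f z ≤ f z₁ := hmax₁ hzK
      have hB : v z ≤ |v z₂| := (hmax₂ hzK).trans (le_abs_self _)
      have hC : (m - f z₁) / (|v z₂| + 1) * v z < m - f z₁ := by
        rw [div_mul_eq_mul_div, div_lt_iff₀ (by positivity)]
        exact mul_lt_mul_of_pos_left (by linarith) (sub_pos.2 hlt)
      linarith
  have hFs : ∀ y ∈ U, ContDiffAt ℝ ∞ (fun z => f z + ε * v z) y := fun y hy =>
    (hf y hy).add (contDiffAt_const.mul hvs.contDiffAt)
  have hsubU : Metric.closedBall p δ ⊆ U := fun z hz => (hball' hz).1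
  obtain ⟨z, hz, hzmax⟩ := (isCompact_closedBall p δ).exists_isMaxOn
    ⟨p, Metric.mem_closedBall_self hδ.le⟩
    (fun y hy => (hFs y (hsubU hy)).continuousAt.continuousWithinAt)
  have hvp : v p = 0 := by simp [hv, hqp]
  have hzm : m ≤ f z + ε * v z := by
    have := hzmax (Metric.mem_closedBall_self hδ.le)
    simpa [hfp, hvp] using this
  have hzint : z ∈ Metric.ball p δ := by
    rcases (Metric.mem_closedBall.1 hz).lt_or_eq with h | h
    · exact h
    · exfalso
      rcases le_or_gt (dist z c) (dist p c) with h1 | h1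
      · exact (hS z h h1).not_ge hzm
      · have hqz : q z < 0 := by
          have : dist p c ^ 2 < dist z c ^ 2 := by gcongr
          simp only [hq]; linarith
        have hvz : v z < 0 := by
          have := mul_neg_of_pos_of_neg (hball' hz).2.2 hqz
          simp only [hv]; linarith
        have := mul_neg_of_pos_of_neg hε hvz
        linarith [hm z (hsubU hz)]
  have hloc : IsLocalMax (fun z => f z + ε * v z) z :=
    hzmax.isLocalMax
      (mem_of_superset (Metric.isOpen_ball.mem_nhds hzint) Metric.ball_subset_closedBall)
  have hle := hg.divergence_grad_nonpos_of_isLocalMax (hsubU hz) hFs hloc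
  have hsum : divergence g (grad g fun z => f z + ε * v z) z
      = divergence g (grad g f) z + ε * divergence g (grad g v) z := by
    have hz' := hsubU hz
    have hev : ∀ᶠ y in 𝓝 z, ∀ a, grad g (fun z => f z + ε * v z) y a
        = grad g f y a + ε * grad g v y a := by
      filter_upwards [hg.isOpen.mem_nhds hz'] with y hy a
      have h1 : ∀ b, pd b (fun z => f z + ε * v z) y = pd b f y + ε * pd b v y := fun b =>
        (HasPd.add ⟨diffAt_of_smooth (hf y hy), rfl⟩
          (HasPd.const_mul ε ⟨diffAt_of_smooth hvs.contDiffAt, rfl⟩)).2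
      simp only [grad, raise1, h1, Finset.mul_sum, ← Finset.sum_add_distrib]
      exact Finset.sum_congr rfl fun b _ => by ring
    have d1 : ∀ a, DifferentiableAt ℝ (fun y => grad g f y a) z := fun a =>
      diffAt_of_smooth (hg.smooth_grad hz' (hf z hz') a)
    have d2 : ∀ a, DifferentiableAt ℝ (fun y => grad g v y a) z := fun a =>
      diffAt_of_smooth (hg.smooth_grad hz' hvs.contDiffAt a)
    rw [divergence_congr hev, divergence_add d1 fun a => (d2 a).const_mul ε,
      divergence_mul (differentiableAt_const ε) d2]
    simp [pd_const]
  rw [hsum] at hle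
  linarith [hsub z (hsubU hz), mul_pos hε (hball' hz).2.1]

/-- The strong maximum principle: the set where a subsolution attains its maximum is open. A point
`y` off this set but near it has a nearest point `p` in it, and `not_touching` applies to the ball
with diameter from `p` to `y`, whose closure meets the set only in `p`. -/
theorem isOpen_setOf_eq_max (hf : ∀ y ∈ U, ContDiffAt ℝ ∞ f y)
    (hsub : ∀ y ∈ U, 0 ≤ divergence g (grad g f) y) {m : ℝ} (hm : ∀ y ∈ U, f y ≤ m)
    (hx : x ∈ U) (hfx : f x = m) : ∀ᶠ y in 𝓝 x, f y = m := by
  obtain ⟨r, hr, hball⟩ := Metric.nhds_basis_closedBall.mem_iff.1 (hg.isOpen.mem_nhds hx)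
  refine mem_of_superset (Metric.ball_mem_nhds x (half_pos hr)) fun y hy => ?_
  by_contra hfy
  have hyr : dist y x < r / 2 := hy
  -- the point of the maximum set nearest to `y`
  have hK : IsCompact (Metric.closedBall x r ∩ {z | f z = m}) := by
    have hc : ContinuousOn f (Metric.closedBall x r) := fun z hz =>
      (hf z (hball hz)).continuousAt.continuousWithinAt
    exact (isCompact_closedBall x r).of_isClosed_subset
      (hc.preimage_isClosed_of_isClosed Metric.isClosed_closedBall isClosed_singleton)
      inter_subset_left
  have hxK : x ∈ Metric.closedBall x r ∩ {z | f z = m} := ⟨Metric.mem_closedBall_self hr.le, hfx⟩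
  obtain ⟨p, hpK, hpd⟩ := hK.exists_isMinOn ⟨x, hxK⟩ (f := fun z => dist z y)
    (continuous_id.dist continuous_const).continuousOn
  have hpy : dist p y < r / 2 := lt_of_le_of_lt (hpd hxK) (by simpa [dist_comm] using hyr)
  have hpU := hball hpK.1
  have hyp : y ≠ p := by rintro rfl; exact hfy hpK.2
  set c := midpoint ℝ p y with hc
  have hcp : dist p c = dist p y / 2 := by
    rw [hc, dist_left_midpoint]; simp; ring
  have hcy : dist c y = dist p y / 2 := by
    rw [hc, dist_midpoint_right]; simp; ring
  have hcne : c ≠ p := by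
    intro h
    rw [h, dist_self] at hcp
    exact hyp (dist_eq_zero.1 (by linarith)).symm
  refine (hg.not_touching hf hsub hm hpU hcne fun z hz hzc hzp => ?_).ne hpK.2
  refine lt_of_le_of_ne (hm z hz) fun hzm => ?_
  have hzy : dist z y ≤ dist p y := by
    have := dist_triangle z c y
    linarith
  have hzx : dist z x ≤ r := by
    have := dist_triangle z y x
    linarith
  have hzy' : dist p y ≤ dist z y := hpd (show z ∈ _ from ⟨hzx, hzm⟩)
  -- equality in the triangle inequality forces `z = p` by strict convexity
  have e1 : dist z c = dist p y / 2 := by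
    have := dist_triangle z c y
    linarith
  have e2 := parallelogram_law_with_norm ℝ (z - c) (c - y)
  rw [sub_add_sub_cancel, ← dist_eq_norm z c, ← dist_eq_norm z y, ← dist_eq_norm c y, e1, hcy] at e2
  have e3 : ‖z - c - (c - y)‖ ^ 2 ≤ 0 := by
    nlinarith [dist_nonneg (x := p) (y := y)]
  have e4 : z - c - (c - y) = 0 := norm_eq_zero.1 (pow_eq_zero_iff two_ne_zero |>.1
    (le_antisymm e3 (sq_nonneg _)))
  have e5 : c + c = p + y := by rw [hc, midpoint_add_self]
  refine hzp ?_
  have : z - c - (c - y) = z - p + (p + y - (c + c)) := by abel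
  rw [this, e5, sub_self, add_zero] at e4
  exact sub_eq_zero.1 e4

end IsMetricOn

/-! ### Signs of the invariants, and the Ernst potential as a subharmonic function -/

namespace IsLocalSolution

variable {C : Coords} {U : Set (Eucl 4)} {x : Eucl 4} (hC : IsLocalSolution C U)
include hC

theorem lam_nonneg (hx : x ∈ U) : 0 ≤ C.lam x := by
  have h := (hC.metric.posDef x hx).posSemidef.dotProduct_mulVec_nonneg (C.ξ x)
  have : C.lam x = C.ξ x ⬝ᵥ (Matrix.of (C.g x)).mulVec (C.ξ x) := by
    rw [dotProduct_comm]; rfl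
  rw [this]
  simpa using h

theorem FSsq_le (s : ℤˣ) (hx : x ∈ U) : 3 * C.FSsq s x ≤ 2 * (C.SFsq s x * C.Ssq s x) := by
  obtain ⟨Θ, w, hΘ⟩ := hC.exists_frame hx s
  exact hC.FSsq_le_of_frame hx hΘ

theorem V_nonneg (s : ℤˣ) {β : ℝ} (hβ : 1 / 2 ≤ β) (hx : x ∈ U) : 0 ≤ C.V s β x := by
  have hFS : 0 ≤ C.FSsq s x := by
    obtain ⟨Θ, w, hΘ⟩ := hC.exists_frame hx s
    rw [hC.FSsq_eq_sum hx hΘ]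
    exact mul_nonneg (by norm_num) (Finset.sum_nonneg fun _ _ => sq_nonneg _)
  have h := hC.FSsq_le s hx
  refine div_nonneg (mul_nonneg (mul_nonneg (by linarith) (hC.lam_nonneg hx)) ?_) (by positivity)
  nlinarith

theorem isAlgSpecial (s : ℤˣ) (hx : x ∈ U) (hP : C.SFsq s x ≠ 0)
    (hS : C.SFsq s x * C.Ssq s x = C.FSsq s x) : C.IsAlgSpecial s x := by
  obtain ⟨Θ, w, hΘ⟩ := hC.exists_frame hx s
  exact hC.isAlgSpecial_of_frame hx hΘ hP hS

/-- The Laplacian of the Ernst potential is `(𝓕^±)²`. -/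
theorem divergence_grad_E (s : ℤˣ) (hx : x ∈ U) :
    divergence C.g (grad C.g (C.E s)) x = C.SFsq s x := by
  rw [← hC.divergence_sigmaUp_eq s hx]
  refine divergence_congr ?_
  filter_upwards [hC.metric.isOpen.mem_nhds hx] with y hy a
  simp only [grad, Coords.sigmaUp, raise1, hC.pd_E s hy]

theorem eventually_E_eq (s : ℤˣ) {m : ℝ} (hm : ∀ y ∈ U, C.E s y ≤ m) (hx : x ∈ U)
    (hE : C.E s x = m) : ∀ᶠ y in 𝓝 x, C.E s y = m :=
  hC.metric.isOpen_setOf_eq_max (fun _ hy => hC.smooth_E s hy)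
    (fun _ hy => by rw [hC.divergence_grad_E s hy]; exact hC.SFsq_nonneg s hy) hm hx hE

theorem SFsq_eq_zero_of_isLocalMax (s : ℤˣ) (hx : x ∈ U) (h : IsLocalMax (C.E s) x) :
    C.SFsq s x = 0 := by
  refine le_antisymm ?_ (hC.SFsq_nonneg s hx)
  rw [← hC.divergence_grad_E s hx]
  exact hC.metric.divergence_grad_nonpos_of_isLocalMax hx (fun _ hy => hC.smooth_E s hy) h

end IsLocalSolution

/-! ### Components in charts -/

section

variable {M : Type*} [TopologicalSpace M] [ChartedSpace (Eucl 4) M] [IsManifold (𝓡 4) ∞ M]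
  {e : OpenPartialHomeomorph M (Eucl 4)} (he : e ∈ IsManifold.maximalAtlas (𝓡 4) ∞ M) {x : Eucl 4}

include he

omit [IsManifold (𝓡 4) ∞ M] in
theorem mdifferentiable_of_mem_maximalAtlas : e.MDifferentiable (𝓡 4) (𝓡 4) :=
  ⟨(contMDiffOn_of_mem_maximalAtlas he).mdifferentiableOn (by simp),
    (contMDiffOn_symm_of_mem_maximalAtlas he).mdifferentiableOn (by simp)⟩

/-- Coordinate vector fields are smooth. -/
theorem smooth_coordVec (hx : x ∈ e.target) (a : Fin 4) :
    ContMDiffAt (𝓡 4) ((𝓡 4).prod 𝓘(ℝ, Eucl 4)) ∞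
      (fun y => (TotalSpace.mk' (Eucl 4) (e.symm y) (coordVec (n := 4) e.symm y a) :
        TangentBundle (𝓡 4) M)) x := by
  have h1 := (contMDiffOn_symm_of_mem_maximalAtlas he).contMDiffOn_tangentMapWithin
    (m := ∞) (by simp) e.open_target.uniqueMDiffOn
  have h2 : ContMDiffAt (𝓡 4) (𝓡 4).tangent ∞
      (fun y => (TotalSpace.mk' (Eucl 4) y (EuclideanSpace.single a (1 : ℝ) : Eucl 4) :
        TangentBundle (𝓡 4) (Eucl 4))) x := by
    rw [← contMDiffWithinAt_univ]
    exact contMDiffWithinAt_vectorSpace_iff_contDiffWithinAt.2 contDiffWithinAt_const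
  have h3 := (h1.contMDiffAt (x := TotalSpace.mk' (Eucl 4) x
    (EuclideanSpace.single a (1 : ℝ) : Eucl 4))
    ((e.open_target.preimage (FiberBundle.continuous_proj (Eucl 4) _)).mem_nhds hx)).comp x h2
  refine h3.congr_of_eventuallyEq ?_
  filter_upwards [e.open_target.mem_nhds hx] with y hy
  simp only [Function.comp, tangentMapWithin, coordVec, mfderivWithin_of_isOpen e.open_target hy]

theorem smooth_comp2 (g : Metric 4 M) (hx : x ∈ e.target) (a b : Fin 4) :
    ContDiffAt ℝ ∞ (fun y => comp2 g.inner e.symm y a b) x := by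
  have h1 := g.contMDiff.contMDiffAt.comp x (contMDiffAt_symm_of_mem_maximalAtlas he hx)
  have h2 := ContMDiffAt.clm_bundle_apply₂ (F₃ := ℝ) (E₃ := fun _ : M => ℝ)
    (b := e.symm) h1 (smooth_coordVec he hx a) (smooth_coordVec he hx b)
  have h3 := (contMDiffAt_totalSpace.1 h2).2
  exact h3.contDiffAt

theorem smooth_compV {ξ : ∀ p : M, TangentSpace (𝓡 4) p}
    (hξ : ContMDiff (𝓡 4) ((𝓡 4).prod 𝓘(ℝ, Eucl 4)) ∞
      (fun p => (TotalSpace.mk' (Eucl 4) p (ξ p) : TangentBundle (𝓡 4) M)))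
    (hx : x ∈ e.target) (a : Fin 4) : ContDiffAt ℝ ∞ (fun y => compV ξ e y a) x := by
  have h1 := (contMDiffOn_of_mem_maximalAtlas he).contMDiffOn_tangentMapWithin
    (m := ∞) (by simp) e.open_source.uniqueMDiffOn
  have h2 := hξ.contMDiffAt.comp x (contMDiffAt_symm_of_mem_maximalAtlas he hx)
  have h3 := (h1.contMDiffAt (x := TotalSpace.mk' (Eucl 4) (e.symm x) (ξ (e.symm x)))
    ((e.open_source.preimage (FiberBundle.continuous_proj (Eucl 4) _)).mem_nhds
      (e.map_target hx))).comp x h2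
  have h4 := (contMDiff_snd_tangentBundle_modelSpace (n := ∞) (Eucl 4) (𝓡 4)).contMDiffAt.comp x h3
  have h5 : ContDiffAt ℝ ∞
      (fun y => (mfderiv (𝓡 4) (𝓡 4) e (e.symm y) (ξ (e.symm y)) : Eucl 4)) x := by
    refine h4.contDiffAt.congr_of_eventuallyEq ?_
    filter_upwards [e.open_target.mem_nhds hx] with y hy
    simp only [Function.comp, tangentMapWithin,
      mfderivWithin_of_isOpen e.open_source (e.map_target hy)]
    rfl
  exact (contDiff_euclidean.1 contDiff_id a).contDiffAt.comp x h5

omit he [IsManifold (𝓡 4) ∞ M] in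
/-- The differential of the inverse chart, expanded in coordinate vector fields. -/
theorem coordVec_sum (v : Eucl 4) : mfderiv (𝓡 4) (𝓡 4) e.symm x v
    = ∑ a, v a • coordVec (n := 4) e.symm x a := by
  have h : ∀ D : Eucl 4 →L[ℝ] Eucl 4, D v = ∑ a, v a • D (EuclideanSpace.single a 1) := by
    intro D
    conv_lhs => rw [← (EuclideanSpace.basisFun (Fin 4) ℝ).sum_repr v]
    simp
  exact h (mfderiv (𝓡 4) (𝓡 4) e.symm x)

omit he in
theorem comp2_bilin (g : Metric 4 M) (v w : Eucl 4) :
    ∑ a, ∑ b, v a * w b * comp2 g.inner e.symm x a b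
      = g.inner (e.symm x) (mfderiv (𝓡 4) (𝓡 4) e.symm x v) (mfderiv (𝓡 4) (𝓡 4) e.symm x w) := by
  rw [coordVec_sum v, coordVec_sum w]
  simp only [map_sum, map_smul, sum_apply, smul_apply, smul_eq_mul,
    Finset.mul_sum, comp2]
  rw [Finset.sum_comm]
  exact Finset.sum_congr rfl fun a _ => Finset.sum_congr rfl fun b _ => by ring

theorem isMetricOn_comp2 (g : Metric 4 M) : IsMetricOn (comp2 g.inner e.symm) e.target where
  isOpen := e.open_target
  smooth _ hx a b := smooth_comp2 he g hx a b
  symm x _ a b := g.symm _ _ _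
  posDef x hx := by
    refine Matrix.PosDef.of_dotProduct_mulVec_pos ?_ fun v hv => ?_
    · ext a b
      simp only [Matrix.conjTranspose_apply, star_trivial, Matrix.of_apply]
      exact g.symm _ _ _
    · have h1 := comp2_bilin (x := x) (e := e) g (WithLp.toLp 2 v) (WithLp.toLp 2 v)
      have h2 : mfderiv (𝓡 4) (𝓡 4) e.symm x (WithLp.toLp 2 v : Eucl 4) ≠ 0 := by
        intro h0
        have h3 := (mdifferentiable_of_mem_maximalAtlas he).comp_symm_deriv hx
        have h4 : mfderiv (𝓡 4) (𝓡 4) e (e.symm x) (mfderiv (𝓡 4) (𝓡 4) e.symm x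
            (WithLp.toLp 2 v : Eucl 4)) = (WithLp.toLp 2 v : Eucl 4) :=
          congrArg (fun A => A (WithLp.toLp 2 v : Eucl 4)) h3
        have h5 : (WithLp.toLp 2 v : Eucl 4) = 0 :=
          h4.symm.trans ((congrArg _ h0).trans (map_zero _))
        exact hv (by simpa using h5)
      have h3 := g.pos _ _ h2
      rw [← h1] at h3
      refine h3.trans_eq ?_
      simp only [dotProduct, Matrix.mulVec, star_trivial, Matrix.of_apply, Finset.mul_sum]
      exact Finset.sum_congr rfl fun a _ => Finset.sum_congr rfl fun b _ => by
        change v a * v b * _ = v a * (_ * v b)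
        ring

/-- The coordinate expression `C.lam` is the square norm of `ξ` on the manifold. -/
theorem lam_coords (g : Metric 4 M) (ξ : ∀ p : M, TangentSpace (𝓡 4) p) (om : M → ℝ)
    (hx : x ∈ e.target) :
    (coords g ξ om e).lam x = g.inner (e.symm x) (ξ (e.symm x)) (ξ (e.symm x)) := by
  set v : Eucl 4 := mfderiv (𝓡 4) (𝓡 4) e (e.symm x) (ξ (e.symm x)) with hv
  have h1 : mfderiv (𝓡 4) (𝓡 4) e.symm x v = ξ (e.symm x) := by
    have h2 := (mdifferentiable_of_mem_maximalAtlas he).symm_comp_deriv (e.map_target hx)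
    rw [e.right_inv hx] at h2
    exact congrArg (fun A => A (ξ (e.symm x))) h2
  have h2 := comp2_bilin (x := x) (e := e) g v v
  rw [h1] at h2
  rw [← h2]
  simp only [Coords.lam, lower1, Finset.sum_mul]
  refine Finset.sum_congr rfl fun a _ => Finset.sum_congr rfl fun b _ => ?_
  have h3 : ∀ a, (coords g ξ om e).ξ x a = v a := fun _ => rfl
  rw [h3, h3]
  change comp2 g.inner e.symm x a b * _ * _ = _
  ring

/-- In an oriented chart a Ricci-flat metric with a Killing field and a twist potential is a local
solution, so that the coordinate results apply. -/
theorem isLocalSolution_coords {g : Metric 4 M} (hric : IsRicciFlat g) {𝒪 : OrientedAtlas M}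
    {ξ : ∀ p : M, TangentSpace (𝓡 4) p} (hξ : IsKilling g ξ) {om : M → ℝ}
    (hom : IsTwistPotential g 𝒪 ξ om) (he𝒪 : e ∈ 𝒪.charts) :
    IsLocalSolution (coords g ξ om e) e.target where
  metric := isMetricOn_comp2 he g
  smooth_ξ _ hx a := smooth_compV he hξ.1 hx a
  smooth_om x hx :=
    (hom.1.contMDiffAt.comp x (contMDiffAt_symm_of_mem_maximalAtlas he hx)).contDiffAt
  killing x hx a b := hξ.2 e he x hx a b
  ricciFlat x hx a b := hric e he x hx a b
  twist x hx a := hom.2 e he𝒪 x hx a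

end

/-! ### The Ernst potentials of an instanton -/

section

variable {M : Type*} [TopologicalSpace M] [ChartedSpace (Eucl 4) M] [IsManifold (𝓡 4) ∞ M]

theorem IsBoundaryType.nonempty {L : Type*} [TopologicalSpace L] [ChartedSpace (Eucl 3) L]
    (h : IsBoundaryType L) : Nonempty L := by
  have h1 : ∀ n : ℕ, Nonempty (Metric.sphere (0 : EuclideanSpace ℝ (Fin (n + 1))) 1) := fun n =>
    ⟨⟨EuclideanSpace.single 0 1, by simp⟩⟩
  rcases h with ⟨_, proj, _⟩ | ⟨_, proj, _⟩
  · exact ⟨proj (1, (h1 2).some)⟩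
  · exact ⟨proj (h1 3).some⟩

/-- An ALF manifold is not compact. -/
theorem ALFStructure.cocompact_neBot {g : Metric 4 M} {L : Type*} [TopologicalSpace L]
    [ChartedSpace (Eucl 3) L] [IsManifold (𝓡 3) ∞ L] (S : ALFStructure g L) :
    (cocompact M).NeBot := by
  obtain ⟨y⟩ := S.boundaryType.nonempty
  refine S.Φ_end.neBot_iff.2 fun {r} _ => ?_
  exact ⟨S.Φ (r + 1, y), mem_image_of_mem _ ⟨by simp, mem_univ y⟩⟩

/-- The Ernst potential as a function on the manifold. -/
def ernst (g : Metric 4 M) (ξ : ∀ p : M, TangentSpace (𝓡 4) p) (om : M → ℝ) (s : ℤˣ) (p : M) : ℝ :=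
  g.inner p (ξ p) (ξ p) + sgn s * om p

variable {g : Metric 4 M} {𝒪 : OrientedAtlas M} {ξ : ∀ p : M, TangentSpace (𝓡 4) p} {om : M → ℝ}

/-- The coordinate expression `C.E` is the restriction of `ernst` to the chart. -/
theorem E_coords {e : OpenPartialHomeomorph M (Eucl 4)} (he : e ∈ 𝒪.charts) {x : Eucl 4}
    (hx : x ∈ e.target) (s : ℤˣ) : (coords g ξ om e).E s x = ernst g ξ om s (e.symm x) := by
  rw [Coords.E, lam_coords (𝒪.subset_maximalAtlas he) g ξ om hx]
  rfl

variable (hric : IsRicciFlat g) (hξ : IsKilling g ξ) (hom : IsTwistPotential g 𝒪 ξ om)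
include hric hξ hom

theorem continuous_ernst (s : ℤˣ) : Continuous (ernst g ξ om s) := by
  rw [continuous_iff_continuousAt]
  intro p
  obtain ⟨e, he, hp⟩ := 𝒪.covers p
  have hC := isLocalSolution_coords (𝒪.subset_maximalAtlas he) hric hξ hom he
  have h1 : ContinuousAt ((coords g ξ om e).E s ∘ e) p :=
    (hC.smooth_E s (e.map_source hp)).continuousAt.comp (e.continuousAt hp)
  refine h1.congr ?_
  filter_upwards [e.open_source.mem_nhds hp] with q hq
  rw [Function.comp, E_coords he (e.map_source hq), e.left_inv hq]

/-- The Ernst potential of a connected manifold is constant if it attains its maximum: in each chart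
it is subharmonic. -/
theorem ernst_eq_of_max [ConnectedSpace M] (s : ℤˣ) {m : ℝ} (hm : ∀ p, ernst g ξ om s p ≤ m)
    {p : M} (hp : ernst g ξ om s p = m) (q : M) : ernst g ξ om s q = m := by
  have hclosed : IsClosed {q | ernst g ξ om s q = m} :=
    isClosed_eq (continuous_ernst hric hξ hom s) continuous_const
  have hopen : IsOpen {q | ernst g ξ om s q = m} := by
    refine isOpen_iff_mem_nhds.2 fun q hq => ?_
    obtain ⟨e, he, hqe⟩ := 𝒪.covers q
    have hC := isLocalSolution_coords (𝒪.subset_maximalAtlas he) hric hξ hom he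
    have h1 := hC.eventually_E_eq s (m := m) (x := e q)
      (fun y hy => by rw [E_coords he hy]; exact hm _) (e.map_source hqe)
      (by rw [E_coords he (e.map_source hqe), e.left_inv hqe]; exact hq)
    filter_upwards [(e.continuousAt hqe).eventually h1, e.open_source.mem_nhds hqe] with y hy hye
    rwa [E_coords he (e.map_source hye), e.left_inv hye] at hy
  have huniv := IsClopen.eq_univ ⟨hclosed, hopen⟩ ⟨p, hp⟩
  exact (huniv ▸ mem_univ q : q ∈ {q | ernst g ξ om s q = m})

/-- The Ernst potential is at most `1` if `λ ≤ 1` and `ω → 0` at infinity: a value above `1` would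
make it attain its maximum, hence be constant, against its behaviour at infinity. -/
theorem ernst_le_one [ConnectedSpace M] [(cocompact M).NeBot]
    (hlam : ∀ p, g.inner p (ξ p) (ξ p) ≤ 1) (hlim : Tendsto om (cocompact M) (𝓝 0))
    (s : ℤˣ) (p : M) : ernst g ξ om s p ≤ 1 := by
  by_contra! hp
  -- away from a compact set the potential is smaller than at `p`
  have hev : ∀ᶠ q in cocompact M, ernst g ξ om s q < ernst g ξ om s p := by
    have h1 : Tendsto (fun q => 1 + sgn s * om q) (cocompact M) (𝓝 1) := by
      simpa using (hlim.const_mul (sgn s)).const_add 1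
    filter_upwards [h1.eventually (gt_mem_nhds hp)] with q hq
    exact lt_of_le_of_lt (add_le_add_left (hlam q) _) hq
  obtain ⟨p₀, hp₀⟩ := (continuous_ernst hric hξ hom s).exists_forall_ge' (x₀ := p)
    (hev.mono fun q hq => hq.le)
  obtain ⟨q, hq⟩ := hev.exists
  have h1 := ernst_eq_of_max hric hξ hom s hp₀ rfl q
  exact (hq.trans_le (hp₀ p)).ne h1

end

end ALFInst

end

theorem lemma5p8 {M : Type*} [TopologicalSpace M] [T2Space M] [SecondCountableTopology M]
    [ChartedSpace (ALFInst.Eucl 4) M] [IsManifold (𝓡 4) ∞ M]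
    (g : ALFInst.Metric 4 M) (hric : ALFInst.IsRicciFlat g) (𝒪 : ALFInst.OrientedAtlas M)
    (ξ : ∀ p : M, TangentSpace (𝓡 4) p) (hξ : ALFInst.IsKilling g ξ)
    (om : M → ℝ) (hom : ALFInst.IsTwistPotential g 𝒪 ξ om) :
    -- the divergence identity, for every real `β`
    (∀ (s : ℤˣ) (β : ℝ), ∀ e ∈ 𝒪.charts, ∀ x ∈ e.target,
      let C := ALFInst.coords g ξ om e
      C.lam x ≠ 0 → C.SFsq s x ≠ 0 → C.E s x ≠ 1 →
        (∀ a, DifferentiableAt ℝ (fun y => C.Psi s β y a) x) ∧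
        ALFInst.divergence C.g (C.Psi s β) x =
          (1 + C.E (-s) x) * (1 - C.E s x) / (2 * C.lam x) * C.V s β x * C.sAbs s x ^ β) ∧
    -- nonnegativity of the potential for `β ≥ 1/2`
    (∀ (s : ℤˣ) (β : ℝ), 1 / 2 ≤ β → ∀ e ∈ 𝒪.charts, ∀ x ∈ e.target,
      let C := ALFInst.coords g ξ om e
      C.SFsq s x ≠ 0 → C.E s x ≠ 1 → 0 ≤ C.V s β x) ∧
    -- the case of a normalized ALF `S¹`-instanton, with `β = 1`
    (∀ {L : Type*} [TopologicalSpace L] [ChartedSpace (ALFInst.Eucl 3) L]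
        [IsManifold (𝓡 3) ∞ L] [ConnectedSpace M] [MulAction Circle M],
      ALFInst.IsCompleteMetric g → Nonempty (ALFInst.ALFStructure g L) →
      ALFInst.GeneratesCircleAction g ξ →
      IsLUB (range fun p => g.inner p (ξ p) (ξ p)) 1 →
      Tendsto om (cocompact M) (𝓝 0) →
      ∀ (s : ℤˣ), ∀ e ∈ 𝒪.charts, ∀ x ∈ e.target,
        let C := ALFInst.coords g ξ om e
        C.lam x ≠ 0 → C.SFsq s x ≠ 0 →
          C.E s x ≠ 1 ∧
          (∀ a, DifferentiableAt ℝ (fun y => C.Psi s 1 y a) x) ∧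
          ALFInst.divergence C.g (C.Psi s 1) x =
            (1 + C.E (-s) x) * (1 - C.E s x) / (2 * C.lam x)
              * (C.lam x * (C.SFsq s x * C.Ssq s x - C.FSsq s x) / (4 * C.SFsq s x ^ 2))
              * C.sAbs s x ∧
          0 ≤ ALFInst.divergence C.g (C.Psi s 1) x ∧
          (ALFInst.divergence C.g (C.Psi s 1) x = 0 → C.IsAlgSpecial s x)) := by
  have hsol := fun e (he : e ∈ 𝒪.charts) =>
    ALFInst.isLocalSolution_coords (𝒪.subset_maximalAtlas he) hric hξ hom he
  refine ⟨fun s β e he x hx hl hP hE => (hsol e he).divergence_Psi s β hx hl hP hE,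
    fun s β hβ e he x hx _ _ => (hsol e he).V_nonneg s hβ hx, ?_⟩
  intro L _ _ _ _ _ _ ⟨hALF⟩ _ hlub hlim s e he x hx C hl hP
  have hC := hsol e he
  have := hALF.cocompact_neBot
  have hle : ∀ y ∈ e.target, C.E s y ≤ 1 := fun y hy => by
    rw [ALFInst.E_coords he hy]
    exact ALFInst.ernst_le_one hric hξ hom (fun p => hlub.1 (mem_range_self p)) hlim s _
  -- a point with `𝓔^± = 1` would be a local maximum, where `(𝓕^±)²`, the Laplacian, vanishes
  have hE : C.E s x ≠ 1 := by
    intro hE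
    refine hP (hC.SFsq_eq_zero_of_isLocalMax s hx ?_)
    filter_upwards [e.open_target.mem_nhds hx] with y hy
    exact (hle y hy).trans_eq hE.symm
  obtain ⟨hdiff, hdiv⟩ := hC.divergence_Psi s 1 hx hl hP hE
  have hV : C.V s 1 x
      = C.lam x * (C.SFsq s x * C.Ssq s x - C.FSsq s x) / (4 * C.SFsq s x ^ 2) := by
    rw [ALFInst.Coords.V]; ring
  rw [Real.rpow_one] at hdiv
  have hlpos : 0 < C.lam x := lt_of_le_of_ne (hC.lam_nonneg hx) hl.symm
  have hu : 0 < 1 - C.E s x := sub_pos.2 (lt_of_le_of_ne (hle x hx) hE)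
  -- `𝓔^∓ = 2 λ - 𝓔^±`
  have hw : 0 < 1 + C.E (-s) x := by
    have := C.lam_eq_half s x
    linarith
  have hPpos : 0 < C.SFsq s x := lt_of_le_of_ne (hC.SFsq_nonneg s hx) hP.symm
  have hs : 0 < C.sAbs s x := Real.sqrt_pos.2 (div_pos hPpos (pow_pos hu 4))
  have hc : 0 < (1 + C.E (-s) x) * (1 - C.E s x) / (2 * C.lam x) := by positivity
  refine ⟨hE, hdiff, by rw [hdiv, hV], ?_, fun h0 => ?_⟩
  · rw [hdiv]
    exact mul_nonneg (mul_nonneg hc.le (hC.V_nonneg s (by norm_num) hx)) hs.le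
  · rw [hdiv, hV] at h0
    have h1 := (mul_eq_zero.1 ((mul_eq_zero.1 h0).resolve_right hs.ne')).resolve_left hc.ne'
    have h2 := (div_eq_zero_iff.1 h1).resolve_right (by positivity)
    exact hC.isAlgSpecial s hx hP (sub_eq_zero.1 ((mul_eq_zero.1 h2).resolve_left hl))
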